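/- Let $n\in\{4,5\}$, let $B=B^{n+1}$ be the closed unit ball in $\mathbb{R}^{n+1}$ with boundary $S^n$, inclusion $\iota\colon S^n\to B$, flat metric $dx^2$, and let $\omega_n$ be the volume of the standard sphere $S^n$. Consider metrics $g=u^2dx^2$ with $0<u\in C^\infty(B)$ (smooth up to the boundary). Let $P=\frac{1}{n-1}\bigl(\mathrm{Ric}-\frac{R}{2n}g\bigr)$ be the Schouten tensor of $g$, $\sigma_1=\mathrm{tr}_g P$, $\sigma_2=\frac12(\sigma_1^2-|P|_g^2)$; let $\eta$ be the outward unit normal of $S^n$ with respect to $g$, $H=\frac1n\mathrm{tr}_{\iota^*g}\nabla\eta$ the mean curvature and $H_2=H\,\mathrm{tr}_{\iota^*g}(P|_{TS^n})+\frac n3H^3$. Put $$\mathcal{S}_2(g)=\int_B\sigma_2\,\mathrm{dvol}_g+\oint_{S^n}H_2\,\mathrm{dvol}_{\iota^*g},\qquad \mathcal{V}=\{g=u^2dx^2 : \mathrm{Vol}_{\iota^*g}(S^n)=\omega_n\},$$ $$\mathcal{C}_1=\{g=u^2dx^2 : \sigma_1\ge 0 \text{ in } B,\ H>0 \text{ on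 } S^n\}.$$ Let $g\in\mathcal{C}_1$. If $g\in\mathcal V$ is a local minimizer of $\mathcal{S}_2\colon\mathcal{V}\to\mathbb{R}$ (in the $C^\infty$ topology), then $g=dx^2$ up to the action of the conformal group of the ball; that is, $g=\Phi^*dx^2$ for some conformal diffeomorphism $\Phi$ of $B$ which preserves $S^n$. The same conclusion holds if $g\in\mathcal V$ is only assumed to be a stable critical point of $\mathcal{S}_2\colon\mathcal{V}\to\mathbb{R}$; that is, if for every smooth curve $g_t$, $|t|<\delta$, in $\mathcal{V}$ with $g_0=g$ one has $\frac{d}{dt}\big|_{t=0}\mathcal{S}_2(g_t)=0$ and $\frac{d^2}{dt^2}\big|_{t=0}\mathcal{S}_2(g_t)\ge0$. -/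

import Mathlib

open MeasureTheory Metric Set Filter Topology
open scoped ContDiff

noncomputable section

namespace BallSigmaTwo

/-- Euclidean space of dimension `n + 1`. -/
abbrev E (n : ℕ) : Type := EuclideanSpace ℝ (Fin (n + 1))

/-- The closed unit ball of dimension `n + 1`. -/
abbrev B (n : ℕ) : Set (E n) := closedBall (0 : E n) 1

/-- The `i`-th partial derivative. -/
def pd {n : ℕ} (i : Fin (n + 1)) (f : E n → ℝ) (x : E n) : ℝ :=
  fderiv ℝ f x (EuclideanSpace.single i 1)

/-- A symmetric 2-tensor field, given by its components in the standard coordinates; Riemannian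
metrics are the positive definite ones. -/
abbrev Tensor2 (n : ℕ) : Type := E n → Matrix (Fin (n + 1)) (Fin (n + 1)) ℝ

/-! Curvatures of a Riemannian metric `g`, in the global coordinates. -/

/-- The Christoffel symbol `Γ^k_{ij}` of the Levi-Civita connection of `g`. -/
def christoffel {n : ℕ} (g : Tensor2 n) (k i j : Fin (n + 1)) (x : E n) : ℝ :=
  (1 / 2) * ∑ l, (g x)⁻¹ k l *
    (pd i (fun y => g y j l) x + pd j (fun y => g y i l) x - pd l (fun y => g y i j) x)

/-- The Ricci tensor (positive on round spheres). -/
def ricci {n : ℕ} (g : Tensor2 n) (x : E n) (i j : Fin (n + 1)) : ℝ :=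
  ∑ k, (pd k (christoffel g k i j) x - pd j (christoffel g k i k) x +
    ∑ l, (christoffel g k k l x * christoffel g l i j x
      - christoffel g k j l x * christoffel g l i k x))

/-- The scalar curvature. -/
def scalarCurv {n : ℕ} (g : Tensor2 n) (x : E n) : ℝ :=
  ∑ i, ∑ j, (g x)⁻¹ i j * ricci g x i j

/-- The Schouten tensor `P = (Ric - R / (2 n) g) / (n - 1)` in dimension `n + 1`. -/
def schouten {n : ℕ} (g : Tensor2 n) (x : E n) (i j : Fin (n + 1)) : ℝ :=
  (1 / ((n : ℝ) - 1)) * (ricci g x i j - scalarCurv g x / (2 * (n : ℝ)) * g x i j)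

/-- `σ₁ = J = tr_g P`. -/
def sigma1 {n : ℕ} (g : Tensor2 n) (x : E n) : ℝ :=
  ∑ i, ∑ j, (g x)⁻¹ i j * schouten g x i j

/-- `|P|²` with respect to `g`. -/
def schoutenNormSq {n : ℕ} (g : Tensor2 n) (x : E n) : ℝ :=
  ∑ i, ∑ j, ∑ k, ∑ l, (g x)⁻¹ i k * (g x)⁻¹ j l * schouten g x i j * schouten g x k l

/-- `σ₂ = (J² - |P|²) / 2`. -/
def sigma2 {n : ℕ} (g : Tensor2 n) (x : E n) : ℝ :=
  (1 / 2) * (sigma1 g x ^ 2 - schoutenNormSq g x)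

/-! Boundary geometry. The covector `x ↦ ∑ xᵢ dxⁱ` is an outward conormal along the unit sphere. -/

/-- The squared length `g^{ij} xᵢ xⱼ` of the Euclidean outward conormal. -/
def conormalSq {n : ℕ} (g : Tensor2 n) (x : E n) : ℝ :=
  ∑ i, ∑ j, (g x)⁻¹ i j * x i * x j

/-- The components of the outward unit normal `η`. This is a unit normal to every sphere centred at
the origin, and so extends the outward unit normal of the unit sphere to a neighbourhood. -/
def outwardNormal {n : ℕ} (g : Tensor2 n) (i : Fin (n + 1)) (x : E n) : ℝ :=
  (∑ j, (g x)⁻¹ i j * x j) / √(conormalSq g x)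

/-- `(∇_i η)^k`. -/
def covDerivNormal {n : ℕ} (g : Tensor2 n) (x : E n) (i k : Fin (n + 1)) : ℝ :=
  pd i (outwardNormal g k) x + ∑ l, christoffel g k i l x * outwardNormal g l x

/-- The components `g^{ij} - η^i η^j` of the inverse of the metric induced on the boundary;
contraction with them is the trace over the tangent space of the boundary. -/
def tangentialInverse {n : ℕ} (g : Tensor2 n) (x : E n) (i j : Fin (n + 1)) : ℝ :=
  (g x)⁻¹ i j - outwardNormal g i x * outwardNormal g j x

/-- The mean curvature `H = (1 / n) tr ∇η` of the unit sphere (it is 1 for the flat metric). -/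
def meanCurv {n : ℕ} (g : Tensor2 n) (x : E n) : ℝ :=
  (1 / (n : ℝ)) *
    ∑ i, ∑ j, tangentialInverse g x i j * ∑ k, g x j k * covDerivNormal g x i k

/-- `H₂ = H tr (P|_{TM}) + (n / 3) H³`, for an umbilic boundary. -/
def H2 {n : ℕ} (g : Tensor2 n) (x : E n) : ℝ :=
  meanCurv g x * (∑ i, ∑ j, tangentialInverse g x i j * schouten g x i j) +
    (n : ℝ) / 3 * meanCurv g x ^ 3

/-! Integration. -/

/-- The Riemannian volume density with respect to Lebesgue measure. -/
def volDensity {n : ℕ} (g : Tensor2 n) (x : E n) : ℝ := √((g x).det)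

/-- The density of the volume form of the induced metric on the unit sphere with respect to the
standard surface measure: the determinant of `g` restricted to the hyperplane orthogonal to the
unit vector `x` is `det g · (xᵀ g⁻¹ x)`. -/
def areaDensity {n : ℕ} (g : Tensor2 n) (x : E n) : ℝ := √((g x).det * conormalSq g x)

/-- The standard surface measure of the unit sphere `S^n`. -/
def surfaceMeasure (n : ℕ) : Measure (sphere (0 : E n) 1) := (volume : Measure (E n)).toSphere

/-- `ω_n`, the volume of the standard `n`-sphere. -/
def omega (n : ℕ) : ℝ := (surfaceMeasure n).real univ

/-- The volume of the boundary sphere in the metric induced by `g`. -/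
def boundaryVol {n : ℕ} (g : Tensor2 n) : ℝ :=
  ∫ x : sphere (0 : E n) 1, areaDensity g (x : E n) ∂(surfaceMeasure n)

/-- `S₂(g) = ∫ σ₂ dvol + ∮ H₂ dvol`. -/
def S2 {n : ℕ} (g : Tensor2 n) : ℝ :=
  (∫ x in B n, sigma2 g x * volDensity g x) +
    ∫ x : sphere (0 : E n) 1, H2 g (x : E n) * areaDensity g (x : E n) ∂(surfaceMeasure n)

/-! Conformally flat metrics. A function in `C^∞` of the closed ball is represented by an extension
to a smooth function on the whole space; only its values on the closed ball matter. -/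

/-- The metric `u² dx²`. -/
def confMetric {n : ℕ} (u : E n → ℝ) : Tensor2 n := fun x => (u x ^ 2) • 1

/-- The flat metric `dx²`. -/
def flatMetric (n : ℕ) : Tensor2 n := fun _ => 1

/-- `u` is a conformal factor: smooth and positive on the closed ball. -/
def IsConfFactor {n : ℕ} (u : E n → ℝ) : Prop :=
  ContDiff ℝ ∞ u ∧ ∀ x ∈ B n, 0 < u x

/-- `u² dx²` lies in `V`: its boundary volume is `ω_n`. -/
def InV {n : ℕ} (u : E n → ℝ) : Prop :=
  IsConfFactor u ∧ boundaryVol (confMetric u) = omega n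

/-- `u² dx²` lies in the cone `C₁`: `σ₁ ≥ 0` on the ball and `H > 0` on the boundary. -/
def InC1 {n : ℕ} (u : E n → ℝ) : Prop :=
  IsConfFactor u ∧ (∀ x ∈ B n, 0 ≤ sigma1 (confMetric u) x) ∧
    ∀ x ∈ sphere (0 : E n) 1, 0 < meanCurv (confMetric u) x

/-- `w` is `ε`-close to `u` in `C^k` of the closed ball; these sets are a neighbourhood basis of
`u` in the `C^∞` topology. -/
def CkClose {n : ℕ} (k : ℕ) (ε : ℝ) (u w : E n → ℝ) : Prop :=
  ∀ m ≤ k, ∀ x ∈ B n, ‖iteratedFDeriv ℝ m (fun y => w y - u y) x‖ < ε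

/-- `u² dx²` is a local minimizer of `S₂ : V → ℝ` in the `C^∞` topology. -/
def IsLocalMinimizer {n : ℕ} (u : E n → ℝ) : Prop :=
  InV u ∧ ∃ k : ℕ, ∃ ε > 0, ∀ w : E n → ℝ, InV w → CkClose k ε u w →
    S2 (confMetric u) ≤ S2 (confMetric w)

/-- `W` is a smooth curve `(-δ, δ) → V` with `W 0 = u`. -/
def IsCurveInV {n : ℕ} (u : E n → ℝ) (δ : ℝ) (W : ℝ → E n → ℝ) : Prop :=
  ContDiffOn ℝ ∞ (fun p : ℝ × E n => W p.1 p.2) (Ioo (-δ) δ ×ˢ univ) ∧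
    (∀ t ∈ Ioo (-δ) δ, InV (W t)) ∧ ∀ x ∈ B n, W 0 x = u x

/-- `u² dx²` is a stable critical point of `S₂ : V → ℝ`: along smooth curves in `V` the first
variation vanishes and the second variation is nonnegative. -/
def IsStableCritical {n : ℕ} (u : E n → ℝ) : Prop :=
  InV u ∧ ∀ δ > 0, ∀ W : ℝ → E n → ℝ, IsCurveInV u δ W →
    deriv (fun t => S2 (confMetric (W t))) 0 = 0 ∧
      0 ≤ iteratedDeriv 2 (fun t => S2 (confMetric (W t))) 0

/-! The conformal group of the ball. -/

/-- `Φ` is a conformal diffeomorphism of the closed unit ball which preserves its boundary. -/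
def IsConfDiffeo {n : ℕ} (Φ : E n → E n) : Prop :=
  ContDiff ℝ ∞ Φ ∧ MapsTo Φ (B n) (B n) ∧ MapsTo Φ (sphere 0 1) (sphere 0 1) ∧
    (∀ x ∈ B n, ConformalAt Φ x) ∧
    ∃ Ψ : E n → E n, ContDiff ℝ ∞ Ψ ∧ MapsTo Ψ (B n) (B n) ∧
      LeftInvOn Ψ Φ (B n) ∧ RightInvOn Ψ Φ (B n)

/-- The pullback `Φ^* g`. -/
def pullback {n : ℕ} (Φ : E n → E n) (g : Tensor2 n) : Tensor2 n := fun x =>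
  Matrix.of fun i j => ∑ a, ∑ b, g (Φ x) a b * pd i (fun y => Φ y a) x * pd j (fun y => Φ y b) x

/-- `g` agrees on the closed ball with the pullback of the flat metric by an element of the
conformal group of the ball. -/
def IsFlatUpToConf {n : ℕ} (g : Tensor2 n) : Prop :=
  ∃ Φ : E n → E n, IsConfDiffeo Φ ∧ ∀ x ∈ B n, g x = pullback Φ (flatMetric n) x

end BallSigmaTwo

end

/-!
The proof is a stability argument in the manner of Hersch: a conformal diffeomorphism of the ball
is chosen which balances the boundary measure, its coordinates are used as test functions in the
second variation, and the resulting inequality is compared with an integral identity in which all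
terms have the opposite sign.

*Variation.* Near the ball write `u = e^v` and let `S = -∇²v + dv ⊗ dv - |dv|²/2 δ` be the Schouten
tensor (`sch`), `T = (tr S) δ - S` its Newton tensor (`newton`) and `h = 1 + ∂ᵣv = e^v H`. Since `T`
is divergence free for `g`, the divergence theorem in the ball and on the sphere gives, for the
functional `G_θ` which is `S₂` with its integrands weighted by `θ` (`weightedS2`),
`d/dt G_θ(v + tφ) = (n-3) G_{θφ} + ∫ e^{(n-3)v} T(∇θ, ∇φ) + ∮ e^{(n-3)v} h ⟨∇θ, ∇φ⟩`, with the
tangential gradient in the last term (`hasDerivAt_weightedS2`). With `θ = 1` this is the first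
variation and with `θ = φ` the second one. The curve `v + tφ`, corrected by a constant to keep the
boundary volume (`volShift`), is admissible in the definitions of a local minimizer and of a stable
critical point alike (`StableAlongCurves`). The first variation in directions supported in the
interior gives `σ₂ = 0`, and with `σ₁ ≥ 0` this implies `T ≥ 0` by the Cauchy–Schwarz inequality.

*Balancing.* The conformal diffeomorphisms `y` of the ball which map `a` to the origin (`mobius a`)
have conformal factor `e^{v₀} = (1 - |a|²) / (1 - 2⟨a, x⟩ + |a|²|x|²)`. The integral of `-v₀`
against the boundary measure `e^{nv}` tends to infinity as `|a| → 1`, and where it is minimal the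
coordinates of `y` have zero mean for this measure (`exists_balanced`). They are then admissible
directions. As `∑ yᵢ² = 1` on the sphere and `∑ dyᵢ ⊗ dyᵢ = e^{2v₀} δ`, the sum of the second
variations over `φ = yᵢ` is explicit and yields
`3 ∮ H₂ ≤ n ∫ e^{(n-3)v + 2v₀} tr S + n ∮ e^{(n-3)v} h e^{2v₀}`
(`StableAlongCurves.balanced_inequality`).

*Rigidity.* The metric `e^{2v₀} dx²` is flat and its boundary has mean curvature one. This expresses
`S` and `h` by `v` and `f = v₀ - v`, and integration by parts turns the difference of the two sides
of the inequality into (`FlatPair.integral_identity`)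
`(n-3) {∫ e^{(n-3)v} (T(∇f, ∇f)/2 + n|∇f|⁴/8) + ∮ e^{(n-3)v} |∇f|² (e^{v₀} + h/2)}`
`+ n(5-n)/2 ∫ e^{(n-3)v + 2v₀} |∇f|²`, with the tangential gradient in the boundary term. For
`n = 4, 5` each term is nonnegative, so `∇f = 0`. The constant `f` vanishes because both metrics
have boundary volume `omega n` (`integral_poisson`), so `u² dx² = y^* dx²`.
-/

noncomputable section

namespace BallSigmaTwo

/-! ### Integration on the ball and the sphere -/

/-- Differentiation under the integral over a compact set. -/
theorem hasDerivAt_setIntegral_of_continuous {X : Type*} [TopologicalSpace X] [MeasurableSpace X]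
    [OpensMeasurableSpace X] {μ : Measure X} [IsFiniteMeasureOnCompacts μ]
    {K : Set X} (hK : IsCompact K) (hKm : MeasurableSet K) {F F' : ℝ → X → ℝ}
    (hF : ∀ t, Continuous (F t)) (hF' : Continuous fun p : ℝ × X => F' p.1 p.2)
    (hd : ∀ t, ∀ x ∈ K, HasDerivAt (fun s => F s x) (F' t x) t) (t₀ : ℝ) :
    HasDerivAt (fun t => ∫ x in K, F t x ∂μ) (∫ x in K, F' t₀ x ∂μ) t₀ := by
  have hc : IsCompact (closedBall t₀ 1 ×ˢ K) := (isCompact_closedBall t₀ 1).prod hK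
  obtain ⟨C, hC⟩ := hc.exists_bound_of_continuousOn hF'.continuousOn
  have hfin : IsFiniteMeasure (μ.restrict K) :=
    ⟨by simpa using hK.measure_lt_top⟩
  have hint : ∀ t, IntegrableOn (F t) K μ := fun t => (hF t).continuousOn.integrableOn_compact' hK hKm
  have hF't : Continuous (F' t₀) := hF'.comp (by fun_prop : Continuous fun x : X => (t₀, x))
  refine (hasDerivAt_integral_of_dominated_loc_of_deriv_le (bound := fun _ => C)
    (s := closedBall t₀ 1) (closedBall_mem_nhds t₀ one_pos)
    (Eventually.of_forall fun t => (hint t).aestronglyMeasurable) (hint t₀)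
    (hF't.continuousOn.integrableOn_compact' hK hKm).aestronglyMeasurable ?_
    (integrable_const C) ?_).2
  · exact (ae_restrict_mem hKm).mono fun x hx t ht => hC (t, x) ⟨ht, hx⟩
  · exact (ae_restrict_mem hKm).mono fun x hx t _ => hd t x hx

variable {n : ℕ}

instance : IsFiniteMeasure (surfaceMeasure n) := by unfold surfaceMeasure; infer_instance

theorem hasDerivAt_sphereIntegral {F F' : ℝ → E n → ℝ}
    (hF : ∀ t, Continuous (F t)) (hF' : Continuous fun p : ℝ × E n => F' p.1 p.2)
    (hd : ∀ t, ∀ x ∈ sphere (0 : E n) 1, HasDerivAt (fun s => F s x) (F' t x) t) (t₀ : ℝ) :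
    HasDerivAt (fun t => ∫ x : sphere (0 : E n) 1, F t x ∂(surfaceMeasure n))
      (∫ x : sphere (0 : E n) 1, F' t₀ x ∂(surfaceMeasure n)) t₀ := by
  have h := hasDerivAt_setIntegral_of_continuous (X := sphere (0 : E n) 1)
    (μ := surfaceMeasure n) isCompact_univ MeasurableSet.univ
    (F := fun t x => F t x) (F' := fun t x => F' t x)
    (fun t => (hF t).comp continuous_subtype_val)
    (hF'.comp (by fun_prop : Continuous fun p : ℝ × sphere (0 : E n) 1 => (p.1, (p.2 : E n))))
    (fun t x _ => hd t x x.2) t₀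
  simpa using h

theorem integrable_of_continuous_sphere {F : sphere (0 : E n) 1 → ℝ} (hF : Continuous F) :
    Integrable F (surfaceMeasure n) := by
  simpa using hF.continuousOn.integrableOn_compact' (μ := surfaceMeasure n) isCompact_univ
    MeasurableSet.univ

theorem integrable_sphere {F : E n → ℝ} (hF : Continuous F) :
    Integrable (fun x : sphere (0 : E n) 1 => F x) (surfaceMeasure n) :=
  integrable_of_continuous_sphere (hF.comp continuous_subtype_val)

theorem integrableOn_ball {F : E n → ℝ} (hF : Continuous F) : IntegrableOn F (B n) :=
  hF.continuousOn.integrableOn_compact (isCompact_closedBall _ _)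

theorem continuous_sphereIntegral {F : ℝ → E n → ℝ} (hF : Continuous fun p : ℝ × E n => F p.1 p.2) :
    Continuous fun t => ∫ x : sphere (0 : E n) 1, F t x ∂(surfaceMeasure n) := by
  have h := continuous_parametric_integral_of_continuous (X := ℝ) (s := univ)
    (μ := surfaceMeasure n) (f := fun t (x : sphere (0 : E n) 1) => F t x)
    (hF.comp (by fun_prop : Continuous fun p : ℝ × sphere (0 : E n) 1 => (p.1, (p.2 : E n))))
    isCompact_univ
  simpa using h

theorem integral_ball_add {F G : E n → ℝ} (hF : Continuous F) (hG : Continuous G) :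
    ∫ x in B n, (F x + G x) = (∫ x in B n, F x) + ∫ x in B n, G x :=
  integral_add (integrableOn_ball hF) (integrableOn_ball hG)

theorem integral_ball_sub {F G : E n → ℝ} (hF : Continuous F) (hG : Continuous G) :
    ∫ x in B n, (F x - G x) = (∫ x in B n, F x) - ∫ x in B n, G x :=
  integral_sub (integrableOn_ball hF) (integrableOn_ball hG)

theorem integral_sphere_add {F G : E n → ℝ} (hF : Continuous F) (hG : Continuous G) :
    ∫ x : sphere (0 : E n) 1, (F x + G x) ∂(surfaceMeasure n) =
      (∫ x : sphere (0 : E n) 1, F x ∂(surfaceMeasure n)) +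
        ∫ x : sphere (0 : E n) 1, G x ∂(surfaceMeasure n) :=
  integral_add (integrable_sphere hF) (integrable_sphere hG)

theorem integral_sphere_sub {F G : E n → ℝ} (hF : Continuous F) (hG : Continuous G) :
    ∫ x : sphere (0 : E n) 1, (F x - G x) ∂(surfaceMeasure n) =
      (∫ x : sphere (0 : E n) 1, F x ∂(surfaceMeasure n)) -
        ∫ x : sphere (0 : E n) 1, G x ∂(surfaceMeasure n) :=
  integral_sub (integrable_sphere hF) (integrable_sphere hG)

/-- A linear isometry, restricted to the unit sphere. -/
def sphereMap (A : E n ≃ₗᵢ[ℝ] E n) (x : sphere (0 : E n) 1) : sphere (0 : E n) 1 :=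
  ⟨A x, by simp⟩

open scoped Pointwise in
/-- The surface measure is invariant under linear isometries. -/
theorem measurePreserving_sphereMap (A : E n ≃ₗᵢ[ℝ] E n) :
    MeasurePreserving (sphereMap A) (surfaceMeasure n) (surfaceMeasure n) := by
  have hm : Measurable (sphereMap A) := by
    apply Continuous.measurable
    unfold sphereMap
    fun_prop
  refine ⟨hm, ?_⟩
  ext s hs
  rw [Measure.map_apply hm hs, surfaceMeasure, Measure.toSphere_apply' _ hs,
    Measure.toSphere_apply' _ (hm hs)]
  congr 1
  have : Ioo (0 : ℝ) 1 • ((↑) '' (sphereMap A ⁻¹' s) : Set (E n)) =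
      A ⁻¹' (Ioo (0 : ℝ) 1 • ((↑) '' s : Set (E n))) := by
    ext y
    constructor
    · rintro ⟨r, hr, _, ⟨z, hz, rfl⟩, rfl⟩
      exact ⟨r, hr, _, ⟨_, hz, rfl⟩, by simp [sphereMap]⟩
    · rintro ⟨r, hr, _, ⟨z, hz, rfl⟩, h⟩
      refine ⟨r, hr, _, ⟨⟨A.symm z, by simp⟩, ?_, rfl⟩, ?_⟩
      · simpa [sphereMap] using hz
      · simp only at h ⊢
        have h2 := congrArg A.symm h
        simpa using h2
  rw [this]
  exact (A.measurePreserving).measure_preimage_emb A.toHomeomorph.measurableEmbedding _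

theorem integral_sphere_comp_isometry (A : E n ≃ₗᵢ[ℝ] E n) (F : E n → ℝ) :
    ∫ x : sphere (0 : E n) 1, F (A x) ∂(surfaceMeasure n) =
      ∫ x : sphere (0 : E n) 1, F x ∂(surfaceMeasure n) := by
  have hemb : MeasurableEmbedding (sphereMap A) := by
    have : Function.LeftInverse (sphereMap A.symm) (sphereMap A) := fun x => by
      ext1; simp [sphereMap]
    refine MeasurableEmbedding.of_measurable_inverse (measurePreserving_sphereMap A).measurable ?_
      (measurePreserving_sphereMap A.symm).measurable this
    have h2 : Function.Surjective (sphereMap A) := fun x => ⟨sphereMap A.symm x, by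
      ext1; simp [sphereMap]⟩
    rw [h2.range_eq]; exact MeasurableSet.univ
  exact (measurePreserving_sphereMap A).integral_comp hemb (fun x => F x)

/-- The rotation by the angle `t` in the plane of the `i`-th and `j`-th coordinates. -/
def rotationMap (i j : Fin (n + 1)) (t : ℝ) : E n →ₗ[ℝ] E n where
  toFun x := x + (((Real.cos t - 1) * x i - Real.sin t * x j) • EuclideanSpace.single i (1 : ℝ) +
    (Real.sin t * x i + (Real.cos t - 1) * x j) • EuclideanSpace.single j (1 : ℝ))
  map_add' x y := by
    simp only [PiLp.add_apply]
    module
  map_smul' c x := by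
    simp only [PiLp.smul_apply, smul_eq_mul, RingHom.id_apply]
    module

theorem norm_rotationMap {i j : Fin (n + 1)} (hij : i ≠ j) (t : ℝ) (x : E n) :
    ‖rotationMap i j t x‖ = ‖x‖ := by
  rw [← sq_eq_sq₀ (norm_nonneg _) (norm_nonneg _)]
  have h1 : inner ℝ x (EuclideanSpace.single i (1 : ℝ)) = x i := by
    simp [EuclideanSpace.inner_single_right]
  have h2 : inner ℝ x (EuclideanSpace.single j (1 : ℝ)) = x j := by
    simp [EuclideanSpace.inner_single_right]
  have h3 : inner ℝ (EuclideanSpace.single i (1 : ℝ) : E n) (EuclideanSpace.single j (1 : ℝ)) = 0 := by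
    simp [EuclideanSpace.inner_single_right, hij.symm]
  have h4 : ‖(EuclideanSpace.single i (1 : ℝ) : E n)‖ = 1 := by simp
  have h5 : ‖(EuclideanSpace.single j (1 : ℝ) : E n)‖ = 1 := by simp
  show ‖x + (_ • _ + _ • _)‖ ^ 2 = _
  rw [norm_add_sq_real, norm_add_sq_real]
  simp only [inner_add_right, inner_smul_right, inner_smul_left, norm_smul, h1, h2, h3, h4, h5,
    mul_one, Real.norm_eq_abs, sq_abs]
  have := Real.sin_sq_add_cos_sq t
  simp
  linear_combination (x i ^ 2 + x j ^ 2) * this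

/-- The rotation `rotationMap`, as an isometry. -/
def rotation {i j : Fin (n + 1)} (hij : i ≠ j) (t : ℝ) : E n ≃ₗᵢ[ℝ] E n :=
  LinearIsometry.toLinearIsometryEquiv ⟨rotationMap i j t, norm_rotationMap hij t⟩ rfl

theorem fderiv_eq_sum_pd (f : E n → ℝ) (x y : E n) : fderiv ℝ f x y = ∑ i, y i * pd i f x := by
  have : y = ∑ i, y i • EuclideanSpace.single i (1 : ℝ) := by
    have := (EuclideanSpace.basisFun (Fin (n+1)) ℝ).sum_repr y
    simpa using this.symm
  conv_lhs => rw [this]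
  simp [map_sum, pd]

theorem continuous_pd {f : E n → ℝ} (hf : ContDiff ℝ ∞ f) (i : Fin (n + 1)) : Continuous (pd i f) :=
  (hf.continuous_fderiv (by simp)).clm_apply continuous_const

/-- The angular derivatives `xᵢ ∂ⱼ - xⱼ ∂ᵢ` integrate to zero over the sphere. -/
theorem integral_angular_derivative {f : E n → ℝ} (hf : ContDiff ℝ ∞ f) (i j : Fin (n + 1)) :
    ∫ x : sphere (0 : E n) 1, ((x : E n) i * pd j f x - (x : E n) j * pd i f x)
      ∂(surfaceMeasure n) = 0 := by
  by_cases hij : i = j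
  · simp [hij]
  -- Rotations preserve the surface measure, so the derivative of `∮ f ∘ R t` at `t = 0` vanishes.
  let R : ℝ → E n → E n := fun t x =>
    x + (((Real.cos t - 1) * x i - Real.sin t * x j) • EuclideanSpace.single i (1 : ℝ) +
    (Real.sin t * x i + (Real.cos t - 1) * x j) • EuclideanSpace.single j (1 : ℝ))
  let R' : ℝ → E n → E n := fun t x =>
    (((- Real.sin t) * x i - Real.cos t * x j) • EuclideanSpace.single i (1 : ℝ) +
    (Real.cos t * x i + (- Real.sin t) * x j) • EuclideanSpace.single j (1 : ℝ))
  have hR : ∀ t x, HasDerivAt (fun s => R s x) (R' t x) t := by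
    intro t x
    refine HasDerivAt.const_add _ (HasDerivAt.add (HasDerivAt.smul_const ?_ _)
      (HasDerivAt.smul_const ?_ _))
    · exact (((Real.hasDerivAt_cos t).sub_const 1).mul_const _).sub
        ((Real.hasDerivAt_sin t).mul_const _)
    · exact ((Real.hasDerivAt_sin t).mul_const _).add
        (((Real.hasDerivAt_cos t).sub_const 1).mul_const _)
  have hRc : Continuous fun p : ℝ × E n => R p.1 p.2 := by fun_prop
  have hRc' : Continuous fun p : ℝ × E n => R' p.1 p.2 := by fun_prop
  have key := hasDerivAt_sphereIntegral (n := n) (F := fun t x => f (R t x))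
    (F' := fun t x => fderiv ℝ f (R t x) (R' t x))
    (fun t => hf.continuous.comp (hRc.comp (by fun_prop : Continuous fun x : E n => (t, x))))
    (((hf.continuous_fderiv (by simp)).comp hRc).clm_apply hRc')
    (fun t x _ => ((hf.differentiable (by simp)).differentiableAt.hasFDerivAt).comp_hasDerivAt t
      (hR t x)) 0
  have hconst : (fun t => ∫ x : sphere (0 : E n) 1, f (R t x) ∂(surfaceMeasure n)) =
      fun _ => ∫ x : sphere (0 : E n) 1, f x ∂(surfaceMeasure n) := by
    funext t
    exact integral_sphere_comp_isometry (rotation hij t) f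
  rw [hconst] at key
  have h0 := key.unique (hasDerivAt_const _ _)
  rw [← h0]
  congr 1
  funext x
  simp [R, R', map_add, map_smul, pd]
  ring

theorem sum_mul_self_sphere {x : E n} (hx : x ∈ sphere (0 : E n) 1) : ∑ i, x i * x i = 1 := by
  have := EuclideanSpace.norm_sq_eq x
  simp only [mem_sphere_iff_norm, sub_zero] at hx
  simp [hx] at this
  rw [this]; simp [sq]

theorem contDiff_coord (i : Fin (n + 1)) : ContDiff ℝ ∞ (fun x : E n => x i) := by fun_prop

theorem pd_coord (i j : Fin (n + 1)) (x : E n) :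
    pd i (fun y => y j) x = if i = j then 1 else 0 := by
  have : (fun y : E n => y j) = (EuclideanSpace.proj j : E n →L[ℝ] ℝ) := rfl
  rw [pd, this, ContinuousLinearMap.fderiv]
  simp [eq_comm]

theorem pd_mul {f g : E n → ℝ} {x : E n} (hf : DifferentiableAt ℝ f x)
    (hg : DifferentiableAt ℝ g x) (i : Fin (n + 1)) :
    pd i (fun y => f y * g y) x = pd i f x * g x + f x * pd i g x := by
  simp only [pd, fderiv_fun_mul hf hg]
  simp; ring

/-- The divergence theorem on the unit sphere, in the form of the derivative at radius one of the
flux of the field `f eᵢ` through spheres. -/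
theorem integral_sphere_pd {f : E n → ℝ} (hf : ContDiff ℝ ∞ f) (i : Fin (n + 1)) :
    ∫ x : sphere (0 : E n) 1, pd i f x ∂(surfaceMeasure n) =
      ∫ x : sphere (0 : E n) 1, ((n : ℝ) * ((x : E n) i * f x) + (x : E n) i * fderiv ℝ f x x)
        ∂(surfaceMeasure n) := by
  -- Sum over `j` the angular derivatives in the `(i, j)`-plane of the functions `yⱼ f`.
  have h : ∀ j, ∫ x : sphere (0 : E n) 1, ((x : E n) i * pd j (fun y => y j * f y) x
      - (x : E n) j * pd i (fun y => y j * f y) x) ∂(surfaceMeasure n) = 0 := fun j =>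
    integral_angular_derivative ((contDiff_coord j).mul hf) i j
  have hsum := Finset.sum_congr rfl (fun j (_ : j ∈ Finset.univ) => h j)
  have hpd : ∀ j k, Continuous (pd j (fun y : E n => y k * f y)) := fun j k =>
    continuous_pd ((contDiff_coord k).mul hf) j
  have hpdf : ∀ j, Continuous (pd j f) := fun j => continuous_pd hf j
  have hco : ∀ j, Continuous fun x : E n => x j := fun j => (contDiff_coord j).continuous
  rw [← integral_finsetSum _ fun j _ => integrable_sphere
    (F := fun x : E n => x i * pd j (fun y => y j * f y) x - x j * pd i (fun y => y j * f y) x)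
    (((hco i).mul (hpd j j)).sub ((hco j).mul (hpd i j)))] at hsum
  simp only [Finset.sum_const_zero] at hsum
  rw [← sub_eq_zero, ← integral_sub (integrable_sphere (hpdf i))
    (integrable_sphere (F := fun x : E n => (n : ℝ) * (x i * f x) + x i * fderiv ℝ f x x) ?_),
    ← neg_eq_zero, ← integral_neg, ← hsum]
  · congr 1
    funext x
    have hfd := (hf.differentiable (by simp)).differentiableAt (x := (x : E n))
    have hcd := fun j => ((contDiff_coord (n := n) j).differentiable (by simp)).differentiableAt
      (x := (x : E n))
    simp only [fun j k => pd_mul (hcd k) hfd j, pd_coord, fderiv_eq_sum_pd, if_true, one_mul]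
    have h1 := sum_mul_self_sphere x.2
    have e : ∀ j, ((x : E n) i * (f x + (x : E n) j * pd j f x) -
        (x : E n) j * ((if i = j then 1 else 0) * f x + (x : E n) j * pd i f x)) =
        (x : E n) i * f x + (x : E n) i * ((x : E n) j * pd j f x) -
        (if i = j then (x : E n) j * f x else 0) - (x : E n) j * (x : E n) j * pd i f x := by
      intro j; split_ifs <;> ring
    simp only [e, Finset.sum_sub_distrib, Finset.sum_add_distrib, ← Finset.mul_sum,
      ← Finset.sum_mul, h1]
    simp
    ring
  · have : Continuous (fderiv ℝ f) := hf.continuous_fderiv (by simp)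
    fun_prop

/-- A field tangent to all centred spheres has divergence of zero mean on the unit sphere. -/
theorem integral_sphere_div_eq_zero {V : Fin (n + 1) → E n → ℝ} (hV : ∀ i, ContDiff ℝ ∞ (V i))
    (ht : ∀ x, ∑ i, x i * V i x = 0) :
    ∫ x : sphere (0 : E n) 1, ∑ i, pd i (V i) x ∂(surfaceMeasure n) = 0 := by
  have hpd : ∀ j, Continuous (pd j (V j)) := fun j => continuous_pd (hV j) j
  have hfd : ∀ j, Continuous (fderiv ℝ (V j)) := fun j => (hV j).continuous_fderiv (by simp)
  have hc : ∀ j, Continuous (V j) := fun j => (hV j).continuous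
  rw [integral_finsetSum _ fun j _ => integrable_sphere (hpd j)]
  simp only [fun i => integral_sphere_pd (hV i) i]
  rw [← integral_finsetSum _ fun j _ => integrable_sphere
    (F := fun x : E n => (n : ℝ) * (x j * V j x) + x j * fderiv ℝ (V j) x x) (by fun_prop)]
  have : ∀ x : E n, ∑ j, ((n : ℝ) * (x j * V j x) + x j * fderiv ℝ (V j) x x) = 0 := by
    intro x
    rw [Finset.sum_add_distrib, ← Finset.mul_sum, ht x, mul_zero, zero_add]
    have h0 : (fun y : E n => ∑ j, y j * V j y) = fun _ => (0 : ℝ) := funext ht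
    have h1 : fderiv ℝ (fun y : E n => ∑ j, y j * V j y) x x = 0 := by rw [h0]; simp
    have hd : ∀ j, DifferentiableAt ℝ (V j) x := fun j =>
      ((hV j).differentiable (by simp)).differentiableAt
    have hcd := fun j => ((contDiff_coord (n := n) j).differentiable (by simp)).differentiableAt
      (x := (x : E n))
    rw [fderiv_fun_sum fun j _ => (hcd j).fun_mul (hd j)] at h1
    have e : ∀ j, fderiv ℝ (fun y : E n => y j) x x = x j := fun j => by
      have : (fun y : E n => y j) = (EuclideanSpace.proj j : E n →L[ℝ] ℝ) := rfl
      rw [this, ContinuousLinearMap.fderiv]; rfl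
    simp only [fun j => fderiv_fun_mul (hcd j) (hd j)] at h1
    simp [Finset.sum_add_distrib, e] at h1
    have h2 : ∑ j, V j x * x j = 0 := by rw [← ht x]; exact Finset.sum_congr rfl fun j _ => mul_comm _ _
    linarith
  simp [this]

/-- Integration in polar coordinates over the unit ball. -/
theorem integral_ball_polar {f : E n → ℝ} (hf : Continuous f) :
    ∫ x in B n, f x = ∫ r in (0 : ℝ)..1, r ^ n *
      ∫ x : sphere (0 : E n) 1, f (r • (x : E n)) ∂(surfaceMeasure n) := by
  have hdim : Module.finrank ℝ (E n) - 1 = n := by simp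
  let g : E n → ℝ := (B n).indicator f
  have hgi : Integrable g := (integrableOn_ball hf).integrable_indicator measurableSet_closedBall
  have hmp := (volume : Measure (E n)).measurePreserving_homeomorphUnitSphereProd
  rw [hdim] at hmp
  have hemb := (homeomorphUnitSphereProd (E n)).measurableEmbedding
  let G : sphere (0 : E n) 1 × Ioi (0 : ℝ) → ℝ := fun p => g ((p.2 : ℝ) • (p.1 : E n))
  have hG : ∀ x : ({(0 : E n)}ᶜ : Set (E n)), G (homeomorphUnitSphereProd (E n) x) = g x := by
    intro x
    have := congrArg Subtype.val ((homeomorphUnitSphereProd (E n)).symm_apply_apply x)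
    simp only [homeomorphUnitSphereProd_symm_apply_coe] at this
    simp only [G, this]
  have h1 : ∫ x in B n, f x = ∫ x : ({(0 : E n)}ᶜ : Set (E n)), g x ∂(volume.comap Subtype.val) := by
    rw [integral_subtype_comap (measurableSet_singleton _).compl g, restrict_compl_singleton,
      integral_indicator measurableSet_closedBall]
  have h2 := hmp.integral_comp hemb G
  simp only [hG] at h2
  have hGi : Integrable G
      ((volume : Measure (E n)).toSphere.prod (Measure.volumeIoiPow n)) := by
    rw [← hmp.integrable_comp_emb hemb]
    have : G ∘ (homeomorphUnitSphereProd (E n)) = fun x : ({(0 : E n)}ᶜ : Set (E n)) => g x :=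
      funext hG
    rw [this]
    exact (integrableOn_iff_comap_subtypeVal (measurableSet_singleton _).compl).1 hgi.integrableOn
  rw [h1, h2, integral_prod_symm G hGi]
  simp only [Measure.volumeIoiPow, ENNReal.ofReal]
  rw [integral_withDensity_eq_integral_smul
    (measurable_subtype_coe.pow_const _).real_toNNReal,
    integral_subtype_comap measurableSet_Ioi fun r : ℝ => Real.toNNReal (r ^ n) •
      ∫ x : sphere (0 : E n) 1, g (r • (x : E n)) ∂(volume : Measure (E n)).toSphere,
    intervalIntegral.integral_of_le zero_le_one]
  rw [setIntegral_eq_of_subset_of_forall_sdiff_eq_zero measurableSet_Ioi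
    (Ioc_subset_Ioi_self : Ioc (0 : ℝ) 1 ⊆ Ioi 0)]
  · refine setIntegral_congr_fun measurableSet_Ioc fun r hr => ?_
    simp only [NNReal.smul_def, Real.coe_toNNReal _ (pow_nonneg hr.1.le _), smul_eq_mul]
    congr 1
    unfold surfaceMeasure
    congr 1
    funext x
    have : r • (x : E n) ∈ B n := by simp [norm_smul, abs_of_pos hr.1, hr.2]
    simp [g, this]
  · intro r hr
    have hr0 : 0 < r := hr.1
    have hr1 : 1 < r := by
      by_contra h
      exact hr.2 ⟨hr.1, not_lt.1 h⟩
    have : ∀ x : sphere (0 : E n) 1, g (r • (x : E n)) = 0 := fun x => by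
      have : r • (x : E n) ∉ B n := by simp [norm_smul, abs_of_pos hr0, hr1]
      simp [g, this]
    simp [this]

/-- The divergence theorem in the unit ball. -/
theorem integral_ball_div (hn : n ≠ 0) {V : Fin (n + 1) → E n → ℝ}
    (hV : ∀ i, ContDiff ℝ ∞ (V i)) :
    ∫ x in B n, ∑ i, pd i (V i) x =
      ∫ x : sphere (0 : E n) 1, ∑ i, (x : E n) i * V i x ∂(surfaceMeasure n) := by
  have hpd : ∀ j, Continuous (pd j (V j)) := fun j => continuous_pd (hV j) j
  have hfd : ∀ j, Continuous (fderiv ℝ (V j)) := fun j => (hV j).continuous_fderiv (by simp)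
  have hc : ∀ j, Continuous (V j) := fun j => (hV j).continuous
  rw [integral_ball_polar (by fun_prop)]
  -- The flux `r ^ n * m r` through the sphere of radius `r` is a primitive of the radial integrand.
  let m : ℝ → ℝ := fun r => ∫ x : sphere (0 : E n) 1, ∑ i, (x : E n) i * V i (r • (x : E n))
    ∂(surfaceMeasure n)
  let m' : ℝ → ℝ := fun r => ∫ x : sphere (0 : E n) 1, ∑ i, (x : E n) i *
    fderiv ℝ (V i) (r • (x : E n)) x ∂(surfaceMeasure n)
  have hm : ∀ r, HasDerivAt m (m' r) r := by
    intro r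
    refine hasDerivAt_sphereIntegral (F := fun r x => ∑ i, x i * V i (r • x))
      (F' := fun r x => ∑ i, x i * fderiv ℝ (V i) (r • x) x) (fun t => by fun_prop) ?_ ?_ r
    · have := fun i => ((hfd i).comp (by fun_prop : Continuous fun p : ℝ × E n => p.1 • p.2)).clm_apply
        (continuous_snd)
      refine continuous_finsetSum _ fun i _ => Continuous.mul (by fun_prop) (this i)
    · intro t x _
      refine HasDerivAt.fun_sum fun i _ => HasDerivAt.const_mul _ ?_
      have h1 : HasDerivAt (fun s : ℝ => s • x) x t := by
        simpa using (hasDerivAt_id t).smul_const x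
      exact (((hV i).differentiable (by simp)).differentiableAt.hasFDerivAt).comp_hasDerivAt t h1
  have hd : ∀ r, HasDerivAt (fun r => r ^ n * m r) (r ^ n *
      ∫ x : sphere (0 : E n) 1, ∑ i, pd i (V i) (r • (x : E n)) ∂(surfaceMeasure n)) r := by
    intro r
    refine ((hasDerivAt_pow n r).fun_mul (hm r)).congr_deriv ?_
    have hVr : ∀ i, ContDiff ℝ ∞ fun x : E n => V i (r • x) := fun i => (hV i).comp (by fun_prop)
    have hfr : ∀ i (x : E n), fderiv ℝ (fun x : E n => V i (r • x)) x =
        r • fderiv ℝ (V i) (r • x) := fun i x => by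
      have h1 : HasFDerivAt (fun y : E n => r • y) (r • ContinuousLinearMap.id ℝ (E n)) x :=
        (hasFDerivAt_id x).const_smul r
      have := (((hV i).differentiable (by simp)).differentiableAt (x := r • x)).hasFDerivAt.comp x h1
      rw [HasFDerivAt.fderiv (f := fun x : E n => V i (r • x)) this]
      ext y; simp
    have hk : ∀ i, r * ∫ x : sphere (0 : E n) 1, pd i (V i) (r • (x : E n)) ∂(surfaceMeasure n) =
        n * (∫ x : sphere (0 : E n) 1, (x : E n) i * V i (r • (x : E n)) ∂(surfaceMeasure n)) +
        r * ∫ x : sphere (0 : E n) 1, (x : E n) i * fderiv ℝ (V i) (r • (x : E n)) x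
          ∂(surfaceMeasure n) := by
      intro i
      have h := integral_sphere_pd (hVr i) i
      rw [integral_add, integral_const_mul] at h
      · simp only [pd, hfr] at h
        simp only [smul_apply, smul_eq_mul, integral_const_mul,
          mul_left_comm _ r] at h
        exact h
      · exact integrable_sphere (F := fun x : E n => n * (x i * V i (r • x))) (by fun_prop)
      · have := (hVr i).continuous_fderiv (by simp)
        exact integrable_sphere (F := fun x : E n => x i * fderiv ℝ (fun x : E n => V i (r • x)) x x)
          (by fun_prop)
    have hs := Finset.sum_congr rfl (fun i (_ : i ∈ Finset.univ) => hk i)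
    rw [Finset.sum_add_distrib, ← Finset.mul_sum, ← Finset.mul_sum, ← Finset.mul_sum,
      ← integral_finsetSum _ fun j _ => integrable_sphere (F := fun x => pd j (V j) (r • x))
        (by fun_prop),
      ← integral_finsetSum _ fun j _ => integrable_sphere (F := fun x => x j * V j (r • x))
        (by fun_prop),
      ← integral_finsetSum _ fun j _ => integrable_sphere
        (F := fun x => x j * fderiv ℝ (V j) (r • x) x) (by fun_prop)] at hs
    obtain ⟨k, rfl⟩ := Nat.exists_eq_succ_of_ne_zero hn
    simp only [m, m', Nat.succ_eq_add_one, Nat.add_sub_cancel, pow_succ] at hs ⊢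
    linear_combination (-r ^ k : ℝ) * hs
  have hcont : Continuous fun r : ℝ => r ^ n *
      ∫ x : sphere (0 : E n) 1, ∑ i, pd i (V i) (r • (x : E n)) ∂(surfaceMeasure n) := by
    refine (continuous_pow n).mul ?_
    exact continuous_sphereIntegral (F := fun r x => ∑ i, pd i (V i) (r • x)) (by fun_prop)
  rw [intervalIntegral.integral_eq_sub_of_hasDerivAt (fun r _ => hd r)
    (hcont.intervalIntegrable _ _)]
  simp [hn, m]

/-! ### Curvature of the metric `e^{2v} dx²` -/

theorem contDiff_pd {f : E n → ℝ} (hf : ContDiff ℝ ∞ f) (i : Fin (n + 1)) :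
    ContDiff ℝ ∞ (pd i f) :=
  (hf.fderiv_right (m := ∞) (by simp)).clm_apply contDiff_const

theorem _root_.ContDiff.differentiableAt_top {f : E n → ℝ} (hf : ContDiff ℝ ∞ f) (x : E n) :
    DifferentiableAt ℝ f x := (hf.differentiable (by simp)).differentiableAt

theorem pd_add {f g : E n → ℝ} {x : E n} (hf : DifferentiableAt ℝ f x)
    (hg : DifferentiableAt ℝ g x) (i : Fin (n + 1)) :
    pd i (fun y => f y + g y) x = pd i f x + pd i g x := by
  simp only [pd, fderiv_fun_add hf hg]
  simp

theorem pd_sub {f g : E n → ℝ} {x : E n} (hf : DifferentiableAt ℝ f x)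
    (hg : DifferentiableAt ℝ g x) (i : Fin (n + 1)) :
    pd i (fun y => f y - g y) x = pd i f x - pd i g x := by
  simp only [pd, fderiv_fun_sub hf hg]
  simp

theorem pd_neg {f : E n → ℝ} {x : E n} (i : Fin (n + 1)) :
    pd i (fun y => - f y) x = - pd i f x := by
  simp only [pd, fderiv_fun_neg]
  simp

theorem pd_const (c : ℝ) (x : E n) (i : Fin (n + 1)) : pd i (fun _ : E n => c) x = 0 := by
  simp [pd]

theorem pd_const_mul {f : E n → ℝ} {x : E n} (c : ℝ) (hf : DifferentiableAt ℝ f x)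
    (i : Fin (n + 1)) : pd i (fun y => c * f y) x = c * pd i f x := by
  rw [pd_mul (by fun_prop) hf, pd_const]; ring

theorem pd_sum {ι : Type*} {s : Finset ι} {f : ι → E n → ℝ} {x : E n}
    (hf : ∀ k, DifferentiableAt ℝ (f k) x) (i : Fin (n + 1)) :
    pd i (fun y => ∑ k ∈ s, f k y) x = ∑ k ∈ s, pd i (f k) x := by
  simp only [pd, fderiv_fun_sum fun k _ => hf k]
  simp

theorem pd_exp {f : E n → ℝ} {x : E n} (hf : DifferentiableAt ℝ f x) (i : Fin (n + 1)) :
    pd i (fun y => Real.exp (f y)) x = Real.exp (f x) * pd i f x := by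
  simp only [pd, fderiv_exp hf]
  simp

theorem pd_pow {f : E n → ℝ} {x : E n} (hf : DifferentiableAt ℝ f x) (k : ℕ) (i : Fin (n + 1)) :
    pd i (fun y => f y ^ k) x = k * f x ^ (k - 1) * pd i f x := by
  simp only [pd, fderiv_fun_pow k hf]
  simp

theorem pd_comm {f : E n → ℝ} (hf : ContDiff ℝ ∞ f) (i j : Fin (n + 1)) (x : E n) :
    pd i (pd j f) x = pd j (pd i f) x := by
  have hs : IsSymmSndFDerivAt ℝ f x := hf.contDiffAt.isSymmSndFDerivAt (by
    simp only [minSmoothness_of_isRCLikeNormedField]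
    exact WithTop.coe_le_coe.2 le_top)
  have hd : DifferentiableAt ℝ (fderiv ℝ f) x :=
    ((hf.fderiv_right (m := ∞) (by simp)).differentiable (by simp)).differentiableAt
  have h : ∀ a b : Fin (n + 1), pd a (pd b f) x =
      fderiv ℝ (fderiv ℝ f) x (EuclideanSpace.single a 1) (EuclideanSpace.single b 1) := by
    intro a b
    unfold pd
    rw [fderiv_clm_apply hd (differentiableAt_const _)]
    simp
  rw [h, h, hs.eq]

theorem pd_congr {f g : E n → ℝ} {x : E n} (h : f =ᶠ[𝓝 x] g) (i : Fin (n + 1)) :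
    pd i f =ᶠ[𝓝 x] pd i g := by
  filter_upwards [h.eventuallyEq_nhds] with y hy
  rw [pd, pd, hy.fderiv_eq]

/-- The pointwise inner product of two gradients. -/
def gradDot (a b : E n → ℝ) (x : E n) : ℝ := ∑ i, pd i a x * pd i b x

/-- The Laplacian. -/
def lap (a : E n → ℝ) (x : E n) : ℝ := ∑ i, pd i (pd i a) x

/-- The Hessian of `v`, applied to the gradients of `a` and `b`. -/
def hess (v a b : E n → ℝ) (x : E n) : ℝ := ∑ i, ∑ j, pd i (pd j v) x * pd i a x * pd j b x

/-- The radial derivative `xᵢ ∂ᵢ`. -/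
def rad (a : E n → ℝ) (x : E n) : ℝ := ∑ i, x i * pd i a x

/-- The Schouten tensor of `e^{2v} dx²`. -/
def sch (v : E n → ℝ) (x : E n) (i j : Fin (n + 1)) : ℝ :=
  -pd i (pd j v) x + pd i v x * pd j v x - if i = j then gradDot v v x / 2 else 0

/-- The Euclidean trace of the Schouten tensor of `e^{2v} dx²`. -/
def trSch (v : E n → ℝ) (x : E n) : ℝ := -lap v x + (1 - ((n : ℝ) + 1) / 2) * gradDot v v x

theorem sum_sch (v : E n → ℝ) (x : E n) : ∑ i, sch v x i i = trSch v x := by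
  simp [sch, trSch, lap, gradDot, Finset.sum_add_distrib]
  ring

theorem confMetric_exp_inv (v : E n → ℝ) (x : E n) :
    (confMetric (fun y => Real.exp (v y)) x)⁻¹ =
      (Real.exp (-2 * v x)) • (1 : Matrix (Fin (n + 1)) (Fin (n + 1)) ℝ) := by
  apply Matrix.inv_eq_right_inv
  rw [confMetric, Matrix.smul_mul, Matrix.mul_smul, smul_smul, Matrix.one_mul, ← Real.exp_nat_mul,
    ← Real.exp_add]
  norm_num

theorem confMetric_exp_apply (v : E n → ℝ) (x : E n) (i j : Fin (n + 1)) :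
    confMetric (fun y => Real.exp (v y)) x i j = if i = j then Real.exp (2 * v x) else 0 := by
  rw [confMetric, ← Real.exp_nat_mul]
  simp [Matrix.smul_apply, Matrix.one_apply]

theorem confMetric_exp_inv_apply (v : E n → ℝ) (x : E n) (i j : Fin (n + 1)) :
    (confMetric (fun y => Real.exp (v y)) x)⁻¹ i j = if i = j then Real.exp (-2 * v x) else 0 := by
  rw [confMetric_exp_inv]
  simp [Matrix.smul_apply, Matrix.one_apply]

theorem christoffel_confMetric {v : E n → ℝ} (hv : ContDiff ℝ ∞ v) (k i j : Fin (n + 1)) :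
    christoffel (confMetric fun y => Real.exp (v y)) k i j = fun x =>
      (if k = j then pd i v x else 0) + (if k = i then pd j v x else 0) -
        if i = j then pd k v x else 0 := by
  funext x
  have hd := hv.differentiableAt_top x
  have hp : ∀ a b c : Fin (n + 1), pd a (fun y => confMetric (fun y => Real.exp (v y)) y b c) x =
      if b = c then Real.exp (2 * v x) * (2 * pd a v x) else 0 := by
    intro a b c
    simp only [confMetric_exp_apply]
    split_ifs with h
    · rw [pd_exp (by fun_prop), pd_const_mul _ hd]
    · exact pd_const _ _ _
  have he : Real.exp (-2 * v x) * Real.exp (2 * v x) = 1 := by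
    rw [← Real.exp_add]; norm_num
  have hm : ∀ (p : Prop) [Decidable p] (a : ℝ), Real.exp (-2 * v x) *
      (if p then Real.exp (2 * v x) * (2 * a) else 0) = if p then 2 * a else 0 := by
    intro p _ a
    split_ifs
    · rw [← mul_assoc, he, one_mul]
    · simp
  unfold christoffel
  simp only [hp, confMetric_exp_inv_apply, ite_mul, zero_mul, Finset.sum_ite_eq, Finset.mem_univ,
    if_true]
  have e1 : (j = k) = (k = j) := propext eq_comm
  have e2 : (i = k) = (k = i) := propext eq_comm
  simp only [mul_sub, mul_add, hm, e1, e2]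
  split_ifs <;> ring

theorem ricci_confMetric {v : E n → ℝ} (hv : ContDiff ℝ ∞ v) (x : E n) (i j : Fin (n + 1)) :
    ricci (confMetric fun y => Real.exp (v y)) x i j =
      ((n : ℝ) - 1) * (-pd i (pd j v) x + pd i v x * pd j v x) -
        if i = j then lap v x + ((n : ℝ) - 1) * gradDot v v x else 0 := by
  have hd : ∀ i, DifferentiableAt ℝ (pd i v) x := fun i => (contDiff_pd hv i).differentiableAt_top x
  have hpd : ∀ a k i j, pd a (fun x => (if k = j then pd i v x else 0) +
      (if k = i then pd j v x else 0) - if i = j then pd k v x else 0) x =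
      (if k = j then pd a (pd i v) x else 0) +
      (if k = i then pd a (pd j v) x else 0) - if i = j then pd a (pd k v) x else 0 := by
    intro a k i j
    have hif : ∀ (p : Prop) [Decidable p] (b : Fin (n + 1)),
        pd a (fun x => if p then pd b v x else 0) x = if p then pd a (pd b v) x else 0 := by
      intro p _ b
      split_ifs
      · rfl
      · exact pd_const _ _ _
    have hdif : ∀ (p : Prop) [Decidable p] (b : Fin (n + 1)),
        DifferentiableAt ℝ (fun x => if p then pd b v x else 0) x := by
      intro p _ b
      split_ifs
      · exact hd b
      · exact differentiableAt_const _
    rw [pd_sub ((hdif _ _).fun_add (hdif _ _)) (hdif _ _), pd_add (hdif _ _) (hdif _ _), hif, hif,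
      hif]
  unfold ricci
  have hk : ∀ k i, christoffel (confMetric fun y => Real.exp (v y)) k i k = pd i v := by
    intro k i
    rw [christoffel_confMetric hv]
    funext y
    rcases eq_or_ne k i with rfl | h <;> simp [*, eq_comm]
  simp only [hk]
  simp only [christoffel_confMetric hv, hpd]
  simp only [mul_add, add_mul, mul_sub, sub_mul, mul_ite, ite_mul, zero_mul, mul_zero,
    Finset.sum_add_distrib, Finset.sum_sub_distrib, Finset.sum_ite_eq, Finset.sum_ite_eq',
    Finset.mem_univ, if_true, Finset.sum_const, Finset.card_univ, Fintype.card_fin]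
  rcases eq_or_ne i j with rfl | h
  · simp [lap, gradDot, Finset.sum_add_distrib]
    ring
  · simp [pd_comm hv i j, h, h.symm]
    ring

theorem scalarCurv_confMetric {v : E n → ℝ} (hv : ContDiff ℝ ∞ v) (x : E n) :
    scalarCurv (confMetric fun y => Real.exp (v y)) x =
      Real.exp (-2 * v x) * (-2 * n * lap v x - n * ((n : ℝ) - 1) * gradDot v v x) := by
  unfold scalarCurv
  simp only [confMetric_exp_inv_apply, ite_mul, zero_mul, Finset.sum_ite_eq, Finset.mem_univ,
    if_true, ricci_confMetric hv, ← Finset.mul_sum, Finset.sum_sub_distrib,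
    Finset.sum_add_distrib, Finset.sum_neg_distrib, Finset.sum_const]
  have h1 : ∑ i, pd i (pd i v) x = lap v x := rfl
  have h2 : ∑ i, pd i v x * pd i v x = gradDot v v x := rfl
  rw [h1, h2]
  simp
  ring

theorem schouten_confMetric (hn : 2 ≤ n) {v : E n → ℝ} (hv : ContDiff ℝ ∞ v) (x : E n)
    (i j : Fin (n + 1)) :
    schouten (confMetric fun y => Real.exp (v y)) x i j = sch v x i j := by
  have he : Real.exp (-2 * v x) * Real.exp (2 * v x) = 1 := by
    rw [← Real.exp_add]; norm_num
  have hn1 : (n : ℝ) - 1 ≠ 0 := by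
    have : (2 : ℝ) ≤ n := by exact_mod_cast hn
    linarith
  have hn0 : (n : ℝ) ≠ 0 := by
    have : (2 : ℝ) ≤ n := by exact_mod_cast hn
    linarith
  rw [schouten, ricci_confMetric hv, scalarCurv_confMetric hv, confMetric_exp_apply, sch]
  generalize Real.exp (-2 * v x) = a at he ⊢
  generalize Real.exp (2 * v x) = b at he ⊢
  split_ifs
  · field_simp
    linear_combination (2 * lap v x + ((n : ℝ) - 1) * gradDot v v x) * he
  · field_simp
    ring

theorem sigma1_confMetric (hn : 2 ≤ n) {v : E n → ℝ} (hv : ContDiff ℝ ∞ v) (x : E n) :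
    sigma1 (confMetric fun y => Real.exp (v y)) x = Real.exp (-2 * v x) * trSch v x := by
  unfold sigma1
  simp only [confMetric_exp_inv_apply, ite_mul, zero_mul, Finset.sum_ite_eq, Finset.mem_univ,
    if_true, schouten_confMetric hn hv, ← Finset.mul_sum, sum_sch]

theorem schoutenNormSq_confMetric (hn : 2 ≤ n) {v : E n → ℝ} (hv : ContDiff ℝ ∞ v) (x : E n) :
    schoutenNormSq (confMetric fun y => Real.exp (v y)) x =
      Real.exp (-4 * v x) * ∑ i, ∑ j, sch v x i j ^ 2 := by
  have he : Real.exp (-2 * v x) * Real.exp (-2 * v x) = Real.exp (-4 * v x) := by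
    rw [← Real.exp_add]; ring_nf
  unfold schoutenNormSq
  simp only [confMetric_exp_inv_apply, ite_mul, mul_ite, zero_mul, mul_zero, Finset.sum_ite_eq,
    Finset.mem_univ, if_true, schouten_confMetric hn hv, Finset.mul_sum]
  refine Finset.sum_congr rfl fun i _ => ?_
  refine Finset.sum_congr rfl fun j _ => ?_
  rw [← he]; ring

/-- The density `σ₂ dvol` of the metric `e^{2v} dx²`. -/
def bulkDensity (v : E n → ℝ) (x : E n) : ℝ :=
  Real.exp (((n : ℝ) - 3) * v x) * ((trSch v x ^ 2 - ∑ i, ∑ j, sch v x i j ^ 2) / 2)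

/-- The trace of the Schouten tensor of `e^{2v} dx²` over the hyperplane orthogonal to the unit
vector `x`. -/
def tanSch (v : E n → ℝ) (x : E n) : ℝ := trSch v x - ∑ i, ∑ j, x i * x j * sch v x i j

/-- The density of `H₂` on the unit sphere for the metric `e^{2v} dx²`. -/
def bdryDensity (v : E n → ℝ) (x : E n) : ℝ :=
  Real.exp (((n : ℝ) - 3) * v x) *
    ((1 + rad v x) * tanSch v x + (n : ℝ) / 3 * (1 + rad v x) ^ 3)

theorem volDensity_confMetric (v : E n → ℝ) (x : E n) :
    volDensity (confMetric fun y => Real.exp (v y)) x = Real.exp (((n : ℝ) + 1) * v x) := by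
  rw [volDensity, confMetric, Matrix.det_smul]
  simp only [Fintype.card_fin, Matrix.det_one, mul_one]
  rw [← pow_mul, mul_comm 2, pow_mul, Real.sqrt_sq (by positivity), ← Real.exp_nat_mul]
  push_cast; rfl

theorem sigma2_mul_volDensity (hn : 2 ≤ n) {v : E n → ℝ} (hv : ContDiff ℝ ∞ v) (x : E n) :
    sigma2 (confMetric fun y => Real.exp (v y)) x *
      volDensity (confMetric fun y => Real.exp (v y)) x = bulkDensity v x := by
  have he : Real.exp (((n : ℝ) - 3) * v x) =
      Real.exp (-4 * v x) * Real.exp (((n : ℝ) + 1) * v x) := by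
    rw [← Real.exp_add]; ring_nf
  have he2 : Real.exp (-4 * v x) = Real.exp (-2 * v x) ^ 2 := by
    rw [← Real.exp_nat_mul]; norm_num; ring_nf
  rw [sigma2, sigma1_confMetric hn hv, schoutenNormSq_confMetric hn hv, volDensity_confMetric,
    bulkDensity, he, he2]
  ring

theorem conormalSq_confMetric (v : E n → ℝ) (x : E n) :
    conormalSq (confMetric fun y => Real.exp (v y)) x = Real.exp (-2 * v x) * ∑ i, x i * x i := by
  unfold conormalSq
  simp only [confMetric_exp_inv_apply, ite_mul, zero_mul, Finset.sum_ite_eq, Finset.mem_univ,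
    if_true, Finset.mul_sum, mul_assoc]

theorem areaDensity_confMetric (v : E n → ℝ) {x : E n} (hx : x ∈ sphere (0 : E n) 1) :
    areaDensity (confMetric fun y => Real.exp (v y)) x = Real.exp (n * v x) := by
  rw [areaDensity, conormalSq_confMetric, sum_mul_self_sphere hx, confMetric, Matrix.det_smul]
  simp only [Fintype.card_fin, Matrix.det_one, mul_one]
  rw [← Real.exp_nat_mul, ← Real.exp_nat_mul, ← Real.exp_add, ← Real.exp_half]
  congr 1
  push_cast
  ring

theorem pd_comp {g : ℝ → ℝ} {g' : ℝ} {f : E n → ℝ} {x : E n} (hg : HasDerivAt g g' (f x))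
    (hf : DifferentiableAt ℝ f x) (i : Fin (n + 1)) :
    pd i (fun y => g (f y)) x = g' * pd i f x := by
  have := hg.comp_hasFDerivAt x hf.hasFDerivAt
  rw [pd, HasFDerivAt.fderiv (f := fun y => g (f y)) this]
  simp [pd]

/-- The extension of the unit normal to a neighbourhood of the sphere is `e^{-v} x / |x|`. -/
theorem outwardNormal_confMetric (v : E n → ℝ) (k : Fin (n + 1)) :
    outwardNormal (confMetric fun y => Real.exp (v y)) k =
      fun y => Real.exp (-v y) * (y k * (√(∑ i, y i * y i))⁻¹) := by
  funext y
  unfold outwardNormal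
  rw [conormalSq_confMetric, Real.sqrt_mul (Real.exp_pos _).le, ← Real.exp_half]
  simp only [confMetric_exp_inv_apply, ite_mul, zero_mul, Finset.sum_ite_eq, Finset.mem_univ,
    if_true]
  have : Real.exp (-2 * v y) = Real.exp (-v y) * Real.exp (-v y) := by
    rw [← Real.exp_add]; ring_nf
  have h2 : Real.exp (-2 * v y / 2) = Real.exp (-v y) := by ring_nf
  rw [this, h2, div_eq_mul_inv, mul_inv]
  field_simp

theorem outwardNormal_sphere (v : E n → ℝ) (k : Fin (n + 1)) {x : E n}
    (hx : x ∈ sphere (0 : E n) 1) :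
    outwardNormal (confMetric fun y => Real.exp (v y)) k x = Real.exp (-v x) * x k := by
  simp [outwardNormal_confMetric, sum_mul_self_sphere hx]

theorem pd_outwardNormal {v : E n → ℝ} (hv : ContDiff ℝ ∞ v) (i k : Fin (n + 1)) {x : E n}
    (hx : x ∈ sphere (0 : E n) 1) :
    pd i (outwardNormal (confMetric fun y => Real.exp (v y)) k) x =
      Real.exp (-v x) * (-pd i v x * x k + (if i = k then 1 else 0) - x i * x k) := by
  have hd := hv.differentiableAt_top x
  have hs := sum_mul_self_sphere hx
  have hsd : DifferentiableAt ℝ (fun y : E n => ∑ i, y i * y i) x := by fun_prop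
  have hg : HasDerivAt (fun s : ℝ => (√s)⁻¹) (-1 / 2) ((fun y : E n => ∑ i, y i * y i) x) := by
    change HasDerivAt _ _ (∑ i, x i * x i)
    rw [hs]
    refine ((Real.hasDerivAt_sqrt one_ne_zero).fun_inv (by simp)).congr_deriv ?_
    norm_num
  have hgd : DifferentiableAt ℝ (fun y : E n => (√(∑ i, y i * y i))⁻¹) x :=
    DifferentiableAt.comp (g := fun s : ℝ => (√s)⁻¹) (f := fun y : E n => ∑ i, y i * y i) x
      hg.differentiableAt hsd
  have hc : ∀ j, DifferentiableAt ℝ (fun y : E n => y j) x := fun j => by fun_prop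
  rw [outwardNormal_confMetric, pd_mul (by fun_prop) ((hc k).fun_mul hgd), pd_exp hd.fun_neg,
    pd_neg, pd_mul (hc k) hgd, pd_comp hg hsd, pd_sum (fun j => (hc j).fun_mul (hc j)), pd_coord]
  have hsum : ∑ k, pd i (fun y : E n => y k * y k) x = 2 * x i := by
    simp only [pd_mul (hc _) (hc _), pd_coord, ite_mul, mul_ite, one_mul, zero_mul, mul_one,
      mul_zero, Finset.sum_add_distrib, Finset.sum_ite_eq, Finset.mem_univ, if_true]
    ring
  rw [hsum]
  simp only [hs, Real.sqrt_one, inv_one]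
  ring

theorem meanCurv_confMetric (hn : n ≠ 0) {v : E n → ℝ} (hv : ContDiff ℝ ∞ v) {x : E n}
    (hx : x ∈ sphere (0 : E n) 1) :
    meanCurv (confMetric fun y => Real.exp (v y)) x = Real.exp (-v x) * (1 + rad v x) := by
  have hs := sum_mul_self_sphere hx
  have he : Real.exp (-2 * v x) * Real.exp (2 * v x) = 1 := by
    rw [← Real.exp_add]; norm_num
  have he2 : Real.exp (-2 * v x) = Real.exp (-v x) * Real.exp (-v x) := by
    rw [← Real.exp_add]; ring_nf
  have hcov : ∀ i k, covDerivNormal (confMetric fun y => Real.exp (v y)) x i k =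
      Real.exp (-v x) * ((if i = k then 1 + rad v x else 0) - x i * x k - x i * pd k v x) := by
    intro i k
    unfold covDerivNormal
    simp only [pd_outwardNormal hv i k hx, christoffel_confMetric hv, outwardNormal_sphere v _ hx,
      add_mul, sub_mul, ite_mul, zero_mul, Finset.sum_add_distrib, Finset.sum_sub_distrib,
      Finset.sum_ite_eq, Finset.mem_univ, if_true]
    rcases eq_or_ne i k with rfl | h
    · simp only [if_true, mul_left_comm _ (Real.exp (-v x)), ← Finset.mul_sum, rad]
      simp only [mul_comm (pd _ v x)]
      ring
    · simp [h, h.symm]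
      ring
  have htan : ∀ i j, tangentialInverse (confMetric fun y => Real.exp (v y)) x i j =
      Real.exp (-2 * v x) * ((if i = j then 1 else 0) - x i * x j) := by
    intro i j
    rw [tangentialInverse, confMetric_exp_inv_apply, outwardNormal_sphere v _ hx,
      outwardNormal_sphere v _ hx, he2]
    split_ifs <;> ring
  unfold meanCurv
  simp only [hcov, htan, confMetric_exp_apply, ite_mul, zero_mul, Finset.sum_ite_eq,
    Finset.mem_univ, if_true]
  have e : ∀ i j, Real.exp (-2 * v x) * ((if i = j then 1 else 0) - x i * x j) *
      (Real.exp (2 * v x) * (Real.exp (-v x) * ((if i = j then 1 + rad v x else 0) - x i * x j -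
        x i * pd j v x))) = Real.exp (-v x) * ((if i = j then (1 + rad v x) - x i * x j -
        x i * pd j v x - x i * x j * (1 + rad v x) else 0) + (x i * x i) * (x j * x j) +
          (x i * x i) * (x j * pd j v x)) := by
    intro i j
    split_ifs
    · linear_combination (Real.exp (-v x) * (1 - x i * x j) * (1 + rad v x - x i * x j -
        x i * pd j v x)) * he
    · linear_combination (Real.exp (-v x) * (0 - x i * x j) * (0 - x i * x j -
        x i * pd j v x)) * he
  simp only [e, ← Finset.mul_sum, Finset.sum_add_distrib, Finset.sum_ite_eq, Finset.mem_univ,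
    if_true, ← Finset.sum_mul, hs, Finset.sum_sub_distrib, Finset.sum_const]
  have hr : ∑ i, x i * pd i v x = rad v x := rfl
  have hn' : (n : ℝ) ≠ 0 := by exact_mod_cast hn
  simp only [hr]
  simp
  field_simp
  ring

theorem H2_mul_areaDensity (hn : 2 ≤ n) {v : E n → ℝ} (hv : ContDiff ℝ ∞ v) {x : E n}
    (hx : x ∈ sphere (0 : E n) 1) :
    H2 (confMetric fun y => Real.exp (v y)) x *
      areaDensity (confMetric fun y => Real.exp (v y)) x = bdryDensity v x := by
  have he : Real.exp (((n : ℝ) - 3) * v x) = Real.exp (-v x) ^ 3 * Real.exp (n * v x) := by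
    rw [← Real.exp_nat_mul, ← Real.exp_add]; push_cast; ring_nf
  have he2 : Real.exp (-2 * v x) = Real.exp (-v x) * Real.exp (-v x) := by
    rw [← Real.exp_add]; ring_nf
  have htr : ∑ i, ∑ j, tangentialInverse (confMetric fun y => Real.exp (v y)) x i j *
      schouten (confMetric fun y => Real.exp (v y)) x i j =
      Real.exp (-v x) ^ 2 * tanSch v x := by
    unfold tangentialInverse
    simp only [confMetric_exp_inv_apply, outwardNormal_sphere v _ hx, schouten_confMetric hn hv,
      sub_mul, ite_mul, zero_mul, Finset.sum_sub_distrib, Finset.sum_ite_eq, Finset.mem_univ,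
      if_true, ← Finset.mul_sum, sum_sch, tanSch, he2]
    rw [mul_sub, Finset.mul_sum]
    congr 1
    · ring
    · refine Finset.sum_congr rfl fun i _ => ?_
      rw [Finset.mul_sum]
      refine Finset.sum_congr rfl fun j _ => ?_
      ring
  rw [H2, htr, meanCurv_confMetric (by omega) hv hx, areaDensity_confMetric v hx, bdryDensity, he]
  ring

theorem S2_confMetric (hn : 2 ≤ n) {v : E n → ℝ} (hv : ContDiff ℝ ∞ v) :
    S2 (confMetric fun y => Real.exp (v y)) = (∫ x in B n, bulkDensity v x) +
      ∫ x : sphere (0 : E n) 1, bdryDensity v x ∂(surfaceMeasure n) := by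
  unfold S2
  simp only [sigma2_mul_volDensity hn hv, fun x : sphere (0 : E n) 1 =>
    H2_mul_areaDensity hn hv x.2]

theorem boundaryVol_confMetric (v : E n → ℝ) :
    boundaryVol (confMetric fun y => Real.exp (v y)) =
      ∫ x : sphere (0 : E n) 1, Real.exp (n * v x) ∂(surfaceMeasure n) := by
  unfold boundaryVol
  simp only [fun x : sphere (0 : E n) 1 => areaDensity_confMetric v x.2]

/-! ### Differential identities in the ball and on the sphere -/

/-- The second radial derivative `xᵢ xⱼ ∂ᵢ ∂ⱼ`. -/
def rad2 (a : E n → ℝ) (x : E n) : ℝ := ∑ i, ∑ j, x i * x j * pd i (pd j a) x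

/-- The Hessian of `v`, applied to the position vector and the gradient of `a`. -/
def radHess (v a : E n → ℝ) (x : E n) : ℝ := ∑ i, ∑ j, x i * pd i (pd j v) x * pd j a x

/-- The inner product of two Hessians. -/
def hessDot (a b : E n → ℝ) (x : E n) : ℝ := ∑ i, ∑ j, pd i (pd j a) x * pd i (pd j b) x

/-- The inner product of the tangential parts of two gradients at a point of the unit sphere. -/
def tanDot (a b : E n → ℝ) (x : E n) : ℝ := gradDot a b x - rad a x * rad b x

/-- The Laplacian of the unit sphere applied to the restriction of `a`, in terms of the
derivatives of `a` in the ambient space. -/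
def tanLap (a : E n → ℝ) (x : E n) : ℝ := lap a x - rad2 a x - n * rad a x

/-- The Newton tensor `T = (tr S) δ - S` of the Schouten tensor `S` of `e^{2v} dx²`, applied to two
gradients. -/
def newton (v a b : E n → ℝ) (x : E n) : ℝ :=
  trSch v x * gradDot a b x - ∑ i, ∑ j, sch v x i j * pd i a x * pd j b x

/-- The linearization at `v` in the direction `φ` of the Schouten tensor of `e^{2v} dx²`. -/
def linSch (v φ : E n → ℝ) (x : E n) (i j : Fin (n + 1)) : ℝ :=
  -pd i (pd j φ) x + pd i v x * pd j φ x + pd i φ x * pd j v x -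
    if i = j then gradDot v φ x else 0

theorem contDiff_gradDot {a b : E n → ℝ} (ha : ContDiff ℝ ∞ a) (hb : ContDiff ℝ ∞ b) :
    ContDiff ℝ ∞ (gradDot a b) :=
  ContDiff.sum fun i _ => (contDiff_pd ha i).mul (contDiff_pd hb i)

theorem contDiff_lap {a : E n → ℝ} (ha : ContDiff ℝ ∞ a) : ContDiff ℝ ∞ (lap a) :=
  ContDiff.sum fun i _ => contDiff_pd (contDiff_pd ha i) i

theorem contDiff_rad {a : E n → ℝ} (ha : ContDiff ℝ ∞ a) : ContDiff ℝ ∞ (rad a) :=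
  ContDiff.sum fun i _ => (contDiff_coord i).mul (contDiff_pd ha i)

theorem contDiff_rad2 {a : E n → ℝ} (ha : ContDiff ℝ ∞ a) : ContDiff ℝ ∞ (rad2 a) :=
  ContDiff.sum fun i _ => ContDiff.sum fun j _ =>
    ((contDiff_coord i).mul (contDiff_coord j)).mul (contDiff_pd (contDiff_pd ha j) i)

theorem contDiff_sch {v : E n → ℝ} (hv : ContDiff ℝ ∞ v) (i j : Fin (n + 1)) :
    ContDiff ℝ ∞ fun x => sch v x i j := by
  unfold sch
  have h1 := contDiff_pd (contDiff_pd hv j) i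
  have h2 := contDiff_pd hv i
  have h3 := contDiff_pd hv j
  have h4 := contDiff_gradDot hv hv
  split_ifs <;> fun_prop

theorem contDiff_trSch {v : E n → ℝ} (hv : ContDiff ℝ ∞ v) : ContDiff ℝ ∞ (trSch v) := by
  unfold trSch
  have h1 := contDiff_lap hv
  have h4 := contDiff_gradDot hv hv
  fun_prop

theorem contDiff_tanSch {v : E n → ℝ} (hv : ContDiff ℝ ∞ v) : ContDiff ℝ ∞ (tanSch v) := by
  unfold tanSch
  have h1 := contDiff_trSch hv
  have h4 := fun i j => contDiff_sch hv i j
  fun_prop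

theorem contDiff_tanDot {a b : E n → ℝ} (ha : ContDiff ℝ ∞ a) (hb : ContDiff ℝ ∞ b) :
    ContDiff ℝ ∞ (tanDot a b) :=
  (contDiff_gradDot ha hb).sub ((contDiff_rad ha).mul (contDiff_rad hb))

theorem contDiff_tanLap {a : E n → ℝ} (ha : ContDiff ℝ ∞ a) : ContDiff ℝ ∞ (tanLap a) :=
  ((contDiff_lap ha).sub (contDiff_rad2 ha)).sub (contDiff_const.mul (contDiff_rad ha))

theorem contDiff_newton {v a b : E n → ℝ} (hv : ContDiff ℝ ∞ v) (ha : ContDiff ℝ ∞ a)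
    (hb : ContDiff ℝ ∞ b) : ContDiff ℝ ∞ (newton v a b) := by
  unfold newton
  have h1 := contDiff_trSch hv
  have h4 := fun i j => contDiff_sch hv i j
  have h5 := contDiff_gradDot ha hb
  have h2 := fun i => contDiff_pd ha i
  have h3 := fun i => contDiff_pd hb i
  fun_prop

theorem contDiff_bulkDensity {v : E n → ℝ} (hv : ContDiff ℝ ∞ v) :
    ContDiff ℝ ∞ (bulkDensity v) := by
  unfold bulkDensity
  have h1 := contDiff_trSch hv
  have h4 := fun i j => contDiff_sch hv i j
  fun_prop

theorem contDiff_bdryDensity {v : E n → ℝ} (hv : ContDiff ℝ ∞ v) :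
    ContDiff ℝ ∞ (bdryDensity v) := by
  unfold bdryDensity
  have h1 := contDiff_tanSch hv
  have h4 := contDiff_rad hv
  fun_prop

theorem gradDot_comm (a b : E n → ℝ) (x : E n) : gradDot a b x = gradDot b a x :=
  Finset.sum_congr rfl fun _ _ => mul_comm _ _

theorem gradDot_mul_left {a b φ : E n → ℝ} (ha : ContDiff ℝ ∞ a) (hb : ContDiff ℝ ∞ b) (x : E n) :
    gradDot (fun y => a y * b y) φ x = gradDot a φ x * b x + a x * gradDot b φ x := by
  simp only [gradDot, pd_mul (ha.differentiableAt_top x) (hb.differentiableAt_top x), add_mul,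
    Finset.sum_add_distrib, Finset.mul_sum, Finset.sum_mul]
  congr 1 <;> exact Finset.sum_congr rfl fun _ _ => by ring

theorem gradDot_exp_left {a φ : E n → ℝ} (ha : ContDiff ℝ ∞ a) (x : E n) :
    gradDot (fun y => Real.exp (a y)) φ x = Real.exp (a x) * gradDot a φ x := by
  simp only [gradDot, pd_exp (ha.differentiableAt_top x), Finset.mul_sum, mul_assoc]

theorem gradDot_const_mul_left {a φ : E n → ℝ} (c : ℝ) (ha : ContDiff ℝ ∞ a) (x : E n) :
    gradDot (fun y => c * a y) φ x = c * gradDot a φ x := by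
  simp only [gradDot, pd_const_mul c (ha.differentiableAt_top x), Finset.mul_sum, mul_assoc]

theorem gradDot_add_left {a b φ : E n → ℝ} (ha : ContDiff ℝ ∞ a) (hb : ContDiff ℝ ∞ b) (x : E n) :
    gradDot (fun y => a y + b y) φ x = gradDot a φ x + gradDot b φ x := by
  simp only [gradDot, pd_add (ha.differentiableAt_top x) (hb.differentiableAt_top x), add_mul,
    Finset.sum_add_distrib]

theorem rad_mul {a b : E n → ℝ} (ha : ContDiff ℝ ∞ a) (hb : ContDiff ℝ ∞ b) (x : E n) :
    rad (fun y => a y * b y) x = rad a x * b x + a x * rad b x := by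
  simp only [rad, pd_mul (ha.differentiableAt_top x) (hb.differentiableAt_top x), mul_add,
    Finset.sum_add_distrib, Finset.mul_sum, Finset.sum_mul]
  congr 1 <;> exact Finset.sum_congr rfl fun _ _ => by ring

theorem rad_exp {a : E n → ℝ} (ha : ContDiff ℝ ∞ a) (x : E n) :
    rad (fun y => Real.exp (a y)) x = Real.exp (a x) * rad a x := by
  simp only [rad, pd_exp (ha.differentiableAt_top x), Finset.mul_sum, mul_left_comm]

theorem rad_const_mul {a : E n → ℝ} (c : ℝ) (ha : ContDiff ℝ ∞ a) (x : E n) :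
    rad (fun y => c * a y) x = c * rad a x := by
  simp only [rad, pd_const_mul c (ha.differentiableAt_top x), Finset.mul_sum, mul_left_comm]

theorem rad_add {a b : E n → ℝ} (ha : ContDiff ℝ ∞ a) (hb : ContDiff ℝ ∞ b) (x : E n) :
    rad (fun y => a y + b y) x = rad a x + rad b x := by
  simp only [rad, pd_add (ha.differentiableAt_top x) (hb.differentiableAt_top x), mul_add,
    Finset.sum_add_distrib]

theorem pd_gradDot {a b : E n → ℝ} (ha : ContDiff ℝ ∞ a) (hb : ContDiff ℝ ∞ b) (i : Fin (n + 1))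
    (x : E n) : pd i (gradDot a b) x =
      ∑ j, (pd i (pd j a) x * pd j b x + pd j a x * pd i (pd j b) x) := by
  have h1 := fun j => (contDiff_pd ha j).differentiableAt_top x
  have h2 := fun j => (contDiff_pd hb j).differentiableAt_top x
  unfold gradDot
  rw [pd_sum (fun j => (h1 j).fun_mul (h2 j))]
  exact Finset.sum_congr rfl fun j _ => pd_mul (h1 j) (h2 j) i

theorem gradDot_gradDot {a b d : E n → ℝ} (ha : ContDiff ℝ ∞ a) (hb : ContDiff ℝ ∞ b) (x : E n) :
    gradDot (gradDot a b) d x = hess a d b x + hess b d a x := by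
  rw [gradDot]
  simp only [pd_gradDot ha hb, Finset.sum_add_distrib, Finset.sum_mul, add_mul, hess]
  congr 1
  · exact Finset.sum_congr rfl fun i _ => Finset.sum_congr rfl fun j _ => by ring
  · exact Finset.sum_congr rfl fun i _ => Finset.sum_congr rfl fun j _ => by ring

theorem hess_comm {v : E n → ℝ} (hv : ContDiff ℝ ∞ v) (a b : E n → ℝ) (x : E n) :
    hess v a b x = hess v b a x := by
  rw [hess, hess, Finset.sum_comm]
  refine Finset.sum_congr rfl fun i _ => Finset.sum_congr rfl fun j _ => ?_
  rw [pd_comm hv]; ring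

theorem pd_rad {a : E n → ℝ} (ha : ContDiff ℝ ∞ a) (i : Fin (n + 1)) (x : E n) :
    pd i (rad a) x = pd i a x + ∑ j, x j * pd i (pd j a) x := by
  have h1 := fun j => (contDiff_pd ha j).differentiableAt_top x
  have h2 := fun j => (contDiff_coord (n := n) j).differentiableAt_top x
  unfold rad
  rw [pd_sum (fun j => (h2 j).fun_mul (h1 j))]
  simp only [fun j => pd_mul (h2 j) (h1 j) i, pd_coord, Finset.sum_add_distrib, ite_mul, one_mul,
    zero_mul, Finset.sum_ite_eq, Finset.mem_univ, if_true]

theorem gradDot_rad {a b : E n → ℝ} (ha : ContDiff ℝ ∞ a) (x : E n) :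
    gradDot (rad a) b x = gradDot a b x + radHess a b x := by
  rw [gradDot]
  simp only [pd_rad ha, add_mul, Finset.sum_add_distrib, radHess, gradDot]
  congr 1
  simp only [Finset.sum_mul]
  rw [Finset.sum_comm]
  refine Finset.sum_congr rfl fun i _ => Finset.sum_congr rfl fun j _ => ?_
  rw [pd_comm ha]

theorem rad_rad {a : E n → ℝ} (ha : ContDiff ℝ ∞ a) (x : E n) :
    rad (rad a) x = rad a x + rad2 a x := by
  rw [rad]
  simp only [pd_rad ha, mul_add, Finset.sum_add_distrib, rad2, rad, Finset.mul_sum, mul_assoc]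

theorem sum_pd_mul_field {a : E n → ℝ} {W : Fin (n + 1) → E n → ℝ} (ha : ContDiff ℝ ∞ a)
    (hW : ∀ i, ContDiff ℝ ∞ (W i)) (x : E n) :
    ∑ i, pd i (fun y => a y * W i y) x = ∑ i, pd i a x * W i x + a x * ∑ i, pd i (W i) x := by
  simp only [fun i => pd_mul (ha.differentiableAt_top x) ((hW i).differentiableAt_top x) i,
    Finset.sum_add_distrib, Finset.mul_sum]

theorem sum_pd_mul_pd {a φ : E n → ℝ} (ha : ContDiff ℝ ∞ a) (hφ : ContDiff ℝ ∞ φ) (x : E n) :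
    ∑ i, pd i (fun y => a y * pd i φ y) x = gradDot a φ x + a x * lap φ x :=
  sum_pd_mul_field ha (fun i => contDiff_pd hφ i) x

theorem pd_lap {v : E n → ℝ} (hv : ContDiff ℝ ∞ v) (j : Fin (n + 1)) (x : E n) :
    pd j (lap v) x = ∑ i, pd i (pd i (pd j v)) x := by
  unfold lap
  rw [pd_sum fun i => (contDiff_pd (contDiff_pd hv i) i).differentiableAt_top x]
  refine Finset.sum_congr rfl fun i _ => ?_
  rw [pd_comm (contDiff_pd hv i), funext fun y => pd_comm hv j i y]

theorem sum_pd_hess {v φ : E n → ℝ} (hv : ContDiff ℝ ∞ v) (hφ : ContDiff ℝ ∞ φ) (x : E n) :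
    ∑ i, pd i (fun y => ∑ j, pd i (pd j v) y * pd j φ y) x =
      gradDot (lap v) φ x + hessDot v φ x := by
  have h1 := fun i j => (contDiff_pd (contDiff_pd hv j) i).differentiableAt_top x
  have h2 := fun j => (contDiff_pd hφ j).differentiableAt_top x
  have e : ∀ i, pd i (fun y => ∑ j, pd i (pd j v) y * pd j φ y) x =
      ∑ j, (pd i (pd i (pd j v)) x * pd j φ x + pd i (pd j v) x * pd i (pd j φ) x) := by
    intro i
    rw [pd_sum (fun j => (h1 i j).fun_mul (h2 j))]
    exact Finset.sum_congr rfl fun j _ => pd_mul (h1 i j) (h2 j) i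
  simp only [e, Finset.sum_add_distrib, hessDot]
  congr 1
  rw [Finset.sum_comm, gradDot]
  simp only [pd_lap hv, Finset.sum_mul]

/-- Integration by parts on the unit sphere: `⟨∇F, ∇φ⟩ + F Δφ`, for the tangential gradient and
Laplacian, has zero mean. -/
theorem integral_sphere_tanDot_add {F φ : E n → ℝ} (hF : ContDiff ℝ ∞ F) (hφ : ContDiff ℝ ∞ φ) :
    ∫ x : sphere (0 : E n) 1, (tanDot F φ x + F x * tanLap φ x) ∂(surfaceMeasure n) = 0 := by
  -- The field `|y|² ∇φ - (∂ᵣφ) y` is smooth and tangent to every centred sphere.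
  let s : E n → ℝ := fun x => ∑ j, x j * x j
  have hs : ContDiff ℝ ∞ s := by fun_prop
  have hr := contDiff_rad hφ
  have hp := fun i => contDiff_pd hφ i
  let W : Fin (n + 1) → E n → ℝ := fun i y => s y * pd i φ y - rad φ y * y i
  have hW : ∀ i, ContDiff ℝ ∞ (W i) := fun i => by fun_prop
  have ht : ∀ x, ∑ i, x i * (F x * W i x) = 0 := by
    intro x
    have : ∀ i, x i * (F x * W i x) = F x * s x * (x i * pd i φ x) - F x * rad φ x * (x i * x i) :=
      fun i => by simp only [W]; ring
    simp only [this, Finset.sum_sub_distrib, ← Finset.mul_sum]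
    simp only [s, rad]; ring
  rw [← integral_sphere_div_eq_zero (V := fun i y => F y * W i y) (fun i => hF.mul (hW i)) ht]
  congr 1
  funext x
  have hx := sum_mul_self_sphere x.2
  have hsx : s x = 1 := hx
  rw [sum_pd_mul_field hF hW]
  have h1 : ∑ i, pd i F x * W i x = tanDot F φ x := by
    have : ∀ i, pd i F x * W i x = pd i F x * pd i φ x - rad φ x * ((x : E n) i * pd i F x) :=
      fun i => by simp only [W, hsx]; ring
    simp only [this, Finset.sum_sub_distrib, ← Finset.mul_sum]
    simp only [tanDot, gradDot, rad]; ring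
  have h2 : ∑ i, pd i (W i) x = tanLap φ x := by
    have hc := fun j => (contDiff_coord (n := n) j).differentiableAt_top (x : E n)
    have hsi : ∀ i, pd i s x = 2 * (x : E n) i := by
      intro i
      simp only [s]
      rw [pd_sum (fun j => (hc j).fun_mul (hc j))]
      simp only [fun j => pd_mul (hc j) (hc j) i, pd_coord, ite_mul, mul_ite, one_mul, zero_mul, mul_one,
        mul_zero, Finset.sum_add_distrib, Finset.sum_ite_eq, Finset.mem_univ, if_true]
      ring
    have : ∀ i, pd i (W i) x = 2 * ((x : E n) i * pd i φ x) + pd i (pd i φ) x -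
        ((x : E n) i * pd i (rad φ) x + rad φ x) := by
      intro i
      simp only [W]
      rw [pd_sub ((hs.mul (hp i)).differentiableAt_top _)
        ((hr.mul (contDiff_coord i)).differentiableAt_top _),
        pd_mul (hs.differentiableAt_top _) ((hp i).differentiableAt_top _),
        pd_mul (hr.differentiableAt_top _) (hc i), hsi, hsx, pd_coord]
      simp; ring
    simp only [this, Finset.sum_sub_distrib, Finset.sum_add_distrib, ← Finset.mul_sum]
    have h3 : ∑ i, (x : E n) i * pd i (rad φ) x = rad φ x + rad2 φ x := rad_rad hφ _
    have h4 : ∑ i, (x : E n) i * pd i φ x = rad φ x := rfl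
    rw [h3, h4, tanLap, lap]
    simp; ring
  rw [h1, h2]

/-- The field `T ∇φ`, where `T` is the Newton tensor of `e^{2v} dx²` and `∇` the flat gradient. -/
def newtonField (v φ : E n → ℝ) (i : Fin (n + 1)) (x : E n) : ℝ :=
  trSch v x * pd i φ x - ∑ j, sch v x i j * pd j φ x

theorem newtonField_eq (v φ : E n → ℝ) (i : Fin (n + 1)) (x : E n) :
    newtonField v φ i x = (-lap v x + (2 - (n : ℝ)) / 2 * gradDot v v x) * pd i φ x +
      ∑ j, pd i (pd j v) x * pd j φ x - gradDot v φ x * pd i v x := by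
  simp only [newtonField, sch, trSch, sub_mul, add_mul, neg_mul, ite_mul, zero_mul,
    Finset.sum_sub_distrib, Finset.sum_add_distrib, Finset.sum_neg_distrib, Finset.sum_ite_eq,
    Finset.mem_univ, if_true, mul_assoc]
  have : ∑ j, pd i v x * (pd j v x * pd j φ x) = pd i v x * gradDot v φ x := by
    rw [gradDot, Finset.mul_sum]
  rw [this]
  ring

theorem contDiff_newtonField {v φ : E n → ℝ} (hv : ContDiff ℝ ∞ v) (hφ : ContDiff ℝ ∞ φ)
    (i : Fin (n + 1)) : ContDiff ℝ ∞ (newtonField v φ i) := by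
  unfold newtonField
  have h1 := contDiff_trSch hv
  have h4 := fun i j => contDiff_sch hv i j
  have h5 := fun i => contDiff_pd hφ i
  fun_prop

theorem sum_pd_mul_newtonField (v a φ : E n → ℝ) (x : E n) :
    ∑ i, pd i a x * newtonField v φ i x = newton v a φ x := by
  simp only [newtonField, newton, gradDot, mul_sub, Finset.sum_sub_distrib, Finset.mul_sum]
  congr 1
  · exact Finset.sum_congr rfl fun i _ => by ring
  · exact Finset.sum_congr rfl fun i _ => Finset.sum_congr rfl fun j _ => by ring

theorem newton_eq (v a b : E n → ℝ) (x : E n) :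
    newton v a b x = (-lap v x + (2 - (n : ℝ)) / 2 * gradDot v v x) * gradDot a b x +
      hess v a b x - gradDot v a x * gradDot v b x := by
  rw [← sum_pd_mul_newtonField]
  simp only [newtonField_eq, mul_sub, mul_add, Finset.sum_sub_distrib, Finset.sum_add_distrib]
  have h1 : ∀ (k : ℝ) (c : E n → ℝ), ∑ i, pd i a x * (k * pd i c x) = k * gradDot a c x := by
    intro k c
    rw [gradDot, Finset.mul_sum]
    exact Finset.sum_congr rfl fun i _ => by ring
  rw [h1, h1, hess]
  simp only [Finset.mul_sum]
  have h2 : ∑ i, ∑ j, pd i a x * (pd i (pd j v) x * pd j b x) =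
      ∑ i, ∑ j, pd i (pd j v) x * pd i a x * pd j b x :=
    Finset.sum_congr rfl fun i _ => Finset.sum_congr rfl fun j _ => by ring
  rw [h2, gradDot_comm v a]
  ring

theorem sum_linSch (v φ : E n → ℝ) (x : E n) :
    ∑ i, linSch v φ x i i = -lap φ x + (1 - (n : ℝ)) * gradDot v φ x := by
  have e : ∀ i, pd i φ x * pd i v x = pd i v x * pd i φ x := fun i => mul_comm _ _
  simp only [linSch, if_true, e, Finset.sum_sub_distrib, Finset.sum_add_distrib,
    Finset.sum_neg_distrib, Finset.sum_const]
  simp only [lap, gradDot]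
  simp
  ring

theorem sum_sch_mul_linSch {v : E n → ℝ} (φ : E n → ℝ) (hv : ContDiff ℝ ∞ v) (x : E n) :
    ∑ i, ∑ j, sch v x i j * linSch v φ x i j = hessDot v φ x - 2 * hess v v φ x +
      lap v x * gradDot v φ x - hess φ v v x + ((n : ℝ) + 1) / 2 * gradDot v v x * gradDot v φ x
      + gradDot v v x * lap φ x / 2 := by
  have e : ∀ i j, sch v x i j * linSch v φ x i j =
      pd i (pd j v) x * pd i (pd j φ) x - pd i (pd j v) x * pd i v x * pd j φ x
      - pd i (pd j v) x * pd i φ x * pd j v x - pd i (pd j φ) x * pd i v x * pd j v x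
      + (pd i v x * pd i v x) * (pd j v x * pd j φ x) + (pd i v x * pd i φ x) * (pd j v x * pd j v x)
      + (if i = j then pd i (pd j v) x * gradDot v φ x - pd i v x * pd j v x * gradDot v φ x
        + gradDot v v x / 2 * pd i (pd j φ) x - gradDot v v x / 2 * (pd i v x * pd j φ x)
        - gradDot v v x / 2 * (pd i φ x * pd j v x) + gradDot v v x / 2 * gradDot v φ x else 0) := by
    intro i j
    rw [sch, linSch]
    split_ifs <;> ring
  have e2 : ∀ i, pd i φ x * pd i v x = pd i v x * pd i φ x := fun i => mul_comm _ _
  simp only [e, Finset.sum_sub_distrib, Finset.sum_add_distrib, Finset.sum_ite_eq, Finset.mem_univ,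
    if_true, e2, ← Finset.mul_sum, ← Finset.sum_mul, Finset.sum_const]
  have h1 : ∑ i, pd i v x * pd i φ x = gradDot v φ x := rfl
  have h2 : ∑ i, pd i v x * pd i v x = gradDot v v x := rfl
  have h3 : ∑ i, ∑ j, pd i (pd j v) x * pd i (pd j φ) x = hessDot v φ x := rfl
  have h4 : ∑ i, ∑ j, pd i (pd j v) x * pd i v x * pd j φ x = hess v v φ x := rfl
  have h5 : ∑ i, ∑ j, pd i (pd j v) x * pd i φ x * pd j v x = hess v v φ x := hess_comm hv _ _ _
  have h6 : ∑ i, ∑ j, pd i (pd j φ) x * pd i v x * pd j v x = hess φ v v x := rfl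
  have h7 : ∑ i, pd i (pd i v) x = lap v x := rfl
  have h8 : ∑ i, pd i (pd i φ) x = lap φ x := rfl
  rw [h1, h2, h3, h4, h5, h6, h7, h8]
  simp
  ring

/-- The divergence of `θ e^{(n-3)v} T ∇φ`. The Newton tensor is divergence free for the metric
`e^{2v} dx²`, so that no third derivatives of `v` are left. -/
theorem div_newtonField {v θ φ : E n → ℝ} (hv : ContDiff ℝ ∞ v) (hθ : ContDiff ℝ ∞ θ)
    (hφ : ContDiff ℝ ∞ φ) (x : E n) :
    ∑ i, pd i (fun y => (θ y * Real.exp (((n : ℝ) - 3) * v y)) * newtonField v φ i y) x =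
      Real.exp (((n : ℝ) - 3) * v x) * (newton v θ φ x +
        θ x * (∑ i, ∑ j, sch v x i j * linSch v φ x i j - trSch v x * ∑ i, linSch v φ x i i)) := by
  have hcv : ContDiff ℝ ∞ fun y => ((n : ℝ) - 3) * v y := by fun_prop
  have hecv : ContDiff ℝ ∞ fun y => Real.exp (((n : ℝ) - 3) * v y) := by fun_prop
  have hl := contDiff_lap hv
  have hg := contDiff_gradDot hv hv
  have hgp := contDiff_gradDot hv hφ
  have hp := fun i => contDiff_pd hφ i
  have hpv := fun i => contDiff_pd hv i
  have hpv2 := fun i j => contDiff_pd (hpv j) i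
  have hα : ContDiff ℝ ∞ fun y => -lap v y + (2 - (n : ℝ)) / 2 * gradDot v v y := by fun_prop
  rw [sum_pd_mul_field (hθ.mul hecv) (contDiff_newtonField hv hφ), sum_pd_mul_newtonField]
  have h1 : newton v (fun y => θ y * Real.exp (((n : ℝ) - 3) * v y)) φ x =
      Real.exp (((n : ℝ) - 3) * v x) * (newton v θ φ x + θ x * (((n : ℝ) - 3) * newton v v φ x)) := by
    simp only [← sum_pd_mul_newtonField, Finset.mul_sum, ← Finset.sum_add_distrib]
    refine Finset.sum_congr rfl fun i _ => ?_
    rw [pd_mul (hθ.differentiableAt_top x) (hecv.differentiableAt_top x),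
      pd_exp (hcv.differentiableAt_top x), pd_const_mul _ (hv.differentiableAt_top x)]
    ring
  have h2 : ∑ i, pd i (newtonField v φ i) x =
      gradDot (fun y => -lap v y + (2 - (n : ℝ)) / 2 * gradDot v v y) φ x +
      (-lap v x + (2 - (n : ℝ)) / 2 * gradDot v v x) * lap φ x + (gradDot (lap v) φ x +
      hessDot v φ x) - (gradDot (gradDot v φ) v x + gradDot v φ x * lap v x) := by
    rw [← sum_pd_mul_pd hα hφ, ← sum_pd_hess hv hφ, ← sum_pd_mul_pd hgp hv,
      ← Finset.sum_add_distrib, ← Finset.sum_sub_distrib]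
    refine Finset.sum_congr rfl fun i _ => ?_
    rw [funext fun y => newtonField_eq v φ i y]
    have d1 := (hα.mul (hp i)).differentiableAt_top x
    have d2 : ContDiff ℝ ∞ (fun y => ∑ j, pd i (pd j v) y * pd j φ y) := by fun_prop
    have d3 := (hgp.mul (hpv i)).differentiableAt_top x
    rw [pd_sub (d1.fun_add (d2.differentiableAt_top x)) d3, pd_add d1 (d2.differentiableAt_top x)]
  have h3 : gradDot (fun y => -lap v y + (2 - (n : ℝ)) / 2 * gradDot v v y) φ x =
      -gradDot (lap v) φ x + (2 - (n : ℝ)) * hess v v φ x := by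
    have : (fun y => -lap v y + (2 - (n : ℝ)) / 2 * gradDot v v y) =
        fun y => (-1) * lap v y + (2 - (n : ℝ)) / 2 * gradDot v v y := by funext y; ring
    rw [this, gradDot_add_left (by fun_prop) (by fun_prop), gradDot_const_mul_left _ hl,
      gradDot_const_mul_left _ hg, gradDot_gradDot hv hv, hess_comm hv φ v]
    ring
  rw [h1, h2, h3, newton_eq v v φ, gradDot_gradDot hv hφ, hess_comm hv v φ, sum_linSch,
    sum_sch_mul_linSch φ hv, trSch, hess_comm hv v φ]
  ring

/-! ### The variation of the functional -/

theorem sum_mul_newtonField (v φ : E n → ℝ) {x : E n} :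
    ∑ i, x i * newtonField v φ i x = trSch v x * rad φ x + radHess v φ x -
      rad v x * gradDot v φ x + gradDot v v x / 2 * rad φ x := by
  simp only [newtonField_eq, mul_sub, mul_add, Finset.sum_sub_distrib, Finset.sum_add_distrib]
  have h1 : ∀ (k : ℝ) (c : E n → ℝ), ∑ i, x i * (k * pd i c x) = k * rad c x := by
    intro k c
    rw [rad, Finset.mul_sum]
    exact Finset.sum_congr rfl fun i _ => by ring
  rw [h1, h1, radHess, trSch]
  simp only [Finset.mul_sum, mul_assoc]
  ring

theorem tanSch_eq (v : E n → ℝ) {x : E n} (hx : x ∈ sphere (0 : E n) 1) :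
    tanSch v x = trSch v x + rad2 v x - rad v x ^ 2 + gradDot v v x / 2 := by
  have hs := sum_mul_self_sphere hx
  have e : ∀ i j, x i * x j * sch v x i j = -(x i * x j * pd i (pd j v) x) +
      (x i * pd i v x) * (x j * pd j v x) - if i = j then gradDot v v x / 2 * (x i * x j) else 0 := by
    intro i j
    rw [sch]
    split_ifs <;> ring
  have h1 : ∑ i, x i * pd i v x = rad v x := rfl
  simp only [tanSch, e, Finset.sum_sub_distrib, Finset.sum_add_distrib, Finset.sum_neg_distrib,
    ← Finset.mul_sum, ← Finset.sum_mul, h1, Finset.sum_ite_eq, Finset.mem_univ, if_true, hs]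
  rw [rad2]
  ring

/-- The linearization of `tanSch` at `v` in the direction `φ`. -/
def tanLinSch (v φ : E n → ℝ) (x : E n) : ℝ :=
  ∑ i, linSch v φ x i i - ∑ i, ∑ j, x i * x j * linSch v φ x i j

theorem tanLinSch_eq (v φ : E n → ℝ) {x : E n} (hx : x ∈ sphere (0 : E n) 1) :
    tanLinSch v φ x = -lap φ x + (1 - (n : ℝ)) * gradDot v φ x + rad2 φ x
      - 2 * rad v x * rad φ x + gradDot v φ x := by
  have hs := sum_mul_self_sphere hx
  have e : ∀ i j, x i * x j * linSch v φ x i j = -(x i * x j * pd i (pd j φ) x) +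
      (x i * pd i v x) * (x j * pd j φ x) + (x i * pd i φ x) * (x j * pd j v x)
      - if i = j then gradDot v φ x * (x i * x j) else 0 := by
    intro i j
    rw [linSch]
    split_ifs <;> ring
  have h1 : ∑ i, x i * pd i v x = rad v x := rfl
  have h2 : ∑ i, x i * pd i φ x = rad φ x := rfl
  simp only [tanLinSch, sum_linSch, e, Finset.sum_sub_distrib, Finset.sum_add_distrib,
    Finset.sum_neg_distrib, ← Finset.mul_sum, ← Finset.sum_mul, h1, h2, Finset.sum_ite_eq,
    Finset.mem_univ, if_true, hs]
  rw [rad2]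
  ring

/-- The derivative of `bulkDensity` at `v` in the direction `φ`. -/
def bulkVar (v φ : E n → ℝ) (x : E n) : ℝ :=
  Real.exp (((n : ℝ) - 3) * v x) * (((n : ℝ) - 3) * φ x *
    ((trSch v x ^ 2 - ∑ i, ∑ j, sch v x i j ^ 2) / 2) +
    (trSch v x * (∑ i, linSch v φ x i i) - ∑ i, ∑ j, sch v x i j * linSch v φ x i j))

/-- The derivative of `bdryDensity` at `v` in the direction `φ`. -/
def bdryVar (v φ : E n → ℝ) (x : E n) : ℝ :=
  Real.exp (((n : ℝ) - 3) * v x) * (((n : ℝ) - 3) * φ x *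
    ((1 + rad v x) * tanSch v x + (n : ℝ) / 3 * (1 + rad v x) ^ 3) +
    (rad φ x * tanSch v x + (1 + rad v x) * tanLinSch v φ x + n * (1 + rad v x) ^ 2 * rad φ x))

/-- Up to the divergence of a tangential field, which integrates to zero, the variation of the
boundary integrand contains the flux of the field `θ e^{(n-3)v} T ∇φ` of the interior. -/
theorem bdryVar_eq {v θ φ : E n → ℝ} (hv : ContDiff ℝ ∞ v) (hθ : ContDiff ℝ ∞ θ) {x : E n}
    (hx : x ∈ sphere (0 : E n) 1) :
    θ x * bdryVar v φ x = ((n : ℝ) - 3) * (θ x * φ x * bdryDensity v x) +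
      θ x * Real.exp (((n : ℝ) - 3) * v x) * ∑ i, x i * newtonField v φ i x +
      Real.exp (((n : ℝ) - 3) * v x) * (1 + rad v x) * tanDot θ φ x -
      (tanDot (fun y => θ y * (Real.exp (((n : ℝ) - 3) * v y) * (1 + rad v y))) φ x +
        θ x * (Real.exp (((n : ℝ) - 3) * v x) * (1 + rad v x)) * tanLap φ x) := by
  have hcv : ContDiff ℝ ∞ fun y => ((n : ℝ) - 3) * v y := by fun_prop
  have hecv : ContDiff ℝ ∞ fun y => Real.exp (((n : ℝ) - 3) * v y) := by fun_prop
  have hr := contDiff_rad hv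
  have hh : ContDiff ℝ ∞ fun y => 1 + rad v y := by fun_prop
  have h1 : gradDot (fun y => 1 + rad v y) φ x = gradDot v φ x + radHess v φ x := by
    rw [gradDot_add_left contDiff_const hr, gradDot_rad hv]
    simp [gradDot, pd_const]
  have h2 : rad (fun y => 1 + rad v y) x = rad v x + rad2 v x := by
    rw [rad_add contDiff_const hr, rad_rad hv]
    simp [rad, pd_const]
  simp only [tanDot]
  rw [gradDot_mul_left hθ (hecv.mul hh), gradDot_mul_left hecv hh, gradDot_exp_left hcv,
    gradDot_const_mul_left _ hv, rad_mul hθ (hecv.mul hh), rad_mul hecv hh, rad_exp hcv,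
    rad_const_mul _ hv, h1, h2, sum_mul_newtonField, bdryVar, bdryDensity, tanSch_eq v hx,
    tanLinSch_eq v φ hx, tanLap, trSch]
  ring

/-- The derivative of the functional at `v` in the direction `φ`, with a weight `θ`, after
integration by parts. -/
theorem integral_bulkVar_add_bdryVar (hn : n ≠ 0) {v θ φ : E n → ℝ} (hv : ContDiff ℝ ∞ v)
    (hθ : ContDiff ℝ ∞ θ) (hφ : ContDiff ℝ ∞ φ) :
    (∫ x in B n, θ x * bulkVar v φ x) +
      ∫ x : sphere (0 : E n) 1, θ x * bdryVar v φ x ∂(surfaceMeasure n) =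
    ((n : ℝ) - 3) * ((∫ x in B n, θ x * φ x * bulkDensity v x) +
      ∫ x : sphere (0 : E n) 1, θ x * φ x * bdryDensity v x ∂(surfaceMeasure n)) +
    (∫ x in B n, Real.exp (((n : ℝ) - 3) * v x) * newton v θ φ x) +
      ∫ x : sphere (0 : E n) 1, Real.exp (((n : ℝ) - 3) * v x) * (1 + rad v x) * tanDot θ φ x
        ∂(surfaceMeasure n) := by
  have hecv : ContDiff ℝ ∞ fun y => Real.exp (((n : ℝ) - 3) * v y) := by fun_prop
  have hr := contDiff_rad hv
  have hF : ContDiff ℝ ∞ fun y => θ y * (Real.exp (((n : ℝ) - 3) * v y) * (1 + rad v y)) := by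
    fun_prop
  have hb := (contDiff_bulkDensity hv)
  have hd := (contDiff_bdryDensity hv)
  have hN := contDiff_newton hv hθ hφ
  have hNf := fun i => contDiff_newtonField hv hφ i
  have ht := contDiff_tanDot hθ hφ
  have hV : ∀ i, ContDiff ℝ ∞
      fun y => (θ y * Real.exp (((n : ℝ) - 3) * v y)) * newtonField v φ i y := by fun_prop
  have hdiv := integral_ball_div hn hV
  have hsph := integral_sphere_tanDot_add hF hφ
  have e1 : ∀ x, θ x * bulkVar v φ x = ((n : ℝ) - 3) * (θ x * φ x * bulkDensity v x) +
      Real.exp (((n : ℝ) - 3) * v x) * newton v θ φ x -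
      ∑ i, pd i (fun y => (θ y * Real.exp (((n : ℝ) - 3) * v y)) * newtonField v φ i y) x := by
    intro x
    rw [div_newtonField hv hθ hφ, bulkVar, bulkDensity]
    ring
  have i1 : Continuous fun x => ((n : ℝ) - 3) * (θ x * φ x * bulkDensity v x) := by fun_prop
  have i2 : Continuous fun x => Real.exp (((n : ℝ) - 3) * v x) * newton v θ φ x := by fun_prop
  have i3 : Continuous fun x =>
      ∑ i, pd i (fun y => (θ y * Real.exp (((n : ℝ) - 3) * v y)) * newtonField v φ i y) x :=
    continuous_finsetSum _ fun i _ => continuous_pd (hV i) i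
  have j1 : Continuous fun x => ((n : ℝ) - 3) * (θ x * φ x * bdryDensity v x) := by fun_prop
  have j2 : Continuous fun x : E n => ∑ i, x i *
      ((θ x * Real.exp (((n : ℝ) - 3) * v x)) * newtonField v φ i x) := by
    fun_prop
  have j3 : Continuous fun x => Real.exp (((n : ℝ) - 3) * v x) * (1 + rad v x) * tanDot θ φ x := by
    fun_prop
  have j4 : Continuous fun x => (tanDot (fun y => θ y * (Real.exp (((n : ℝ) - 3) * v y) *
      (1 + rad v y))) φ x +
        θ x * (Real.exp (((n : ℝ) - 3) * v x) * (1 + rad v x)) * tanLap φ x) := by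
    have h1 := contDiff_tanDot hF hφ
    have h2 := contDiff_tanLap hφ
    fun_prop
  have e2 : ∀ x : sphere (0 : E n) 1, θ x * bdryVar v φ x =
      ((n : ℝ) - 3) * (θ x * φ x * bdryDensity v x) + (∑ i, (x : E n) i *
      ((θ x * Real.exp (((n : ℝ) - 3) * v x)) * newtonField v φ i x)) +
      Real.exp (((n : ℝ) - 3) * v x) * (1 + rad v x) * tanDot θ φ x -
      (tanDot (fun y => θ y * (Real.exp (((n : ℝ) - 3) * v y) * (1 + rad v y))) φ x +
        θ x * (Real.exp (((n : ℝ) - 3) * v x) * (1 + rad v x)) * tanLap φ x) := by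
    intro x
    rw [bdryVar_eq hv hθ x.2, Finset.mul_sum]
    congr 3
    exact Finset.sum_congr rfl fun i _ => by ring
  simp only [e1, e2]
  rw [integral_ball_sub (i1.fun_add i2) i3, integral_ball_add i1 i2,
    integral_sphere_sub ((j1.fun_add j2).fun_add j3) j4, integral_sphere_add (j1.fun_add j2) j3,
    integral_sphere_add j1 j2, hdiv, hsph, integral_const_mul, integral_const_mul]
  ring

/-! The path `t ↦ v + t φ` of logarithmic conformal factors. -/

theorem pd_add_mul {v φ : E n → ℝ} (hv : ContDiff ℝ ∞ v) (hφ : ContDiff ℝ ∞ φ) (t : ℝ)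
    (i : Fin (n + 1)) : pd i (fun y => v y + t * φ y) = fun y => pd i v y + t * pd i φ y := by
  funext y
  have := hφ.differentiableAt_top y
  rw [pd_add (hv.differentiableAt_top y) (by fun_prop), pd_const_mul _ this]

theorem pd_pd_add_mul {v φ : E n → ℝ} (hv : ContDiff ℝ ∞ v) (hφ : ContDiff ℝ ∞ φ) (t : ℝ)
    (i j : Fin (n + 1)) : pd i (pd j (fun y => v y + t * φ y)) =
      fun y => pd i (pd j v) y + t * pd i (pd j φ) y := by
  rw [pd_add_mul hv hφ, pd_add_mul (contDiff_pd hv j) (contDiff_pd hφ j)]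

theorem hasDerivAt_affine (a b t : ℝ) : HasDerivAt (fun s : ℝ => a + s * b) b t := by
  simpa using ((hasDerivAt_id t).mul_const b).const_add a

theorem hasDerivAt_gradDot_path {v φ : E n → ℝ} (hv : ContDiff ℝ ∞ v) (hφ : ContDiff ℝ ∞ φ)
    (x : E n) (t : ℝ) : HasDerivAt (fun s : ℝ => gradDot (fun y => v y + s * φ y)
      (fun y => v y + s * φ y) x) (2 * gradDot (fun y => v y + t * φ y) φ x) t := by
  unfold gradDot
  simp only [pd_add_mul hv hφ]
  rw [Finset.mul_sum]
  refine HasDerivAt.fun_sum fun i _ => ?_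
  refine ((hasDerivAt_affine _ _ t).fun_mul (hasDerivAt_affine _ _ t)).congr_deriv ?_
  ring

theorem hasDerivAt_sch_path {v φ : E n → ℝ} (hv : ContDiff ℝ ∞ v) (hφ : ContDiff ℝ ∞ φ)
    (x : E n) (i j : Fin (n + 1)) (t : ℝ) :
    HasDerivAt (fun s : ℝ => sch (fun y => v y + s * φ y) x i j)
      (linSch (fun y => v y + t * φ y) φ x i j) t := by
  have hg := hasDerivAt_gradDot_path hv hφ x t
  unfold sch linSch
  simp only [pd_pd_add_mul hv hφ]
  simp only [fun s k => congrFun (pd_add_mul hv hφ s k) x]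
  refine ((((hasDerivAt_affine _ _ t).fun_neg).fun_add
    ((hasDerivAt_affine _ _ t).fun_mul (hasDerivAt_affine _ _ t))).fun_sub
    (f' := _) (g' := if i = j then gradDot (fun y => v y + t * φ y) φ x else 0) ?_).congr_deriv ?_
  · split_ifs
    · refine (hg.div_const 2).congr_deriv (by ring)
    · exact hasDerivAt_const _ _
  · ring

theorem hasDerivAt_trSch_path {v φ : E n → ℝ} (hv : ContDiff ℝ ∞ v) (hφ : ContDiff ℝ ∞ φ)
    (x : E n) (t : ℝ) : HasDerivAt (fun s : ℝ => trSch (fun y => v y + s * φ y) x)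
      (∑ i, linSch (fun y => v y + t * φ y) φ x i i) t := by
  simp only [← sum_sch]
  exact HasDerivAt.fun_sum fun i _ => hasDerivAt_sch_path hv hφ x i i t

theorem hasDerivAt_rad_path {v φ : E n → ℝ} (hv : ContDiff ℝ ∞ v) (hφ : ContDiff ℝ ∞ φ)
    (x : E n) (t : ℝ) : HasDerivAt (fun s : ℝ => rad (fun y => v y + s * φ y) x) (rad φ x) t := by
  unfold rad
  simp only [pd_add_mul hv hφ]
  exact HasDerivAt.fun_sum fun i _ => (hasDerivAt_affine _ _ t).const_mul _

theorem hasDerivAt_exp_path (c : ℝ) (v φ : E n → ℝ) (x : E n) (t : ℝ) :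
    HasDerivAt (fun s : ℝ => Real.exp (c * (v x + s * φ x)))
      (Real.exp (c * (v x + t * φ x)) * (c * φ x)) t :=
  ((hasDerivAt_affine _ _ t).const_mul c).exp

theorem hasDerivAt_bulkDensity_path {v φ : E n → ℝ} (hv : ContDiff ℝ ∞ v) (hφ : ContDiff ℝ ∞ φ)
    (x : E n) (t : ℝ) : HasDerivAt (fun s : ℝ => bulkDensity (fun y => v y + s * φ y) x)
      (bulkVar (fun y => v y + t * φ y) φ x) t := by
  unfold bulkDensity bulkVar
  refine ((hasDerivAt_exp_path _ v φ x t).fun_mul ((((hasDerivAt_trSch_path hv hφ x t).fun_pow 2).fun_sub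
    (HasDerivAt.fun_sum fun i _ => HasDerivAt.fun_sum fun j _ =>
      (hasDerivAt_sch_path hv hφ x i j t).fun_pow 2)).div_const 2)).congr_deriv ?_
  simp only [Nat.cast_ofNat, Nat.add_one_sub_one, pow_one, mul_assoc, ← Finset.mul_sum]
  ring

theorem hasDerivAt_bdryDensity_path {v φ : E n → ℝ} (hv : ContDiff ℝ ∞ v) (hφ : ContDiff ℝ ∞ φ)
    (x : E n) (t : ℝ) : HasDerivAt (fun s : ℝ => bdryDensity (fun y => v y + s * φ y) x)
      (bdryVar (fun y => v y + t * φ y) φ x) t := by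
  have htan : HasDerivAt (fun s : ℝ => tanSch (fun y => v y + s * φ y) x)
      (tanLinSch (fun y => v y + t * φ y) φ x) t :=
    (hasDerivAt_trSch_path hv hφ x t).fun_sub
    (HasDerivAt.fun_sum fun i _ => HasDerivAt.fun_sum fun j _ =>
      (hasDerivAt_sch_path hv hφ x i j t).const_mul _)
  have hr := (hasDerivAt_rad_path hv hφ x t).const_add 1
  unfold bdryDensity bdryVar
  refine ((hasDerivAt_exp_path _ v φ x t).fun_mul ((hr.fun_mul htan).fun_add
    ((hr.fun_pow 3).const_mul _))).congr_deriv ?_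
  norm_num
  ring

/-- The functional `S₂` of the metric `e^{2v} dx²`, localized by a weight `θ`. -/
def weightedS2 (θ v : E n → ℝ) : ℝ :=
  (∫ x in B n, θ x * bulkDensity v x) +
    ∫ x : sphere (0 : E n) 1, θ x * bdryDensity v x ∂(surfaceMeasure n)

/-- The derivative of the weighted functional in the direction `φ`. It involves only first
derivatives of `θ` and `φ`. -/
theorem hasDerivAt_weightedS2 (hn : n ≠ 0) {v θ φ : E n → ℝ} (hv : ContDiff ℝ ∞ v)
    (hθ : ContDiff ℝ ∞ θ) (hφ : ContDiff ℝ ∞ φ) (t : ℝ) :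
    HasDerivAt (fun s : ℝ => weightedS2 θ (fun y => v y + s * φ y))
      (((n : ℝ) - 3) * weightedS2 (fun y => θ y * φ y) (fun y => v y + t * φ y) +
        (∫ x in B n, Real.exp (((n : ℝ) - 3) * (v x + t * φ x)) *
          newton (fun y => v y + t * φ y) θ φ x) +
        ∫ x : sphere (0 : E n) 1, Real.exp (((n : ℝ) - 3) * (v x + t * φ x)) *
          (1 + rad (fun y => v y + t * φ y) x) * tanDot θ φ x ∂(surfaceMeasure n)) t := by
  have hvt : ∀ s : ℝ, ContDiff ℝ ∞ (fun y => v y + s * φ y) := fun s => by fun_prop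
  have hb := fun s => contDiff_bulkDensity (hvt s)
  have hd := fun s => contDiff_bdryDensity (hvt s)
  have c1 := fun i => continuous_pd hv i
  have c2 := fun i => continuous_pd hφ i
  have c3 := fun i j => continuous_pd (contDiff_pd hv j) i
  have c4 := fun i j => continuous_pd (contDiff_pd hφ j) i
  have c5 := hv.continuous
  have c6 := hφ.continuous
  have c7 := hθ.continuous
  have cs : ∀ i j, Continuous fun p : ℝ × E n => sch (fun y => v y + p.1 * φ y) p.2 i j := by
    intro i j
    unfold sch gradDot
    simp only [pd_pd_add_mul hv hφ]
    simp only [pd_add_mul hv hφ]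
    split_ifs <;> fun_prop
  have cl : ∀ i j, Continuous fun p : ℝ × E n => linSch (fun y => v y + p.1 * φ y) φ p.2 i j := by
    intro i j
    unfold linSch gradDot
    simp only [pd_add_mul hv hφ]
    split_ifs <;> fun_prop
  have cr : Continuous fun p : ℝ × E n => rad (fun y => v y + p.1 * φ y) p.2 := by
    unfold rad
    simp only [pd_add_mul hv hφ]
    fun_prop
  have crφ : Continuous (rad φ) := (contDiff_rad hφ).continuous
  have cb : Continuous fun p : ℝ × E n => θ p.2 * bulkVar (fun y => v y + p.1 * φ y) φ p.2 := by
    unfold bulkVar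
    simp only [← sum_sch]
    fun_prop
  have cd : Continuous fun p : ℝ × E n => θ p.2 * bdryVar (fun y => v y + p.1 * φ y) φ p.2 := by
    unfold bdryVar tanLinSch tanSch
    simp only [← sum_sch]
    fun_prop
  have h1 := hasDerivAt_setIntegral_of_continuous (μ := (volume : Measure (E n)))
    (isCompact_closedBall (0 : E n) 1) measurableSet_closedBall
    (F := fun s x => θ x * bulkDensity (fun y => v y + s * φ y) x)
    (F' := fun s x => θ x * bulkVar (fun y => v y + s * φ y) φ x)
    (fun s => by fun_prop) cb
    (fun s x _ => (hasDerivAt_bulkDensity_path hv hφ x s).const_mul _) t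
  have h2 := hasDerivAt_sphereIntegral
    (F := fun s x => θ x * bdryDensity (fun y => v y + s * φ y) x)
    (F' := fun s x => θ x * bdryVar (fun y => v y + s * φ y) φ x)
    (fun s => by fun_prop) cd
    (fun s x _ => (hasDerivAt_bdryDensity_path hv hφ x s).const_mul _) t
  refine (h1.fun_add h2).congr_deriv ?_
  rw [integral_bulkVar_add_bdryVar hn (hvt t) hθ hφ]
  rfl

/-! ### The integral identity behind rigidity -/

/-- The relation between the Schouten tensor of `e^{2v} dx²` and `f` which expresses that the
metric `e^{2(v+f)} dx²` has vanishing Schouten tensor. -/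
theorem sch_eq_of_flat {v f : E n → ℝ} (hv : ContDiff ℝ ∞ v) (hf : ContDiff ℝ ∞ f) {x : E n}
    (h : ∀ i j, sch (fun y => v y + f y) x i j = 0) (i j : Fin (n + 1)) :
    sch v x i j = -linSch v f x i j - pd i f x * pd j f x +
      if i = j then gradDot f f x / 2 else 0 := by
  have h1 : (fun y => v y + f y) = fun y => v y + 1 * f y := by simp
  have hij := h i j
  rw [h1] at hij
  simp only [sch, pd_pd_add_mul hv hf] at hij
  simp only [pd_add_mul hv hf, gradDot] at hij
  have e : ∑ k, (pd k v x + 1 * pd k f x) * (pd k v x + 1 * pd k f x) =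
      gradDot v v x + 2 * gradDot v f x + gradDot f f x := by
    simp only [gradDot, Finset.mul_sum, ← Finset.sum_add_distrib]
    exact Finset.sum_congr rfl fun k _ => by ring
  rw [e] at hij
  rw [sch, linSch]
  split_ifs at hij ⊢ <;> linarith

theorem sum_if_mul (a : ℝ) (F G : Fin (n + 1) → ℝ) :
    ∑ i, ∑ j, (if i = j then a else 0) * F i * G j = a * ∑ i, F i * G i := by
  simp only [ite_mul, zero_mul, Finset.sum_ite_eq, Finset.mem_univ, if_true, Finset.mul_sum,
    mul_assoc]

/-- Assumptions on a pair `(v, f)` such that `e^{2(v+f)} dx²` is a flat metric on the ball for which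
the unit sphere has mean curvature one. -/
structure FlatPair (v f : E n → ℝ) : Prop where
  smooth_left : ContDiff ℝ ∞ v
  smooth_right : ContDiff ℝ ∞ f
  sch_eq : ∀ x ∈ B n, ∀ i j, sch (fun y => v y + f y) x i j = 0
  exp_eq : ∀ x ∈ sphere (0 : E n) 1, Real.exp (v x + f x) = 1 + rad v x + rad f x

namespace FlatPair

variable {v f : E n → ℝ}

theorem trSch_eq (h : FlatPair v f) {x : E n} (hx : x ∈ B n) :
    trSch v x = lap f x + ((n : ℝ) - 1) * gradDot v f x + ((n : ℝ) - 1) / 2 * gradDot f f x := by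
  have hs := sch_eq_of_flat h.smooth_left h.smooth_right (h.sch_eq x hx)
  rw [← sum_sch]
  simp only [hs, if_true, Finset.sum_add_distrib, Finset.sum_sub_distrib, Finset.sum_neg_distrib,
    sum_linSch, Finset.sum_const]
  have : ∑ i, pd i f x * pd i f x = gradDot f f x := rfl
  rw [this]
  simp
  ring

theorem sum_sch_mul (h : FlatPair v f) {x : E n} (hx : x ∈ B n) (F G : Fin (n + 1) → ℝ) :
    ∑ i, ∑ j, sch v x i j * F i * G j = (∑ i, ∑ j, pd i (pd j f) x * F i * G j) -
      (∑ i, pd i v x * F i) * (∑ i, pd i f x * G i) -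
      (∑ i, pd i f x * F i) * (∑ i, pd i v x * G i) -
      (∑ i, pd i f x * F i) * (∑ i, pd i f x * G i) +
      (gradDot v f x + gradDot f f x / 2) * ∑ i, F i * G i := by
  have hs := sch_eq_of_flat h.smooth_left h.smooth_right (h.sch_eq x hx)
  have e : ∀ i j, sch v x i j * F i * G j = pd i (pd j f) x * F i * G j -
      (pd i v x * F i) * (pd j f x * G j) - (pd i f x * F i) * (pd j v x * G j) -
      (pd i f x * F i) * (pd j f x * G j) +
      (if i = j then gradDot v f x + gradDot f f x / 2 else 0) * F i * G j := by
    intro i j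
    rw [hs, linSch]
    split_ifs <;> ring
  simp only [e, Finset.sum_add_distrib, Finset.sum_sub_distrib, sum_if_mul, ← Finset.mul_sum,
    ← Finset.sum_mul]

theorem newton_eq (h : FlatPair v f) {x : E n} (hx : x ∈ B n) :
    newton v f f x = trSch v x * gradDot f f x - (hess f f f x - gradDot v f x * gradDot f f x -
      gradDot f f x ^ 2 / 2) := by
  have h1 : ∑ i, pd i v x * pd i f x = gradDot v f x := rfl
  have h2 : ∑ i, pd i f x * pd i f x = gradDot f f x := rfl
  rw [newton, h.sum_sch_mul hx, h1, h2, hess]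
  ring

theorem tanSch_eq (h : FlatPair v f) {x : E n} (hx : x ∈ sphere (0 : E n) 1) :
    tanSch v x = tanLap f x + ((n : ℝ) - 2) * tanDot v f x + ((n : ℝ) / 2 - 1) * tanDot f f x +
      (n : ℝ) / 2 * ((1 + rad v x + rad f x) ^ 2 - (1 + rad v x) ^ 2) := by
  have hB : x ∈ B n := sphere_subset_closedBall hx
  have e : ∀ i j, x i * x j * sch v x i j = sch v x i j * x i * x j := fun i j => by ring
  have e1 : ∀ a : E n → ℝ, ∑ i, pd i a x * x i = rad a x := fun a =>
    Finset.sum_congr rfl fun i _ => mul_comm _ _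
  have e2 : ∑ i, ∑ j, pd i (pd j f) x * x i * x j = rad2 f x :=
    Finset.sum_congr rfl fun i _ => Finset.sum_congr rfl fun j _ => by ring
  rw [tanSch]
  simp only [e]
  rw [h.sum_sch_mul hB, e1, e1, e2, sum_mul_self_sphere hx, h.trSch_eq hB, tanLap, tanDot, tanDot]
  ring

/-- The divergence of `e^{(n-3)v} T ∇f`, where `T` is the Newton tensor. -/
theorem div_newton (h : FlatPair v f) {x : E n} (hx : x ∈ B n) :
    ∑ i, pd i (fun y => (1 * Real.exp (((n : ℝ) - 3) * v y)) * newtonField v f i y) x =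
      2 * bulkDensity v x + Real.exp (((n : ℝ) - 3) * v x) *
        (newton v f f x - (n : ℝ) / 2 * (trSch v x * gradDot f f x)) := by
  have hs := sch_eq_of_flat h.smooth_left h.smooth_right (h.sch_eq x hx)
  rw [div_newtonField (θ := fun _ => 1) h.smooth_left contDiff_const h.smooth_right]
  have h0 : newton v (fun _ => (1 : ℝ)) f x = 0 := by
    simp [newton, gradDot, pd_const]
  have h1 : ∑ i, linSch v f x i i = -trSch v x + ((n : ℝ) - 1) / 2 * gradDot f f x := by
    rw [sum_linSch, h.trSch_eq hx]; ring
  have h2 : ∑ i, ∑ j, sch v x i j * linSch v f x i j = -(∑ i, ∑ j, sch v x i j ^ 2) -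
      (∑ i, ∑ j, sch v x i j * pd i f x * pd j f x) + gradDot f f x / 2 * trSch v x := by
    have e : ∀ i j, sch v x i j * linSch v f x i j = -(sch v x i j ^ 2) -
        sch v x i j * pd i f x * pd j f x + (if i = j then gradDot f f x / 2 * sch v x i j else 0) := by
      intro i j
      have := hs i j
      split_ifs at this ⊢ <;> linear_combination (sch v x i j) * this
    simp only [e, Finset.sum_add_distrib, Finset.sum_sub_distrib, Finset.sum_neg_distrib,
      Finset.sum_ite_eq, Finset.mem_univ, if_true, ← Finset.mul_sum, sum_sch]
  rw [h0, h1, h2, newton, bulkDensity]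
  ring

/-- The divergence of `e^{(n-3)v} |∇f|² ∇f`. The Hessian term is expressed by the Newton tensor. -/
theorem div_normSq (h : FlatPair v f) {x : E n} (hx : x ∈ B n) :
    ∑ i, pd i (fun y => (Real.exp (((n : ℝ) - 3) * v y) * gradDot f f y) * pd i f y) x =
      Real.exp (((n : ℝ) - 3) * v x) * (3 * (trSch v x * gradDot f f x) - 2 * newton v f f x -
        ((n : ℝ) - 3) / 2 * gradDot f f x ^ 2) := by
  have hv := h.smooth_left
  have hf := h.smooth_right
  have hcv : ContDiff ℝ ∞ fun y => ((n : ℝ) - 3) * v y := by fun_prop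
  have hg := contDiff_gradDot hf hf
  rw [sum_pd_mul_pd (hcv.exp.mul hg) hf, gradDot_mul_left hcv.exp hg, gradDot_exp_left hcv,
    gradDot_const_mul_left _ hv, gradDot_gradDot hf hf, h.newton_eq hx, h.trSch_eq hx]
  ring

/-- The divergence of `e^{(n-3)v + 2(v+f)} ∇f`. -/
theorem div_exp (h : FlatPair v f) {x : E n} (hx : x ∈ B n) :
    ∑ i, pd i (fun y => Real.exp (((n : ℝ) - 3) * v y + 2 * (v y + f y)) * pd i f y) x =
      Real.exp (((n : ℝ) - 3) * v x + 2 * (v x + f x)) * (trSch v x +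
        (5 - (n : ℝ)) / 2 * gradDot f f x) := by
  have hv := h.smooth_left
  have hf := h.smooth_right
  have hcv : ContDiff ℝ ∞ fun y => ((n : ℝ) - 3) * v y := by fun_prop
  have hvf : ContDiff ℝ ∞ fun y => v y + f y := by fun_prop
  have h2 : ContDiff ℝ ∞ fun y => 2 * (v y + f y) := by fun_prop
  have h3 := hcv.add h2
  rw [sum_pd_mul_pd h3.exp hf, gradDot_exp_left h3, gradDot_add_left hcv h2,
    gradDot_const_mul_left _ hv, gradDot_const_mul_left _ hvf, gradDot_add_left hv hf,
    h.trSch_eq hx]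
  ring

theorem sum_mul_newtonField_sphere (φ : E n → ℝ) (hv : ContDiff ℝ ∞ v) {x : E n}
    (hx : x ∈ sphere (0 : E n) 1) :
    ∑ i, x i * newtonField v φ i x = tanSch v x * rad φ x + tanDot (rad v) φ x -
      (1 + rad v x) * tanDot v φ x := by
  rw [sum_mul_newtonField, BallSigmaTwo.tanSch_eq v hx, tanDot, gradDot_rad hv, rad_rad hv, tanDot]
  ring

theorem tanDot_weight (h : FlatPair v f) {x : E n} (hx : x ∈ sphere (0 : E n) 1) :
    tanDot (fun y => Real.exp (((n : ℝ) - 3) * v y) * ((1 + rad v y) + Real.exp (v y + f y))) f x =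
      Real.exp (((n : ℝ) - 3) * v x) * (((n : ℝ) - 3) * (2 * (1 + rad v x) + rad f x) * tanDot v f x +
        tanDot (rad v) f x + (1 + rad v x + rad f x) * (tanDot v f x + tanDot f f x)) := by
  have hv := h.smooth_left
  have hf := h.smooth_right
  have hr := contDiff_rad hv
  have hcv : ContDiff ℝ ∞ fun y => ((n : ℝ) - 3) * v y := by fun_prop
  have hh : ContDiff ℝ ∞ fun y => 1 + rad v y := by fun_prop
  have hvf : ContDiff ℝ ∞ fun y => v y + f y := by fun_prop
  have h1 : gradDot (fun y => 1 + rad v y) f x = gradDot (rad v) f x := by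
    rw [gradDot_add_left contDiff_const hr]
    simp [gradDot, pd_const]
  have h2 : rad (fun y => 1 + rad v y) x = rad (rad v) x := by
    rw [rad_add contDiff_const hr]
    simp [rad, pd_const]
  simp only [tanDot]
  rw [gradDot_mul_left hcv.exp (hh.add hvf.exp), gradDot_exp_left hcv, gradDot_const_mul_left _ hv,
    gradDot_add_left hh hvf.exp, gradDot_exp_left hvf, gradDot_add_left hv hf,
    rad_mul hcv.exp (hh.add hvf.exp), rad_exp hcv, rad_const_mul _ hv,
    rad_add hh hvf.exp, rad_exp hvf, rad_add hv hf, h1, h2, h.exp_eq x hx]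
  ring

/-- The boundary integrand of `integral_identity`, modulo the fluxes of the three fields of
`interior_identity` and the divergence of a tangential field. -/
theorem boundary_identity (h : FlatPair v f) {x : E n} (hx : x ∈ sphere (0 : E n) 1) :
    3 * bdryDensity v x - (n : ℝ) * (Real.exp (((n : ℝ) - 3) * v x) * (1 + rad v x) *
        Real.exp (2 * (v x + f x))) =
      ((n : ℝ) - 3) * (Real.exp (((n : ℝ) - 3) * v x) * (tanDot f f x *
        (Real.exp (v x + f x) + (1 + rad v x) / 2))) -
      3 / 2 * (∑ i, x i * ((1 * Real.exp (((n : ℝ) - 3) * v x)) * newtonField v f i x)) -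
      (n : ℝ) / 4 * (∑ i, x i * ((Real.exp (((n : ℝ) - 3) * v x) * gradDot f f x) * pd i f x)) +
      (n : ℝ) * (∑ i, x i * (Real.exp (((n : ℝ) - 3) * v x + 2 * (v x + f x)) * pd i f x)) +
      3 / 2 * (tanDot (fun y => Real.exp (((n : ℝ) - 3) * v y) * ((1 + rad v y) +
          Real.exp (v y + f y))) f x +
        Real.exp (((n : ℝ) - 3) * v x) * ((1 + rad v x) + Real.exp (v x + f x)) * tanLap f x) := by
  have e2 : Real.exp (2 * (v x + f x)) = (1 + rad v x + rad f x) ^ 2 := by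
    rw [← h.exp_eq x hx, ← Real.exp_nat_mul]; norm_num
  have e1 : ∀ (a : ℝ) (F : Fin (n + 1) → ℝ), ∑ i, x i * (a * F i) = a * ∑ i, x i * F i := by
    intro a F
    rw [Finset.mul_sum]
    exact Finset.sum_congr rfl fun i _ => by ring
  have hr : ∑ i, x i * pd i f x = rad f x := rfl
  have hp : gradDot f f x = tanDot f f x + rad f x ^ 2 := by rw [tanDot]; ring
  rw [h.tanDot_weight hx, e1, e1, e1, sum_mul_newtonField_sphere f h.smooth_left hx, hr,
    Real.exp_add (((n : ℝ) - 3) * v x) (2 * _),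
    e2, h.exp_eq x hx, bdryDensity, h.tanSch_eq hx, hp]
  ring

/-- The interior integrand of `integral_identity`, modulo the divergences of three fields
with coefficients `3/2`, `n/4` and `-n`. -/
theorem interior_identity (h : FlatPair v f) {x : E n} (hx : x ∈ B n) :
    3 * bulkDensity v x - (n : ℝ) * (Real.exp (((n : ℝ) - 3) * v x + 2 * (v x + f x)) * trSch v x) =
      ((n : ℝ) - 3) * (Real.exp (((n : ℝ) - 3) * v x) * (newton v f f x / 2 +
        (n : ℝ) / 8 * gradDot f f x ^ 2)) + (n : ℝ) * (5 - (n : ℝ)) / 2 *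
        (Real.exp (((n : ℝ) - 3) * v x + 2 * (v x + f x)) * gradDot f f x) +
      3 / 2 * (∑ i, pd i (fun y => (1 * Real.exp (((n : ℝ) - 3) * v y)) * newtonField v f i y) x) +
      (n : ℝ) / 4 * (∑ i, pd i (fun y => (Real.exp (((n : ℝ) - 3) * v y) * gradDot f f y) *
        pd i f y) x) -
      (n : ℝ) * (∑ i, pd i (fun y => Real.exp (((n : ℝ) - 3) * v y + 2 * (v y + f y)) *
        pd i f y) x) := by
  rw [h.div_newton hx, h.div_normSq hx, h.div_exp hx]
  ring

/-- The integral identity: the defect of the stability inequality is a sum of terms which are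
nonnegative if `4 ≤ n ≤ 5`, `T ≥ 0` and `H ≥ 0`. -/
theorem integral_identity (hn : n ≠ 0) (h : FlatPair v f) :
    (∫ x in B n, (3 * bulkDensity v x - (n : ℝ) *
      (Real.exp (((n : ℝ) - 3) * v x + 2 * (v x + f x)) * trSch v x))) +
    (∫ x : sphere (0 : E n) 1, (3 * bdryDensity v x - (n : ℝ) *
      (Real.exp (((n : ℝ) - 3) * v x) * (1 + rad v x) * Real.exp (2 * (v x + f x))))
        ∂(surfaceMeasure n)) =
    (∫ x in B n, (((n : ℝ) - 3) * (Real.exp (((n : ℝ) - 3) * v x) * (newton v f f x / 2 +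
        (n : ℝ) / 8 * gradDot f f x ^ 2)) + (n : ℝ) * (5 - (n : ℝ)) / 2 *
        (Real.exp (((n : ℝ) - 3) * v x + 2 * (v x + f x)) * gradDot f f x))) +
    ∫ x : sphere (0 : E n) 1, ((n : ℝ) - 3) * (Real.exp (((n : ℝ) - 3) * v x) * (tanDot f f x *
        (Real.exp (v x + f x) + (1 + rad v x) / 2))) ∂(surfaceMeasure n) := by
  have hv := h.smooth_left
  have hf := h.smooth_right
  have hr := contDiff_rad hv
  have hg := contDiff_gradDot hf hf
  have hN := contDiff_newton hv hf hf
  have hNf := fun i => contDiff_newtonField hv hf i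
  have hpf := fun i => contDiff_pd hf i
  have htd := contDiff_tanDot hf hf
  have hV1 : ∀ i, ContDiff ℝ ∞ fun y => (1 * Real.exp (((n : ℝ) - 3) * v y)) *
    newtonField v f i y := by fun_prop
  have hV2 : ∀ i, ContDiff ℝ ∞ fun y => (Real.exp (((n : ℝ) - 3) * v y) * gradDot f f y) *
    pd i f y := by fun_prop
  have hV3 : ∀ i, ContDiff ℝ ∞ fun y => Real.exp (((n : ℝ) - 3) * v y + 2 * (v y + f y)) *
    pd i f y := by fun_prop
  have hF : ContDiff ℝ ∞ fun y => Real.exp (((n : ℝ) - 3) * v y) * ((1 + rad v y) +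
    Real.exp (v y + f y)) := by fun_prop
  have I1 := integral_ball_div hn hV1
  have I2 := integral_ball_div hn hV2
  have I3 := integral_ball_div hn hV3
  have I4 := integral_sphere_tanDot_add hF hf
  have c1 := continuous_finsetSum Finset.univ fun i _ => continuous_pd (hV1 i) i
  have c2 := continuous_finsetSum Finset.univ fun i _ => continuous_pd (hV2 i) i
  have c3 := continuous_finsetSum Finset.univ fun i _ => continuous_pd (hV3 i) i
  have htF := contDiff_tanDot hF hf
  have htl := contDiff_tanLap hf
  rw [setIntegral_congr_fun measurableSet_closedBall fun x hx => h.interior_identity hx]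
  simp only [fun x : sphere (0 : E n) 1 => h.boundary_identity x.2]
  rw [integral_ball_sub (by fun_prop) (by fun_prop), integral_ball_add (by fun_prop) (by fun_prop),
    integral_ball_add (by fun_prop) (by fun_prop),
    integral_add (integrable_of_continuous_sphere (by fun_prop))
      (integrable_of_continuous_sphere (by fun_prop)),
    integral_add (integrable_of_continuous_sphere (by fun_prop))
      (integrable_of_continuous_sphere (by fun_prop)),
    integral_sub (integrable_of_continuous_sphere (by fun_prop))
      (integrable_of_continuous_sphere (by fun_prop)),
    integral_sub (integrable_of_continuous_sphere (by fun_prop))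
      (integrable_of_continuous_sphere (by fun_prop))]
  simp only [integral_const_mul] at I1 I2 I3 I4 ⊢
  rw [I1, I2, I3, I4]
  ring

end FlatPair

/-! ### Rigidity -/

theorem eqOn_ball_of_ae {g h : E n → ℝ} (hg : Continuous g) (hh : Continuous h)
    (hae : ∀ᵐ x, x ∈ ball (0 : E n) 1 → g x = h x) : EqOn g h (B n) := by
  have h1 : EqOn g h (ball (0 : E n) 1) :=
    Measure.eqOn_open_of_ae_eq (μ := volume) ((ae_restrict_iff' measurableSet_ball).2 hae)
      isOpen_ball hg.continuousOn hh.continuousOn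
  have h2 := h1.closure hg hh
  rwa [closure_ball _ one_ne_zero] at h2

theorem eqOn_zero_of_integral_nonpos {g : E n → ℝ} (hg : Continuous g) (h0 : ∀ x ∈ B n, 0 ≤ g x)
    (hi : ∫ x in B n, g x ≤ 0) {x : E n} (hx : x ∈ B n) : g x = 0 := by
  have hae : 0 ≤ᵐ[volume.restrict (B n)] g :=
    (ae_restrict_iff' measurableSet_closedBall).2 (Eventually.of_forall h0)
  have hz := (setIntegral_eq_zero_iff_of_nonneg_ae hae (integrableOn_ball hg)).1
    (le_antisymm hi (setIntegral_nonneg measurableSet_closedBall h0))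
  have hz' := (ae_restrict_iff' measurableSet_closedBall).1 hz
  exact eqOn_ball_of_ae hg continuous_const
    (hz'.mono fun y hy hyB => hy (ball_subset_closedBall hyB)) hx

theorem gradDot_self_nonneg (f : E n → ℝ) (x : E n) : 0 ≤ gradDot f f x :=
  Finset.sum_nonneg fun _ _ => mul_self_nonneg _

theorem tanDot_self_nonneg (f : E n → ℝ) {x : E n} (hx : x ∈ sphere (0 : E n) 1) :
    0 ≤ tanDot f f x := by
  have h := Finset.sum_mul_sq_le_sq_mul_sq Finset.univ (fun i => x i) fun i => pd i f x
  have h1 : ∑ i, x i ^ 2 = 1 := by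
    rw [← sum_mul_self_sphere hx]
    exact Finset.sum_congr rfl fun i _ => pow_two _
  have h2 : ∑ i, pd i f x ^ 2 = gradDot f f x := Finset.sum_congr rfl fun i _ => pow_two _
  rw [h1, h2, one_mul] at h
  rw [tanDot]
  have : rad f x = ∑ i, x i * pd i f x := rfl
  rw [← this] at h
  linarith [sq (rad f x)]

/-- If `σ₁ ≥ 0` and `σ₂ = 0` then the first Newton tensor is nonnegative. -/
theorem newton_self_nonneg {v : E n → ℝ} {x : E n} (h1 : 0 ≤ trSch v x)
    (h2 : bulkDensity v x = 0) (a : E n → ℝ) : 0 ≤ newton v a a x := by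
  have hs : ∑ i, ∑ j, sch v x i j ^ 2 = trSch v x ^ 2 := by
    rw [bulkDensity] at h2
    have := (mul_eq_zero.1 h2).resolve_left (Real.exp_ne_zero _)
    linarith
  -- Cauchy–Schwarz for `S` and `∇a ⊗ ∇a`, where `|S| = tr S` because `σ₂ = 0`.
  have hcs := Finset.sum_mul_sq_le_sq_mul_sq (Finset.univ : Finset (Fin (n + 1) × Fin (n + 1)))
    (fun p => sch v x p.1 p.2) fun p => pd p.1 a x * pd p.2 a x
  simp only [Fintype.sum_prod_type, mul_pow, ← Finset.mul_sum, ← Finset.sum_mul, hs] at hcs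
  have h3 : ∑ i, pd i a x ^ 2 = gradDot a a x := Finset.sum_congr rfl fun i _ => pow_two _
  rw [h3] at hcs
  have h4 : ∑ i, ∑ j, sch v x i j * (pd i a x * pd j a x) ≤ trSch v x * gradDot a a x := by
    refine le_of_sq_le_sq ?_ (mul_nonneg h1 (gradDot_self_nonneg a x))
    linarith [mul_pow (trSch v x) (gradDot a a x) 2, sq (gradDot a a x)]
  rw [newton]
  simp only [mul_assoc] at h4 ⊢
  linarith

theorem eq_of_gradDot_self_eq_zero {f : E n → ℝ} (hf : ContDiff ℝ ∞ f)
    (h : ∀ x ∈ B n, gradDot f f x = 0) {x y : E n} (hx : x ∈ B n) (hy : y ∈ B n) : f x = f y := by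
  have hd : ∀ z ∈ B n, ‖fderiv ℝ f z‖ ≤ 0 := by
    intro z hz
    have hp : ∀ i, pd i f z = 0 := by
      have := (Finset.sum_eq_zero_iff_of_nonneg fun i _ => mul_self_nonneg (pd i f z)).1 (h z hz)
      exact fun i => mul_self_eq_zero.1 (this i (Finset.mem_univ i))
    have : fderiv ℝ f z = 0 := by
      ext w
      simp [fderiv_eq_sum_pd, hp]
    simp [this]
  have := (convex_closedBall (0 : E n) 1).norm_image_sub_le_of_norm_fderiv_le
    (fun z _ => hf.differentiableAt_top z) hd hy hx
  rw [zero_mul, norm_le_zero_iff, sub_eq_zero] at this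
  exact this

/-- Rigidity in dimensions five and six: if `σ₂ = 0`, `σ₁ ≥ 0`, `H > 0` and the left side of
`FlatPair.integral_identity` is not positive, then the conformal factor `f` is constant. -/
theorem FlatPair.eq_of_integral_nonpos {v f : E n → ℝ} (hn : n = 4 ∨ n = 5) (h : FlatPair v f)
    (hb : ∀ x ∈ B n, bulkDensity v x = 0) (htr : ∀ x ∈ B n, 0 ≤ trSch v x)
    (hH : ∀ x ∈ sphere (0 : E n) 1, 0 < 1 + rad v x)
    (hs : (∫ x in B n, (3 * bulkDensity v x - (n : ℝ) *
        (Real.exp (((n : ℝ) - 3) * v x + 2 * (v x + f x)) * trSch v x))) +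
      (∫ x : sphere (0 : E n) 1, (3 * bdryDensity v x - (n : ℝ) *
        (Real.exp (((n : ℝ) - 3) * v x) * (1 + rad v x) * Real.exp (2 * (v x + f x))))
        ∂(surfaceMeasure n)) ≤ 0) {x y : E n} (hx : x ∈ B n) (hy : y ∈ B n) : f x = f y := by
  rw [h.integral_identity (by omega)] at hs
  have hv := h.smooth_left
  have hf := h.smooth_right
  have hg := contDiff_gradDot hf hf
  have hN := contDiff_newton hv hf hf
  have hn4 : (4 : ℝ) ≤ n := by rcases hn with rfl | rfl <;> norm_num
  have hn5 : (n : ℝ) ≤ 5 := by rcases hn with rfl | rfl <;> norm_num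
  have hbd : 0 ≤ ∫ x : sphere (0 : E n) 1, ((n : ℝ) - 3) * (Real.exp (((n : ℝ) - 3) * v x) *
      (tanDot f f x * (Real.exp (v x + f x) + (1 + rad v x) / 2))) ∂(surfaceMeasure n) := by
    refine integral_nonneg fun z => ?_
    have h1 := tanDot_self_nonneg f z.2
    have h2 := hH z z.2
    have h3 : (0 : ℝ) ≤ n - 3 := by linarith
    positivity
  refine eq_of_gradDot_self_eq_zero hf (fun z hz => ?_) hx hy
  have hlow : ∀ z ∈ B n, 0 ≤ newton v f f z := fun z hz => newton_self_nonneg (htr z hz) (hb z hz) f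
  have hn3 : (0 : ℝ) < n - 3 := by linarith
  have hn5' : (0 : ℝ) ≤ 5 - n := by linarith
  have key := eqOn_zero_of_integral_nonpos (by fun_prop) (fun z hz => ?_)
    (by linarith : ∫ x in B n, (((n : ℝ) - 3) * (Real.exp (((n : ℝ) - 3) * v x) *
      (newton v f f x / 2 + (n : ℝ) / 8 * gradDot f f x ^ 2)) + (n : ℝ) * (5 - (n : ℝ)) / 2 *
      (Real.exp (((n : ℝ) - 3) * v x + 2 * (v x + f x)) * gradDot f f x)) ≤ 0) hz
  · have h0 := hlow z hz
    have h1 := gradDot_self_nonneg f z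
    by_contra hne
    have h2 : 0 < gradDot f f z := lt_of_le_of_ne h1 (Ne.symm hne)
    have : 0 < (n : ℝ) := by linarith
    have : 0 < ((n : ℝ) - 3) * (Real.exp (((n : ℝ) - 3) * v z) *
      (newton v f f z / 2 + (n : ℝ) / 8 * gradDot f f z ^ 2)) + (n : ℝ) * (5 - (n : ℝ)) / 2 *
      (Real.exp (((n : ℝ) - 3) * v z + 2 * (v z + f z)) * gradDot f f z) := by positivity
    linarith
  · have h0 := hlow z hz
    have h1 := gradDot_self_nonneg f z
    positivity

/-! ### Curves of metrics with prescribed boundary volume -/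

/-- In a jointly smooth family of functions the members depend continuously on the parameter in
the `C^∞` topology of the ball. -/
theorem eventually_CkClose {W : ℝ → E n → ℝ} (hW : ContDiff ℝ ∞ fun p : ℝ × E n => W p.1 p.2)
    (k : ℕ) {ε : ℝ} (hε : 0 < ε) : ∀ᶠ t in 𝓝 (0 : ℝ), CkClose k ε (W 0) (W t) := by
  -- A jointly smooth function which vanishes at `t = 0`.
  set G : ℝ × E n → ℝ := fun p => W p.1 p.2 - W 0 p.2 with hG
  have hGs : ContDiff ℝ ∞ G := by
    have h0 : ContDiff ℝ ∞ fun p : ℝ × E n => W 0 p.2 :=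
      hW.comp (contDiff_const.prodMk contDiff_snd : ContDiff ℝ ∞ fun p : ℝ × E n => ((0 : ℝ), p.2))
    exact hW.sub h0
  have key : ∀ (m : ℕ) (t : ℝ) (x : E n), iteratedFDeriv ℝ m (fun y => W t y - W 0 y) x =
      (iteratedFDeriv ℝ m G (t, x)).compContinuousLinearMap
        fun _ => ContinuousLinearMap.inr ℝ ℝ (E n) := by
    intro m t x
    have e : (fun y => W t y - W 0 y) = (fun z => G ((t, 0) + z)) ∘
        ContinuousLinearMap.inr ℝ ℝ (E n) := by
      funext y
      simp [hG]
    have hs : ContDiff ℝ ∞ fun z => G ((t, 0) + z) := hGs.comp (contDiff_const.add contDiff_id)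
    rw [e, ContinuousLinearMap.iteratedFDeriv_comp_right _ hs x (i := m)
      (WithTop.coe_le_coe.2 le_top), iteratedFDeriv_comp_add_left]
    simp
  have hm : ∀ m : ℕ, ∀ᶠ t in 𝓝 (0 : ℝ), ∀ x ∈ B n,
      ‖iteratedFDeriv ℝ m (fun y => W t y - W 0 y) x‖ < ε := by
    intro m
    refine (isCompact_closedBall (0 : E n) 1).eventually_forall_of_forall_eventually fun x _ => ?_
    have hc : Continuous fun p : ℝ × E n =>
        ‖iteratedFDeriv ℝ m (fun y => W p.1 y - W 0 y) p.2‖ := by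
      simp only [key]
      have h1 : Continuous (iteratedFDeriv ℝ m G) :=
        hGs.continuous_iteratedFDeriv (WithTop.coe_le_coe.2 le_top)
      exact ((ContinuousMultilinearMap.compContinuousLinearMapL (F := ℝ)
        fun _ : Fin m => ContinuousLinearMap.inr ℝ ℝ (E n)).continuous.comp h1).norm
    refine hc.continuousAt.eventually_lt continuousAt_const ?_
    simpa using hε
  have := (Filter.eventually_all_finite (Set.finite_Iic k)).2 fun m _ => hm m
  filter_upwards [this] with t ht m hmk x hx using ht m hmk x hx

/-- The first and second order conditions for `e^{2v} dx²` along globally smooth curves of metrics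
of boundary volume `omega n`. They hold both for local minimizers and for stable critical points. -/
def StableAlongCurves (v : E n → ℝ) : Prop :=
  ∀ W : ℝ → E n → ℝ, ContDiff ℝ ∞ (fun p : ℝ × E n => W p.1 p.2) → (∀ t, InV (W t)) →
    (W 0 = fun x => Real.exp (v x)) → ∀ (q' : ℝ → ℝ) (q'' : ℝ),
    (∀ t, HasDerivAt (fun s => S2 (confMetric (W s))) (q' t) t) → HasDerivAt q' q'' 0 →
    q' 0 = 0 ∧ 0 ≤ q''

/-- The necessary second order condition at a local minimum. -/
theorem deriv_eq_zero_and_nonneg_of_isLocalMin {q q' : ℝ → ℝ} {q'' : ℝ}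
    (h1 : ∀ t, HasDerivAt q (q' t) t) (h2 : HasDerivAt q' q'' 0) (hq : IsLocalMin q 0) :
    q' 0 = 0 ∧ 0 ≤ q'' := by
  have h0 := hq.hasDerivAt_eq_zero (h1 0)
  refine ⟨h0, ?_⟩
  by_contra! hneg
  have hd : deriv q = q' := funext fun t => (h1 t).deriv
  -- If `q'' < 0` then `q` also has a local maximum, so it is locally constant and `q'' = 0`.
  have hmax : IsLocalMax q 0 := isLocalMax_of_deriv_deriv_neg (by rw [hd, h2.deriv]; exact hneg)
    (by rw [hd, h0]) (h1 0).continuousAt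
  have hc : q =ᶠ[𝓝 0] fun _ => q 0 := by
    filter_upwards [hq, hmax] with t ha hb using le_antisymm hb ha
  have hc' : q' =ᶠ[𝓝 0] fun _ => 0 := by
    filter_upwards [hc.eventuallyEq_nhds] with t ht
    rw [← hd, ht.deriv_eq, deriv_const]
  have := (h2.congr_of_eventuallyEq hc'.symm).unique (hasDerivAt_const _ _)
  linarith

theorem IsLocalMinimizer.stableAlongCurves {v : E n → ℝ}
    (h : IsLocalMinimizer fun x => Real.exp (v x)) : StableAlongCurves v := by
  intro W hW hV h0 q' q'' h1 h2
  obtain ⟨_, k, ε, hε, hmin⟩ := h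
  refine deriv_eq_zero_and_nonneg_of_isLocalMin h1 h2 ?_
  filter_upwards [eventually_CkClose hW k hε] with t ht
  rw [h0] at ht ⊢
  exact hmin _ (hV t) ht

theorem IsStableCritical.stableAlongCurves {v : E n → ℝ}
    (h : IsStableCritical fun x => Real.exp (v x)) : StableAlongCurves v := by
  intro W hW hV h0 q' q'' h1 h2
  have := h.2 1 one_pos W ⟨hW.contDiffOn, fun t _ => hV t, fun x _ => by rw [h0]⟩
  have hd : deriv (fun s => S2 (confMetric (W s))) = q' := funext fun t => (h1 t).deriv
  rwa [iteratedDeriv_succ, iteratedDeriv_one, hd, h2.deriv] at this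

/-! ### First and second variation -/

theorem pd_add_const (w : E n → ℝ) (c : ℝ) (i : Fin (n + 1)) :
    pd i (fun y => w y + c) = pd i w := by
  funext x
  simp [pd]

/-- The scaling behaviour of `S₂`. -/
theorem weightedS2_add_const (w : E n → ℝ) (c : ℝ) :
    weightedS2 (fun _ => 1) (fun y => w y + c) =
      Real.exp (((n : ℝ) - 3) * c) * weightedS2 (fun _ => 1) w := by
  have h1 : ∀ x, bulkDensity (fun y => w y + c) x =
      Real.exp (((n : ℝ) - 3) * c) * bulkDensity w x := by
    intro x
    simp only [bulkDensity, trSch, sch, lap, gradDot, pd_add_const, mul_add, Real.exp_add]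
    ring
  have h2 : ∀ x, bdryDensity (fun y => w y + c) x =
      Real.exp (((n : ℝ) - 3) * c) * bdryDensity w x := by
    intro x
    simp only [bdryDensity, tanSch, trSch, sch, lap, gradDot, rad, pd_add_const, mul_add,
      Real.exp_add]
    ring
  simp only [weightedS2, h1, h2, one_mul, integral_const_mul]
  ring

theorem S2_confMetric_eq_weightedS2 (hn : 2 ≤ n) {v : E n → ℝ} (hv : ContDiff ℝ ∞ v) :
    S2 (confMetric fun y => Real.exp (v y)) = weightedS2 (fun _ => 1) v := by
  rw [S2_confMetric hn hv, weightedS2]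
  simp

/-- The moments of `φ` for the boundary volume of `e^{2(v+tφ)} dx²`. -/
def bdryMoment (v φ : E n → ℝ) (k : ℕ) (t : ℝ) : ℝ :=
  ∫ x : sphere (0 : E n) 1, φ x ^ k * Real.exp (n * (v x + t * φ x)) ∂(surfaceMeasure n)

theorem hasDerivAt_bdryMoment {v φ : E n → ℝ} (hv : ContDiff ℝ ∞ v) (hφ : ContDiff ℝ ∞ φ) (k : ℕ)
    (t : ℝ) : HasDerivAt (bdryMoment v φ k) (n * bdryMoment v φ (k + 1) t) t := by
  have cv := hv.continuous
  have cφ := hφ.continuous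
  have := hasDerivAt_sphereIntegral (n := n)
    (F := fun t x => φ x ^ k * Real.exp (n * (v x + t * φ x)))
    (F' := fun t x => n * (φ x ^ (k + 1) * Real.exp (n * (v x + t * φ x))))
    (fun t => by fun_prop) (by fun_prop) (fun t x _ => ?_) t
  · rw [integral_const_mul] at this
    exact this
  · have h1 : HasDerivAt (fun s : ℝ => n * (v x + s * φ x)) (n * φ x) t := by
      simpa using (((hasDerivAt_id t).mul_const (φ x)).const_add (v x)).const_mul (n : ℝ)
    exact (h1.exp.const_mul (φ x ^ k)).congr_deriv (by ring)

theorem contDiff_bdryMoment {v φ : E n → ℝ} (hv : ContDiff ℝ ∞ v) (hφ : ContDiff ℝ ∞ φ) (k : ℕ) :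
    ContDiff ℝ ∞ (bdryMoment v φ k) := by
  have hd : ∀ k, deriv (bdryMoment v φ k) = fun t => n * bdryMoment v φ (k + 1) t :=
    fun k => funext fun t => (hasDerivAt_bdryMoment hv hφ k t).deriv
  refine contDiff_infty.2 fun m => ?_
  induction m generalizing k with
  | zero => exact contDiff_zero.2 (continuous_iff_continuousAt.2 fun t =>
      (hasDerivAt_bdryMoment hv hφ k t).continuousAt)
  | succ m ih =>
    have : ((m + 1 : ℕ) : WithTop ℕ∞) = (m : WithTop ℕ∞) + 1 := by norm_cast
    rw [this, contDiff_succ_iff_deriv]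
    refine ⟨fun t => (hasDerivAt_bdryMoment hv hφ k t).differentiableAt, by simp, ?_⟩
    rw [hd]
    exact contDiff_const.mul (ih _)

theorem omega_pos (n : ℕ) : 0 < omega n := by
  have : (surfaceMeasure n) univ ≠ 0 := by
    simp [surfaceMeasure, Measure.toSphere_apply_univ, (measure_ball_pos volume (0 : E n) one_pos).ne']
  exact ENNReal.toReal_pos this (measure_ne_top _ _)

theorem bdryMoment_zero_pos {v φ : E n → ℝ} (hv : ContDiff ℝ ∞ v) (hφ : ContDiff ℝ ∞ φ) (t : ℝ) :
    0 < bdryMoment v φ 0 t := by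
  have cv := hv.continuous
  have cφ := hφ.continuous
  have : NeZero (surfaceMeasure n) := ⟨fun h => by
    have := omega_pos n
    simp [omega, h] at this⟩
  simp only [bdryMoment, pow_zero, one_mul]
  exact integral_exp_pos (integrable_of_continuous_sphere (by fun_prop))

/-- The logarithm of the constant factor which brings `e^{2(v+tφ)} dx²` to boundary volume
`omega n`. -/
def volShift (v φ : E n → ℝ) (t : ℝ) : ℝ := -Real.log (bdryMoment v φ 0 t / omega n) / n

theorem contDiff_volShift {v φ : E n → ℝ} (hv : ContDiff ℝ ∞ v) (hφ : ContDiff ℝ ∞ φ) :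
    ContDiff ℝ ∞ (volShift v φ) := by
  have h := (contDiff_bdryMoment hv hφ 0).div_const (omega n)
  exact ((h.log fun t =>
    (div_pos (bdryMoment_zero_pos hv hφ t) (omega_pos n)).ne').neg).div_const _

theorem hasDerivAt_volShift (hn : n ≠ 0) {v φ : E n → ℝ} (hv : ContDiff ℝ ∞ v)
    (hφ : ContDiff ℝ ∞ φ) (t : ℝ) :
    HasDerivAt (volShift v φ) (-(bdryMoment v φ 1 t / bdryMoment v φ 0 t)) t := by
  have h0 := bdryMoment_zero_pos hv hφ t
  have hω := omega_pos n
  have h := ((hasDerivAt_bdryMoment hv hφ 0 t).div_const (omega n)).log (div_pos h0 hω).ne'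
  have hn' : (n : ℝ) ≠ 0 := by exact_mod_cast hn
  refine (h.neg.div_const (n : ℝ)).congr_deriv ?_
  field_simp

theorem inV_of_integral_eq {w : E n → ℝ} (hw : ContDiff ℝ ∞ w)
    (h : ∫ x : sphere (0 : E n) 1, Real.exp (n * w x) ∂(surfaceMeasure n) = omega n) :
    InV fun y => Real.exp (w y) :=
  ⟨⟨hw.exp, fun _ _ => Real.exp_pos _⟩, by rw [boundaryVol_confMetric, h]⟩

theorem inV_volShift (hn : n ≠ 0) {v φ : E n → ℝ} (hv : ContDiff ℝ ∞ v) (hφ : ContDiff ℝ ∞ φ)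
    (t : ℝ) : InV fun y => Real.exp ((v y + t * φ y) + volShift v φ t) := by
  have h0 := bdryMoment_zero_pos hv hφ t
  have hω := omega_pos n
  have hn' : (n : ℝ) ≠ 0 := by exact_mod_cast hn
  refine inV_of_integral_eq (by fun_prop) ?_
  simp only [mul_add (n : ℝ) (_ + _), Real.exp_add, integral_mul_const]
  have e1 : Real.exp (n * volShift v φ t) = omega n / bdryMoment v φ 0 t := by
    rw [volShift, mul_div_cancel₀ _ hn', ← Real.log_inv, Real.exp_log (by positivity), inv_div]
  have e2 : ∫ x : sphere (0 : E n) 1, Real.exp (n * (v x + t * φ x)) ∂(surfaceMeasure n) =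
      bdryMoment v φ 0 t := by simp [bdryMoment]
  rw [e1, e2]
  field_simp

/-- The second variation of the weighted functional with weight `φ`, in the direction `φ`. -/
def secondVar (v φ : E n → ℝ) : ℝ :=
  ((n : ℝ) - 3) * weightedS2 (fun y => φ y * φ y) v +
    (∫ x in B n, Real.exp (((n : ℝ) - 3) * v x) * newton v φ φ x) +
    ∫ x : sphere (0 : E n) 1, Real.exp (((n : ℝ) - 3) * v x) * (1 + rad v x) * tanDot φ φ x
      ∂(surfaceMeasure n)

theorem hasDerivAt_weightedS2_one (hn : n ≠ 0) {v φ : E n → ℝ} (hv : ContDiff ℝ ∞ v)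
    (hφ : ContDiff ℝ ∞ φ) (t : ℝ) :
    HasDerivAt (fun s : ℝ => weightedS2 (fun _ => 1) (fun y => v y + s * φ y))
      (((n : ℝ) - 3) * weightedS2 φ (fun y => v y + t * φ y)) t := by
  have h := hasDerivAt_weightedS2 hn hv (θ := fun _ => 1) contDiff_const hφ t
  have e1 : ∀ w (x : E n), newton w (fun _ => (1 : ℝ)) φ x = 0 := fun w x => by
    simp [newton, gradDot, pd_const]
  have e2 : ∀ x : E n, tanDot (fun _ => (1 : ℝ)) φ x = 0 := fun x => by
    simp [tanDot, gradDot, rad, pd_const]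
  simpa [e1, e2] using h

/-- The conditions of vanishing first and nonnegative second variation, in the directions which
preserve the boundary volume to first order. -/
theorem StableAlongCurves.variation (hn : 4 ≤ n) {v φ : E n → ℝ} (h : StableAlongCurves v)
    (hv : ContDiff ℝ ∞ v) (hV : InV fun x => Real.exp (v x)) (hφ : ContDiff ℝ ∞ φ)
    (h0 : ∫ x : sphere (0 : E n) 1, φ x * Real.exp (n * v x) ∂(surfaceMeasure n) = 0) :
    weightedS2 φ v = 0 ∧ 0 ≤ secondVar v φ - n * (weightedS2 (fun _ => 1) v *
      ((∫ x : sphere (0 : E n) 1, φ x ^ 2 * Real.exp (n * v x) ∂(surfaceMeasure n)) /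
        omega n)) := by
  have hn0 : n ≠ 0 := by omega
  have hc : (0 : ℝ) < n - 3 := by
    have : (4 : ℝ) ≤ n := by exact_mod_cast hn
    linarith
  have hω := omega_pos n
  have hM0 : bdryMoment v φ 0 0 = omega n := by
    have := hV.2
    rw [boundaryVol_confMetric] at this
    simpa [bdryMoment] using this
  have hM1 : bdryMoment v φ 1 0 = 0 := by simpa [bdryMoment] using h0
  have hM2 : bdryMoment v φ 2 0 =
      ∫ x : sphere (0 : E n) 1, φ x ^ 2 * Real.exp (n * v x) ∂(surfaceMeasure n) := by
    simp [bdryMoment]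
  have hβ0 : volShift v φ 0 = 0 := by simp [volShift, hM0, hω.ne']
  have hβ := contDiff_volShift hv hφ
  set W : ℝ → E n → ℝ := fun t y => Real.exp ((v y + t * φ y) + volShift v φ t) with hW
  have hWs : ContDiff ℝ ∞ fun p : ℝ × E n => W p.1 p.2 := by
    simp only [hW]
    fun_prop
  have hS : (fun s => S2 (confMetric (W s))) = fun s => Real.exp (((n : ℝ) - 3) * volShift v φ s) *
      weightedS2 (fun _ => 1) (fun y => v y + s * φ y) := by
    funext s
    simp only [hW]
    rw [S2_confMetric_eq_weightedS2 (by omega) (by fun_prop), weightedS2_add_const]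
  have hE : ∀ t, HasDerivAt (fun s => Real.exp (((n : ℝ) - 3) * volShift v φ s))
      (Real.exp (((n : ℝ) - 3) * volShift v φ t) *
        (((n : ℝ) - 3) * -(bdryMoment v φ 1 t / bdryMoment v φ 0 t))) t := fun t =>
    ((hasDerivAt_volShift hn0 hv hφ t).const_mul _).exp
  have hA := hasDerivAt_weightedS2_one hn0 hv hφ
  have hP := hasDerivAt_weightedS2 hn0 hv hφ hφ 0
  have hq : ∀ t, HasDerivAt (fun s => S2 (confMetric (W s)))
      (((n : ℝ) - 3) * (Real.exp (((n : ℝ) - 3) * volShift v φ t) *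
        (weightedS2 φ (fun y => v y + t * φ y) - weightedS2 (fun _ => 1) (fun y => v y + t * φ y) *
          (bdryMoment v φ 1 t / bdryMoment v φ 0 t)))) t := by
    intro t
    rw [hS]
    exact ((hE t).mul (hA t)).congr_deriv (by ring)
  -- As the first moment vanishes at `t = 0`, only the second one enters this derivative.
  have hM : HasDerivAt (fun t => bdryMoment v φ 1 t / bdryMoment v φ 0 t)
      (n * (bdryMoment v φ 2 0 / omega n)) 0 := by
    refine ((hasDerivAt_bdryMoment hv hφ 1 0).div (hasDerivAt_bdryMoment hv hφ 0 0)
      (bdryMoment_zero_pos hv hφ 0).ne').congr_deriv ?_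
    rw [hM0, hM1]
    field_simp
    simp
  have hqq := (((hE 0).mul (hP.sub ((hA 0).mul hM))).const_mul ((n : ℝ) - 3))
  obtain ⟨c1, c2⟩ := h W hWs (inV_volShift hn0 hv hφ) (by simp [hW, hβ0]) _ _ hq hqq
  simp only [hβ0, hM1, hM2, hM0, mul_zero, zero_mul, zero_div, neg_zero, Real.exp_zero, one_mul,
    add_zero, zero_add, sub_zero] at c1 c2
  have d1 : weightedS2 φ v = 0 := (mul_eq_zero.1 c1).resolve_left hc.ne'
  refine ⟨d1, ?_⟩
  have := nonneg_of_mul_nonneg_right c2 hc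
  rw [secondVar]
  linarith

/-- The Euler–Lagrange equation in the interior: `σ₂ = 0`. -/
theorem StableAlongCurves.bulkDensity_eq_zero (hn : 4 ≤ n) {v : E n → ℝ} (h : StableAlongCurves v)
    (hv : ContDiff ℝ ∞ v) (hV : InV fun x => Real.exp (v x)) {x : E n} (hx : x ∈ B n) :
    bulkDensity v x = 0 := by
  have hb := (contDiff_bulkDensity hv).continuous
  refine eqOn_ball_of_ae hb continuous_const ?_ hx
  refine isOpen_ball.ae_eq_zero_of_integral_contDiff_smul_eq_zero
    (hb.locallyIntegrable.locallyIntegrableOn _) fun φ hφ _ hsupp => ?_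
  -- A test function supported in the open ball vanishes on the sphere, hence is admissible.
  have hz : ∀ y ∉ ball (0 : E n) 1, φ y = 0 := fun y hy =>
    image_eq_zero_of_notMem_tsupport fun hy' => hy (hsupp hy')
  have hs : ∀ y : sphere (0 : E n) 1, φ y = 0 := fun y => hz y (by
    have := y.2
    rw [mem_sphere] at this
    simp [mem_ball, this])
  have := (h.variation hn hv hV hφ (by simp [hs])).1
  rw [weightedS2] at this
  simp only [hs, zero_mul, integral_zero, add_zero] at this
  rw [← this]
  refine (setIntegral_eq_integral_of_forall_compl_eq_zero fun y hy => ?_).symm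
  rw [hz y fun h => hy (ball_subset_closedBall h), zero_smul]

/-! ### Stability tested with the coordinates of a conformal map -/

/-- `Y` is the germ along the ball of a conformal map `y` of the ball with conformal factor
`e^{v₀}`: it maps the unit sphere to itself and `y^* dx² = e^{2v₀} dx²`. -/
structure ConfCoords (v₀ : E n → ℝ) (Y : Fin (n + 1) → E n → ℝ) : Prop where
  smooth_factor : ContDiff ℝ ∞ v₀
  smooth : ∀ i, ContDiff ℝ ∞ (Y i)
  sum_sq : ∀ x ∈ sphere (0 : E n) 1, ∑ i, Y i x ^ 2 = 1
  conformal : ∀ x ∈ B n, ∀ a b, ∑ i, pd a (Y i) x * pd b (Y i) x =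
    if a = b then Real.exp (2 * v₀ x) else 0

namespace ConfCoords

variable {v₀ : E n → ℝ} {Y : Fin (n + 1) → E n → ℝ}

theorem sum_bilin (h : ConfCoords v₀ Y) {x : E n} (hx : x ∈ B n)
    (A : Fin (n + 1) → Fin (n + 1) → ℝ) :
    ∑ i, ∑ a, ∑ b, A a b * pd a (Y i) x * pd b (Y i) x = Real.exp (2 * v₀ x) * ∑ a, A a a := by
  rw [Finset.sum_comm]
  simp_rw [Finset.sum_comm (s := (Finset.univ : Finset (Fin (n + 1)))) (f := fun i b =>
    A _ b * pd _ (Y i) x * pd b (Y i) x), mul_assoc, ← Finset.mul_sum, h.conformal x hx]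
  simp [Finset.mul_sum, mul_comm]

theorem sum_gradDot (h : ConfCoords v₀ Y) {x : E n} (hx : x ∈ B n) :
    ∑ i, gradDot (Y i) (Y i) x = ((n : ℝ) + 1) * Real.exp (2 * v₀ x) := by
  simp only [gradDot]
  rw [Finset.sum_comm]
  simp [h.conformal x hx]

theorem sum_newton (h : ConfCoords v₀ Y) (v : E n → ℝ) {x : E n} (hx : x ∈ B n) :
    ∑ i, newton v (Y i) (Y i) x = n * (Real.exp (2 * v₀ x) * trSch v x) := by
  simp only [newton, Finset.sum_sub_distrib, ← Finset.mul_sum, h.sum_gradDot hx, h.sum_bilin hx,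
    sum_sch]
  ring

theorem sum_tanDot (h : ConfCoords v₀ Y) {x : E n} (hx : x ∈ sphere (0 : E n) 1) :
    ∑ i, tanDot (Y i) (Y i) x = n * Real.exp (2 * v₀ x) := by
  have hB : x ∈ B n := sphere_subset_closedBall hx
  have h1 := h.sum_bilin hB fun a b => x a * x b
  rw [sum_mul_self_sphere hx] at h1
  have h2 : ∑ i, rad (Y i) x * rad (Y i) x = Real.exp (2 * v₀ x) := by
    rw [mul_one] at h1
    rw [← h1]
    refine Finset.sum_congr rfl fun i _ => ?_
    rw [rad, Finset.sum_mul_sum]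
    exact Finset.sum_congr rfl fun a _ => Finset.sum_congr rfl fun b _ => by ring
  simp only [tanDot, Finset.sum_sub_distrib, h.sum_gradDot hB, h2]
  ring

end ConfCoords

theorem sum_weightedS2 {v : E n → ℝ} (hv : ContDiff ℝ ∞ v) {θ : Fin (n + 1) → E n → ℝ}
    (hθ : ∀ i, ContDiff ℝ ∞ (θ i)) :
    ∑ i, weightedS2 (θ i) v = weightedS2 (fun x => ∑ i, θ i x) v := by
  have cθ := fun i => (hθ i).continuous
  have cb := (contDiff_bulkDensity hv).continuous
  have cd := (contDiff_bdryDensity hv).continuous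
  simp only [weightedS2, Finset.sum_add_distrib, Finset.sum_mul]
  rw [integral_finsetSum _ fun i _ => integrableOn_ball (by fun_prop),
    integral_finsetSum _ fun i _ => integrable_of_continuous_sphere (by fun_prop)]

/-- Stability, summed over the coordinates of a balanced conformal map. The weights `Yᵢ²` add up to
one on the sphere, and in the interior their values do not matter because `σ₂ = 0`. -/
theorem StableAlongCurves.balanced_inequality (hn : 4 ≤ n) {v v₀ : E n → ℝ}
    {Y : Fin (n + 1) → E n → ℝ} (h : StableAlongCurves v) (hv : ContDiff ℝ ∞ v)
    (hV : InV fun x => Real.exp (v x)) (hY : ConfCoords v₀ Y)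
    (h0 : ∀ i, ∫ x : sphere (0 : E n) 1, Y i x * Real.exp (n * v x) ∂(surfaceMeasure n) = 0) :
    (∫ x in B n, (3 * bulkDensity v x - (n : ℝ) *
        (Real.exp (((n : ℝ) - 3) * v x + 2 * v₀ x) * trSch v x))) +
      (∫ x : sphere (0 : E n) 1, (3 * bdryDensity v x - (n : ℝ) *
        (Real.exp (((n : ℝ) - 3) * v x) * (1 + rad v x) * Real.exp (2 * v₀ x)))
        ∂(surfaceMeasure n)) ≤ 0 := by
  have hω := omega_pos n
  have hb : ∀ x ∈ B n, bulkDensity v x = 0 := fun x hx => h.bulkDensity_eq_zero hn hv hV hx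
  have cY := fun i => (hY.smooth i).continuous
  have cv := hv.continuous
  have cv₀ := hY.smooth_factor.continuous
  have cb := (contDiff_bulkDensity hv).continuous
  have cd := (contDiff_bdryDensity hv).continuous
  have ct := (contDiff_trSch hv).continuous
  have cr := (contDiff_rad hv).continuous
  have cN := fun i => (contDiff_newton hv (hY.smooth i) (hY.smooth i)).continuous
  have cD := fun i => (contDiff_tanDot (hY.smooth i) (hY.smooth i)).continuous
  have hsum : 0 ≤ ∑ i, (secondVar v (Y i) - n * (weightedS2 (fun _ => 1) v *
      ((∫ x : sphere (0 : E n) 1, Y i x ^ 2 * Real.exp (n * v x) ∂(surfaceMeasure n)) /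
        omega n))) :=
    Finset.sum_nonneg fun i _ => (h.variation hn hv hV (hY.smooth i) (h0 i)).2
  have hbw : ∀ θ : E n → ℝ, ∫ x in B n, θ x * bulkDensity v x = 0 := fun θ => by
    rw [setIntegral_congr_fun measurableSet_closedBall (g := fun _ => 0) fun x hx => by
      simp [hb x hx]]
    simp
  have e1 : weightedS2 (fun _ => 1) v =
      ∫ x : sphere (0 : E n) 1, bdryDensity v x ∂(surfaceMeasure n) := by
    rw [weightedS2, hbw]
    simp
  have e2 : ∑ i, weightedS2 (fun y => Y i y * Y i y) v =
      ∫ x : sphere (0 : E n) 1, bdryDensity v x ∂(surfaceMeasure n) := by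
    rw [sum_weightedS2 hv fun i => (hY.smooth i).mul (hY.smooth i), weightedS2, hbw, zero_add]
    refine integral_congr_ae (Eventually.of_forall fun x => ?_)
    have := hY.sum_sq x x.2
    simp only [← pow_two, this, one_mul]
  have e3 : ∑ i, ∫ x in B n, Real.exp (((n : ℝ) - 3) * v x) * newton v (Y i) (Y i) x =
      n * ∫ x in B n, Real.exp (((n : ℝ) - 3) * v x + 2 * v₀ x) * trSch v x := by
    rw [← integral_finsetSum _ fun i _ => integrableOn_ball (by fun_prop), ← integral_const_mul]
    refine setIntegral_congr_fun measurableSet_closedBall fun x hx => ?_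
    simp only [← Finset.mul_sum]
    rw [hY.sum_newton v hx, Real.exp_add]
    ring
  have e4 : ∑ i, ∫ x : sphere (0 : E n) 1, Real.exp (((n : ℝ) - 3) * v x) * (1 + rad v x) *
        tanDot (Y i) (Y i) x ∂(surfaceMeasure n) =
      n * ∫ x : sphere (0 : E n) 1, Real.exp (((n : ℝ) - 3) * v x) * (1 + rad v x) *
        Real.exp (2 * v₀ x) ∂(surfaceMeasure n) := by
    rw [← integral_finsetSum _ fun i _ => integrable_of_continuous_sphere (by fun_prop),
      ← integral_const_mul]
    refine integral_congr_ae (Eventually.of_forall fun x => ?_)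
    simp only [← Finset.mul_sum]
    rw [hY.sum_tanDot x.2]
    ring
  have e5 : ∑ i, ∫ x : sphere (0 : E n) 1, Y i x ^ 2 * Real.exp (n * v x) ∂(surfaceMeasure n) =
      omega n := by
    have := hV.2
    rw [boundaryVol_confMetric] at this
    rw [← integral_finsetSum _ fun i _ => integrable_of_continuous_sphere (by fun_prop), ← this]
    refine integral_congr_ae (Eventually.of_forall fun x => ?_)
    simp only [← Finset.sum_mul]
    rw [hY.sum_sq x x.2, one_mul]
  simp only [Finset.sum_sub_distrib, ← Finset.mul_sum, ← Finset.sum_div, secondVar,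
    Finset.sum_add_distrib, e1, e2, e3, e4, e5, div_self hω.ne'] at hsum
  rw [integral_ball_sub (by fun_prop) (by fun_prop),
    integral_sub (integrable_of_continuous_sphere (by fun_prop))
      (integrable_of_continuous_sphere (by fun_prop))]
  simp only [integral_const_mul]
  have := hbw fun _ => 1
  simp only [one_mul] at this
  rw [this]
  linarith

/-! ### Dependence on the germ along the ball -/

/-- A function which is smooth on a neighbourhood of the ball has the same germ along the ball as
a function which is smooth on the whole space. -/
theorem exists_contDiff_eventuallyEq {F : Type*} [NormedAddCommGroup F] [NormedSpace ℝ F]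
    {U : Set (E n)} (hU : IsOpen U) (hB : B n ⊆ U) {f : E n → F} (hf : ContDiffOn ℝ ∞ f U) :
    ∃ g : E n → F, ContDiff ℝ ∞ g ∧ g =ᶠ[𝓝ˢ (B n)] f := by
  obtain ⟨δ, hδ, hδU⟩ := (isCompact_closedBall (0 : E n) 1).exists_cthickening_subset_open hU hB
  rw [cthickening_closedBall hδ.le zero_le_one] at hδU
  let χ : ContDiffBump (0 : E n) := ⟨1 + δ / 3, 1 + 2 * δ / 3, by linarith, by linarith⟩
  refine ⟨fun x => χ x • f x, contDiff_iff_contDiffAt.2 fun x => ?_, ?_⟩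
  · by_cases hx : x ∈ U
    · exact χ.contDiff.contDiffAt.smul (hf.contDiffAt (hU.mem_nhds hx))
    · have hx' : x ∉ tsupport χ := by
        rw [χ.tsupport_eq]
        refine fun h => hx (hδU (closedBall_subset_closedBall ?_ h))
        change 1 + 2 * δ / 3 ≤ δ + 1
        linarith
      have h0 : (fun y => χ y • f y) =ᶠ[𝓝 x] fun _ => 0 := by
        filter_upwards [notMem_tsupport_iff_eventuallyEq.1 hx'] with y hy
        rw [hy, Pi.zero_apply, zero_smul]
      exact contDiffAt_const.congr_of_eventuallyEq h0
  · have hsub : B n ⊆ ball (0 : E n) (1 + δ / 3) := closedBall_subset_ball (by linarith)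
    filter_upwards [isOpen_ball.mem_nhdsSet.2 hsub] with x hx
    rw [χ.one_of_mem_closedBall (ball_subset_closedBall hx), one_smul]

theorem eventuallyEq_nhds_of_mem {F : Type*} {f g : E n → F} (h : f =ᶠ[𝓝ˢ (B n)] g) {x : E n}
    (hx : x ∈ B n) : f =ᶠ[𝓝 x] g :=
  h.filter_mono (nhds_le_nhdsSet hx)

theorem christoffel_congr {g g' : Tensor2 n} {x : E n} (h : g =ᶠ[𝓝 x] g') (k i j : Fin (n + 1)) :
    christoffel g k i j =ᶠ[𝓝 x] christoffel g' k i j := by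
  have hp : ∀ a b c, pd a (fun y => g y b c) =ᶠ[𝓝 x] pd a fun y => g' y b c := fun a b c =>
    pd_congr (h.mono fun y hy => by simp only [hy]) a
  have hp' : ∀ᶠ y in 𝓝 x, ∀ a b c, pd a (fun y => g y b c) y = pd a (fun y => g' y b c) y :=
    eventually_all.2 fun a => eventually_all.2 fun b => eventually_all.2 fun c => hp a b c
  filter_upwards [h, hp'] with y hy hpy
  simp only [christoffel, hpy, hy]

theorem schouten_congr {g g' : Tensor2 n} {x : E n} (h : g =ᶠ[𝓝 x] g') :
    schouten g x = schouten g' x := by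
  have hr : ∀ i j, ricci g x i j = ricci g' x i j := fun i j => by
    have hc := fun k i j => (christoffel_congr h k i j).eq_of_nhds
    have hp := fun a k i j => (pd_congr (christoffel_congr h k i j) a).eq_of_nhds
    simp only [ricci, hc, hp]
  funext i j
  simp only [schouten, scalarCurv, hr, h.eq_of_nhds]

theorem sigma1_congr {g g' : Tensor2 n} {x : E n} (h : g =ᶠ[𝓝 x] g') :
    sigma1 g x = sigma1 g' x := by
  simp only [sigma1, schouten_congr h, h.eq_of_nhds]

theorem sigma2_congr {g g' : Tensor2 n} {x : E n} (h : g =ᶠ[𝓝 x] g') :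
    sigma2 g x = sigma2 g' x := by
  simp only [sigma2, schoutenNormSq, sigma1_congr h, schouten_congr h, h.eq_of_nhds]

theorem outwardNormal_congr {g g' : Tensor2 n} {x : E n} (h : g =ᶠ[𝓝 x] g') (i : Fin (n + 1)) :
    outwardNormal g i =ᶠ[𝓝 x] outwardNormal g' i := by
  filter_upwards [h] with y hy
  simp only [outwardNormal, conormalSq, hy]

theorem tangentialInverse_congr {g g' : Tensor2 n} {x : E n} (h : g =ᶠ[𝓝 x] g') :
    tangentialInverse g x = tangentialInverse g' x := by
  funext i j
  simp only [tangentialInverse, h.eq_of_nhds, (outwardNormal_congr h _).eq_of_nhds]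

theorem meanCurv_congr {g g' : Tensor2 n} {x : E n} (h : g =ᶠ[𝓝 x] g') :
    meanCurv g x = meanCurv g' x := by
  have hc := fun k i j => (christoffel_congr h k i j).eq_of_nhds
  have hν := fun i => (outwardNormal_congr h i).eq_of_nhds
  have hp := fun a i => (pd_congr (outwardNormal_congr h i) a).eq_of_nhds
  simp only [meanCurv, covDerivNormal, tangentialInverse_congr h, hc, hν, hp, h.eq_of_nhds]

theorem H2_congr {g g' : Tensor2 n} {x : E n} (h : g =ᶠ[𝓝 x] g') : H2 g x = H2 g' x := by
  simp only [H2, meanCurv_congr h, tangentialInverse_congr h, schouten_congr h]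

theorem areaDensity_congr {g g' : Tensor2 n} {x : E n} (h : g x = g' x) :
    areaDensity g x = areaDensity g' x := by
  simp only [areaDensity, conormalSq, h]

theorem S2_congr {g g' : Tensor2 n} (h : g =ᶠ[𝓝ˢ (B n)] g') : S2 g = S2 g' := by
  have h1 : ∀ x ∈ B n, sigma2 g x * volDensity g x = sigma2 g' x * volDensity g' x :=
    fun x hx => by
      have := eventuallyEq_nhds_of_mem h hx
      simp only [sigma2_congr this, volDensity, this.eq_of_nhds]
  have h2 : ∀ x : sphere (0 : E n) 1, H2 g x * areaDensity g x = H2 g' x * areaDensity g' x :=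
    fun x => by
      have := eventuallyEq_nhds_of_mem h (sphere_subset_closedBall x.2)
      rw [H2_congr this, areaDensity_congr this.eq_of_nhds]
  rw [S2, S2, setIntegral_congr_fun measurableSet_closedBall h1]
  simp only [h2]

theorem boundaryVol_congr {g g' : Tensor2 n} (h : g =ᶠ[𝓝ˢ (B n)] g') :
    boundaryVol g = boundaryVol g' := by
  have h2 : ∀ x : sphere (0 : E n) 1, areaDensity g x = areaDensity g' x := fun x =>
    areaDensity_congr (eventuallyEq_nhds_of_mem h (sphere_subset_closedBall x.2)).eq_of_nhds
  simp only [boundaryVol, h2]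

theorem confMetric_congr {u w : E n → ℝ} (h : u =ᶠ[𝓝ˢ (B n)] w) :
    confMetric u =ᶠ[𝓝ˢ (B n)] confMetric w := by
  filter_upwards [h] with x hx
  simp only [confMetric, hx]

theorem eq_on_ball {u w : E n → ℝ} (h : u =ᶠ[𝓝ˢ (B n)] w) {x : E n} (hx : x ∈ B n) : u x = w x :=
  (eventuallyEq_nhds_of_mem h hx).eq_of_nhds

theorem InV.congr {u w : E n → ℝ} (hu : InV u) (h : u =ᶠ[𝓝ˢ (B n)] w) (hw : ContDiff ℝ ∞ w) :
    InV w :=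
  ⟨⟨hw, fun x hx => eq_on_ball h hx ▸ hu.1.2 x hx⟩,
    boundaryVol_congr (confMetric_congr h) ▸ hu.2⟩

theorem InC1.congr {u w : E n → ℝ} (hu : InC1 u) (h : u =ᶠ[𝓝ˢ (B n)] w) (hw : ContDiff ℝ ∞ w) :
    InC1 w := by
  have hg := confMetric_congr h
  refine ⟨⟨hw, fun x hx => eq_on_ball h hx ▸ hu.1.2 x hx⟩, fun x hx => ?_, fun x hx => ?_⟩
  · rw [← sigma1_congr (eventuallyEq_nhds_of_mem hg hx)]
    exact hu.2.1 x hx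
  · rw [← meanCurv_congr (eventuallyEq_nhds_of_mem hg (sphere_subset_closedBall hx))]
    exact hu.2.2 x hx

theorem IsLocalMinimizer.congr {u w : E n → ℝ} (hu : IsLocalMinimizer u) (h : u =ᶠ[𝓝ˢ (B n)] w)
    (hw : ContDiff ℝ ∞ w) : IsLocalMinimizer w := by
  obtain ⟨hV, k, ε, hε, hmin⟩ := hu
  refine ⟨hV.congr h hw, k, ε, hε, fun z hz hzc => ?_⟩
  rw [← S2_congr (confMetric_congr h)]
  refine hmin z hz fun m hm x hx => ?_
  have he : (fun y => z y - u y) =ᶠ[𝓝 x] fun y => z y - w y := by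
    filter_upwards [eventuallyEq_nhds_of_mem h hx] with y hy
    rw [hy]
  rw [(he.iteratedFDeriv ℝ m).eq_of_nhds]
  exact hzc m hm x hx

theorem IsStableCritical.congr {u w : E n → ℝ} (hu : IsStableCritical u) (h : u =ᶠ[𝓝ˢ (B n)] w)
    (hw : ContDiff ℝ ∞ w) : IsStableCritical w :=
  ⟨hu.1.congr h hw, fun δ hδ W hW => hu.2 δ hδ W
    ⟨hW.1, hW.2.1, fun x hx => (hW.2.2 x hx).trans (eq_on_ball h hx).symm⟩⟩

/-- Up to its germ along the ball, a conformal factor is the exponential of a smooth function. -/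
theorem IsConfFactor.exists_exp {u : E n → ℝ} (hu : IsConfFactor u) :
    ∃ v : E n → ℝ, ContDiff ℝ ∞ v ∧ u =ᶠ[𝓝ˢ (B n)] fun x => Real.exp (v x) := by
  have hU : IsOpen {x | 0 < u x} := isOpen_lt continuous_const hu.1.continuous
  obtain ⟨v, hv, hvu⟩ := exists_contDiff_eventuallyEq hU hu.2
    (hu.1.contDiffOn.log fun x hx => (ne_of_gt hx : u x ≠ 0))
  refine ⟨v, hv, ?_⟩
  filter_upwards [hvu, hU.mem_nhdsSet.2 hu.2] with x hx hpos
  rw [hx, Real.exp_log hpos]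

/-! ### Poisson-type integrals over the sphere -/

theorem sum_mul_eq_inner (a x : E n) : ∑ i, a i * x i = inner ℝ a x := by
  rw [PiLp.inner_apply]
  exact Finset.sum_congr rfl fun i _ => by simp [mul_comm]

theorem sum_mul_self_eq_norm_sq (x : E n) : ∑ i, x i * x i = ‖x‖ ^ 2 := by
  rw [sum_mul_eq_inner, real_inner_self_eq_norm_sq]

theorem pd_inner (a : E n) (i : Fin (n + 1)) (x : E n) :
    pd i (fun y => inner ℝ a y) x = a i := by
  have : (fun y : E n => inner ℝ a y) = innerSL ℝ a := rfl
  rw [pd, this, ContinuousLinearMap.fderiv, innerSL_apply_apply, EuclideanSpace.inner_single_right]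
  simp

theorem pd_norm_sq (i : Fin (n + 1)) (x : E n) : pd i (fun y => ‖y‖ ^ 2) x = 2 * x i := by
  simp only [← sum_mul_self_eq_norm_sq]
  rw [pd_sum fun k => by fun_prop]
  simp only [fun k : Fin (n + 1) => pd_mul ((contDiff_coord k).differentiableAt_top x)
    ((contDiff_coord k).differentiableAt_top x) i, pd_coord]
  simp [Finset.sum_add_distrib]
  ring

theorem pd_inv {f : E n → ℝ} {x : E n} (hf : DifferentiableAt ℝ f x) (h0 : f x ≠ 0)
    (i : Fin (n + 1)) : pd i (fun y => (f y)⁻¹) x = -((f x)⁻¹ ^ 2 * pd i f x) := by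
  have := ((hasDerivAt_inv h0).comp_hasFDerivAt x hf.hasFDerivAt).fderiv
  simp only [Function.comp_def] at this
  simp only [pd, this]
  simp

/-- A smooth function of `x`, positive for `‖b‖ < 1`, which is `‖x - b‖²` on the unit sphere. -/
def cdist (b x : E n) : ℝ := ‖x‖ ^ 2 - 2 * inner ℝ b x + ‖b‖ ^ 2 + (1 - ‖x‖ ^ 2) ^ 2

theorem cdist_pos {b : E n} (hb : ‖b‖ < 1) (x : E n) : 0 < cdist b x := by
  have h1 := real_inner_le_norm b x
  rcases eq_or_ne ‖x‖ 1 with hx | hx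
  · rw [cdist, hx]
    rw [hx] at h1
    nlinarith [sq_pos_of_pos (sub_pos.2 hb)]
  · have h2 : 0 < (1 - ‖x‖ ^ 2) ^ 2 := by
      refine sq_pos_of_ne_zero fun h => hx ?_
      have : ‖x‖ ^ 2 = 1 := by linarith
      exact (pow_eq_one_iff_of_nonneg (norm_nonneg x) two_ne_zero).1 this
    rw [cdist]
    nlinarith [sq_nonneg (‖x‖ - ‖b‖)]

theorem cdist_sphere (b : E n) {x : E n} (hx : x ∈ sphere (0 : E n) 1) :
    cdist b x = 1 - 2 * inner ℝ b x + ‖b‖ ^ 2 := by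
  rw [cdist, mem_sphere_zero_iff_norm.1 hx]
  ring

/-- The reciprocal of `cdist`. -/
def invDist (b x : E n) : ℝ := (cdist b x)⁻¹

theorem invDist_pos {b : E n} (hb : ‖b‖ < 1) (x : E n) : 0 < invDist b x := inv_pos.2 (cdist_pos hb x)

theorem invDist_mul_cdist {b : E n} (hb : ‖b‖ < 1) (x : E n) : invDist b x * cdist b x = 1 :=
  inv_mul_cancel₀ (cdist_pos hb x).ne'

theorem contDiff_cdist (b : E n) : ContDiff ℝ ∞ (cdist b) := by
  unfold cdist
  have : ContDiff ℝ ∞ fun x : E n => ‖x‖ ^ 2 := contDiff_norm_sq ℝ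
  have : ContDiff ℝ ∞ fun x : E n => inner ℝ b x := contDiff_const.inner ℝ contDiff_id
  fun_prop

theorem continuous_cdist : Continuous fun p : E n × E n => cdist p.1 p.2 := by
  unfold cdist
  fun_prop

theorem pd_cdist (b : E n) (i : Fin (n + 1)) {x : E n} (hx : x ∈ sphere (0 : E n) 1) :
    pd i (cdist b) x = 2 * x i - 2 * b i := by
  have c1 : ContDiff ℝ ∞ fun x : E n => ‖x‖ ^ 2 := contDiff_norm_sq ℝ
  have c2 : ContDiff ℝ ∞ fun x : E n => inner ℝ b x := contDiff_const.inner ℝ contDiff_id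
  have d1 := c1.differentiableAt_top x
  have d2 := c2.differentiableAt_top x
  have : cdist b = fun x => ‖x‖ ^ 2 - 2 * inner ℝ b x + ‖b‖ ^ 2 + (1 - ‖x‖ ^ 2) ^ 2 := rfl
  rw [this, pd_add (by fun_prop) (by fun_prop), pd_add (by fun_prop) (by fun_prop),
    pd_sub (by fun_prop) (by fun_prop), pd_norm_sq, pd_const,
    pd_pow (f := fun x => 1 - ‖x‖ ^ 2) (by fun_prop), pd_sub (by fun_prop) (by fun_prop),
    pd_const_mul _ d2, pd_inner, pd_norm_sq, pd_const, mem_sphere_zero_iff_norm.1 hx]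
  norm_num

/-- The mean of the divergence of the tangential field `|x - b|^{-2n} (w - ⟨w, x⟩ x)`. -/
theorem integral_cdist_inner (hn : n ≠ 0) {b : E n} (hb : ‖b‖ < 1) (w : E n) :
    ∫ x : sphere (0 : E n) 1, invDist b x ^ (n + 1) *
      ((1 + ‖b‖ ^ 2) * inner ℝ w (x : E n) - 2 * inner ℝ b w) ∂(surfaceMeasure n) = 0 := by
  simp only [invDist]
  have c1 : ContDiff ℝ ∞ fun x : E n => ‖x‖ ^ 2 := contDiff_norm_sq ℝ
  have c2 : ContDiff ℝ ∞ fun x : E n => inner ℝ w x := contDiff_const.inner ℝ contDiff_id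
  have c3 := contDiff_cdist b
  have c4 : ContDiff ℝ ∞ fun x => (cdist b x)⁻¹ := c3.inv fun x => (cdist_pos hb x).ne'
  have hV : ∀ i : Fin (n + 1), ContDiff ℝ ∞ fun x : E n =>
      (cdist b x)⁻¹ ^ n * (‖x‖ ^ 2 * w i - inner ℝ w x * x i) := fun i => by fun_prop
  have ht : ∀ x : E n, ∑ i, x i * ((cdist b x)⁻¹ ^ n * (‖x‖ ^ 2 * w i - inner ℝ w x * x i)) = 0 := by
    intro x
    have e : ∀ i, x i * ((cdist b x)⁻¹ ^ n * (‖x‖ ^ 2 * w i - inner ℝ w x * x i)) =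
        (cdist b x)⁻¹ ^ n * (‖x‖ ^ 2 * (w i * x i) - inner ℝ w x * (x i * x i)) := fun i => by ring
    simp only [e, ← Finset.mul_sum, Finset.sum_sub_distrib, sum_mul_eq_inner,
      real_inner_self_eq_norm_sq]
    ring
  have h := integral_sphere_div_eq_zero hV ht
  have hpt : ∀ x : sphere (0 : E n) 1,
      ∑ i, pd i (fun x : E n => (cdist b x)⁻¹ ^ n * (‖x‖ ^ 2 * w i - inner ℝ w x * x i)) x =
      -(n : ℝ) * ((cdist b x)⁻¹ ^ (n + 1) *
        ((1 + ‖b‖ ^ 2) * inner ℝ w (x : E n) - 2 * inner ℝ b w)) := by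
    rintro ⟨x, hx⟩
    have d1 := c1.differentiableAt_top x
    have d2 := c2.differentiableAt_top x
    have d3 := c3.differentiableAt_top x
    have d4 := c4.differentiableAt_top x
    have hne := (cdist_pos hb x).ne'
    have hpow : (cdist b x)⁻¹ ^ (n - 1) * (cdist b x)⁻¹ ^ 2 = (cdist b x)⁻¹ ^ (n + 1) := by
      rw [← pow_add]; congr 1; omega
    have hpow' : (cdist b x)⁻¹ ^ n = (cdist b x)⁻¹ ^ (n + 1) * cdist b x := by
      rw [pow_succ]; field_simp
    have e : ∀ i, pd i (fun x : E n => (cdist b x)⁻¹ ^ n * (‖x‖ ^ 2 * w i - inner ℝ w x * x i)) x =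
        (cdist b x)⁻¹ ^ (n + 1) * (-(n : ℝ) * (2 * (w i * x i) - 2 * (b i * w i) -
          inner ℝ w x * (2 * (x i * x i) - 2 * (b i * x i))) +
          cdist b x * (w i * x i - inner ℝ w x)) := by
      intro i
      have hx1 := mem_sphere_zero_iff_norm.1 hx
      rw [pd_mul (by fun_prop) (by fun_prop), pd_pow d4, pd_inv d3 hne, pd_cdist b i hx,
        pd_sub (by fun_prop) (by fun_prop), pd_mul (by fun_prop) (by fun_prop),
        pd_mul (by fun_prop) (by fun_prop), pd_norm_sq, pd_inner, pd_const, pd_coord, if_pos rfl,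
        hx1]
      linear_combination (-(n : ℝ) * (2 * x i - 2 * b i) * (w i - inner ℝ w x * x i)) * hpow +
        (w i * x i - inner ℝ w x) * hpow'
    simp only [e, ← Finset.mul_sum, Finset.sum_sub_distrib, Finset.sum_add_distrib,
      sum_mul_eq_inner, real_inner_self_eq_norm_sq, mem_sphere_zero_iff_norm.1 hx,
      Finset.sum_const, Finset.card_univ, Fintype.card_fin, nsmul_eq_mul, cdist_sphere b hx]
    push_cast
    ring
  simp only [hpt, integral_const_mul] at h
  exact (mul_eq_zero.1 h).resolve_left (by simpa using hn)

/-- The path `θ ↦ sin θ • a` from the origin to `a` stays in the open ball for all real `θ`, so that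
no domain restriction is needed when integrals along it are differentiated. -/
theorem norm_sin_smul_lt {a : E n} (ha : ‖a‖ < 1) (θ : ℝ) : ‖Real.sin θ • a‖ < 1 := by
  rw [norm_smul, Real.norm_eq_abs]
  exact (mul_le_of_le_one_left (norm_nonneg a) (Real.abs_sin_le_one θ)).trans_lt ha

theorem one_sub_norm_sq_pos {a : E n} (ha : ‖a‖ < 1) : 0 < 1 - ‖a‖ ^ 2 := by
  have := norm_nonneg a
  nlinarith

theorem norm_smul_sq (s : ℝ) (a : E n) : ‖s • a‖ ^ 2 = s ^ 2 * ‖a‖ ^ 2 := by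
  rw [norm_smul, mul_pow, Real.norm_eq_abs, sq_abs]

theorem cdist_smul_sphere (s : ℝ) (a : E n) {x : E n} (hx : x ∈ sphere (0 : E n) 1) :
    cdist (s • a) x = 1 - 2 * (s * inner ℝ a x) + s ^ 2 * ‖a‖ ^ 2 := by
  rw [cdist_sphere _ hx, real_inner_smul_left, norm_smul_sq]

theorem integral_sphere_one (n : ℕ) : ∫ _ : sphere (0 : E n) 1, (1 : ℝ) ∂(surfaceMeasure n) =
    omega n := by
  simp [omega]

theorem continuous_invDist_right {a : E n} (ha : ‖a‖ < 1) : Continuous (invDist a) :=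
  (contDiff_cdist a).continuous.inv₀ fun x => (cdist_pos ha x).ne'

theorem continuous_invDist {β : ℝ → E n} (hβ : Continuous β) (h1 : ∀ t, ‖β t‖ < 1) :
    Continuous fun p : ℝ × E n => invDist (β p.1) p.2 :=
  (continuous_cdist.comp (by fun_prop : Continuous fun p : ℝ × E n => (β p.1, p.2))).inv₀
    fun p => (cdist_pos (h1 p.1) p.2).ne'

theorem hasDerivAt_cdist_sin (a : E n) {x : E n} (hx : x ∈ sphere (0 : E n) 1) (θ : ℝ) :
    HasDerivAt (fun θ => cdist (Real.sin θ • a) x)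
      (Real.cos θ * (-2 * inner ℝ a x + 2 * (Real.sin θ * ‖a‖ ^ 2))) θ := by
  simp only [cdist_smul_sphere _ a hx]
  have hs := Real.hasDerivAt_sin θ
  refine ((((hs.mul_const (inner ℝ a x)).const_mul 2).const_sub 1).add
    ((hs.pow 2).mul_const (‖a‖ ^ 2))).congr_deriv ?_
  push_cast
  ring

/-- The conformal factor of a conformal diffeomorphism of the ball has constant boundary volume. -/
theorem integral_poisson (hn : n ≠ 0) {a : E n} (ha : ‖a‖ < 1) :
    ∫ x : sphere (0 : E n) 1, ((1 - ‖a‖ ^ 2) * invDist a x) ^ n ∂(surfaceMeasure n) =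
      omega n := by
  have hb := norm_sin_smul_lt ha
  have cβ : Continuous fun θ : ℝ => Real.sin θ • a := by fun_prop
  have cinv := continuous_invDist cβ hb
  have cinv' := fun θ => continuous_invDist_right (hb θ)
  have hd : ∀ t : ℝ, ∀ x ∈ sphere (0 : E n) 1,
      HasDerivAt (fun θ : ℝ => ((1 - ‖Real.sin θ • a‖ ^ 2) * invDist (Real.sin θ • a) x) ^ n)
        (2 * n * Real.cos t * (1 - ‖Real.sin t • a‖ ^ 2) ^ (n - 1) *
          (invDist (Real.sin t • a) x ^ (n + 1) * ((1 + ‖Real.sin t • a‖ ^ 2) * inner ℝ a x -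
            2 * inner ℝ (Real.sin t • a) a))) t := by
    intro t x hx
    have hne := (cdist_pos (hb t) x).ne'
    have hs := Real.hasDerivAt_sin t
    have h1 : HasDerivAt (fun θ : ℝ => 1 - ‖Real.sin θ • a‖ ^ 2)
        (-(2 * Real.sin t * Real.cos t * ‖a‖ ^ 2)) t := by
      simp only [norm_smul_sq]
      refine (((hs.pow 2).mul_const _).const_sub 1).congr_deriv ?_
      push_cast
      ring
    have h2 : HasDerivAt (fun θ : ℝ => invDist (Real.sin θ • a) x) (-(Real.cos t *
        (-2 * inner ℝ a x + 2 * (Real.sin t * ‖a‖ ^ 2)) * invDist (Real.sin t • a) x ^ 2)) t := by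
      refine ((hasDerivAt_cdist_sin a hx t).fun_inv hne).congr_deriv ?_
      rw [invDist, inv_pow, neg_div, div_eq_mul_inv]
    refine ((h1.fun_mul h2).fun_pow n).congr_deriv ?_
    have hpow : invDist (Real.sin t • a) x ^ (n + 1) =
        invDist (Real.sin t • a) x ^ (n - 1) * invDist (Real.sin t • a) x ^ 2 := by
      rw [← pow_add]; congr 1; omega
    have hr := cdist_smul_sphere (Real.sin t) a hx
    have hinv := invDist_mul_cdist (hb t) x
    rw [hr] at hinv
    rw [hpow, mul_pow, real_inner_smul_left, real_inner_self_eq_norm_sq, norm_smul_sq]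
    linear_combination (n * (1 - Real.sin t ^ 2 * ‖a‖ ^ 2) ^ (n - 1) *
      invDist (Real.sin t • a) x ^ (n - 1) * invDist (Real.sin t • a) x * (2 * Real.sin t * Real.cos t * ‖a‖ ^ 2)) * hinv
  have hder := fun θ => hasDerivAt_sphereIntegral (n := n) (fun θ => by fun_prop) (by fun_prop) hd θ
  simp only [integral_const_mul, integral_cdist_inner hn (hb _), mul_zero] at hder
  -- The derivative is a tangential divergence; compare `θ = π / 2` with `θ = 0`.
  have hc := is_const_of_deriv_eq_zero (fun θ => (hder θ).differentiableAt)
    (fun θ => (hder θ).deriv) (Real.pi / 2) 0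
  simp only [Real.sin_pi_div_two, one_smul, Real.sin_zero, zero_smul] at hc
  rw [hc, ← integral_sphere_one]
  refine integral_congr_ae (Eventually.of_forall fun x => ?_)
  simp [invDist, cdist_sphere _ x.2]

theorem integral_cdist_inv_le (hn : n ≠ 0) {a : E n} (ha : ‖a‖ < 1) :
    ∫ x : sphere (0 : E n) 1, (1 - ‖a‖ ^ 2) * invDist a x ∂(surfaceMeasure n) ≤ omega n := by
  have hc := continuous_invDist_right ha
  have hle : ∫ x : sphere (0 : E n) 1, (1 + n * ((1 - ‖a‖ ^ 2) * invDist a x - 1))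
      ∂(surfaceMeasure n) ≤
      ∫ x : sphere (0 : E n) 1, ((1 - ‖a‖ ^ 2) * invDist a x) ^ n ∂(surfaceMeasure n) := by
    refine integral_mono (integrable_of_continuous_sphere (by fun_prop))
      (integrable_of_continuous_sphere (by fun_prop)) fun x => ?_
    have h0 : 0 < (1 - ‖a‖ ^ 2) * invDist a x :=
      mul_pos (one_sub_norm_sq_pos ha) (invDist_pos ha x)
    -- Bernoulli's inequality reduces the claim to `integral_poisson`.
    have := one_add_mul_le_pow (a := (1 - ‖a‖ ^ 2) * invDist a x - 1) (by linarith) n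
    simpa using this
  rw [integral_poisson hn ha, integral_add (integrable_of_continuous_sphere (by fun_prop))
    (integrable_of_continuous_sphere (by fun_prop)), integral_const_mul,
    integral_sub (integrable_of_continuous_sphere (by fun_prop))
    (integrable_of_continuous_sphere (by fun_prop)), integral_sphere_one] at hle
  have hn' : (0 : ℝ) < n := by exact_mod_cast Nat.pos_of_ne_zero hn
  have : (n : ℝ) * ((∫ x : sphere (0 : E n) 1, (1 - ‖a‖ ^ 2) * invDist a x
    ∂(surfaceMeasure n)) - omega n) ≤ 0 := by linarith
  have := nonpos_of_mul_nonpos_right this hn'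
  linarith

/-- The mean of `log ‖x - a‖²` over the unit sphere increases along rays. -/
theorem integral_log_cdist_nonneg (hn : n ≠ 0) {a : E n} (ha : ‖a‖ < 1) :
    0 ≤ ∫ x : sphere (0 : E n) 1, Real.log (cdist a x) ∂(surfaceMeasure n) := by
  have hb := norm_sin_smul_lt ha
  have cβ : Continuous fun θ : ℝ => Real.sin θ • a := by fun_prop
  have cinv := continuous_invDist cβ hb
  have cinv' := fun θ => continuous_invDist_right (hb θ)
  have clog : ∀ θ : ℝ, Continuous fun x => Real.log (cdist (Real.sin θ • a) x) := fun θ =>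
    (contDiff_cdist _).continuous.log fun x => (cdist_pos (hb θ) x).ne'
  have hd : ∀ t : ℝ, ∀ x ∈ sphere (0 : E n) 1,
      HasDerivAt (fun θ : ℝ => Real.log (cdist (Real.sin θ • a) x))
        (Real.cos t * (-2 * inner ℝ a x + 2 * (Real.sin t * ‖a‖ ^ 2)) *
          invDist (Real.sin t • a) x) t := fun t x hx =>
    ((hasDerivAt_cdist_sin a hx t).log (cdist_pos (hb t) x).ne').congr_deriv (div_eq_mul_inv _ _)
  have hder := fun θ => hasDerivAt_sphereIntegral (n := n) clog (by fun_prop) hd θ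
  have hmono := monotoneOn_of_deriv_nonneg (convex_Icc 0 (Real.pi / 2))
    (fun θ _ => (hder θ).continuousAt.continuousWithinAt)
    (fun θ _ => (hder θ).differentiableAt.differentiableWithinAt) (fun θ hθ => by
      rw [interior_Icc] at hθ
      have hsin : 0 < Real.sin θ := Real.sin_pos_of_pos_of_lt_pi hθ.1 (by linarith [hθ.2, Real.pi_pos])
      have hcos : 0 ≤ Real.cos θ :=
        Real.cos_nonneg_of_neg_pi_div_two_le_of_le (by linarith [hθ.1, Real.pi_pos]) hθ.2.le
      rw [(hder θ).deriv]
      -- After multiplication by `sin θ` the derivative is `cos θ` times the defect in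
      -- `integral_cdist_inv_le`.
      refine nonneg_of_mul_nonneg_right ?_ hsin
      rw [← integral_const_mul]
      have e : ∀ x : sphere (0 : E n) 1, Real.sin θ * (Real.cos θ * (-2 * inner ℝ a (x : E n) +
          2 * (Real.sin θ * ‖a‖ ^ 2)) * invDist (Real.sin θ • a) x) =
          Real.cos θ * (1 - (1 - ‖Real.sin θ • a‖ ^ 2) * invDist (Real.sin θ • a) x) := by
        intro x
        have hinv := invDist_mul_cdist (hb θ) (x : E n)
        rw [cdist_smul_sphere (Real.sin θ) a x.2] at hinv
        rw [norm_smul_sq]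
        linear_combination Real.cos θ * hinv
      simp only [e]
      have := cinv' θ
      rw [integral_const_mul, integral_sub (integrable_of_continuous_sphere (by fun_prop))
        (integrable_of_continuous_sphere (by fun_prop)), integral_sphere_one]
      have := integral_cdist_inv_le hn (hb θ)
      exact mul_nonneg hcos (by linarith))
  have h := hmono (left_mem_Icc.2 (by positivity)) (right_mem_Icc.2 (by positivity))
    (by positivity : (0 : ℝ) ≤ Real.pi / 2)
  simp only [Real.sin_pi_div_two, one_smul, Real.sin_zero, zero_smul] at h
  refine le_trans (le_of_eq ?_) h
  have : ∀ x : sphere (0 : E n) 1, Real.log (cdist 0 (x : E n)) = 0 := fun x => by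
    simp [cdist_sphere _ x.2]
  simp [this]

/-! ### Balancing -/

/-- The integral of `-log` of the conformal factor of a conformal diffeomorphism of the ball. Its
critical points are the balanced conformal diffeomorphisms. -/
def balanceEnergy (w : E n → ℝ) (b : E n) : ℝ :=
  ∫ x : sphere (0 : E n) 1, (Real.log (cdist b x) - Real.log (1 - ‖b‖ ^ 2)) * w x ∂(surfaceMeasure n)

theorem continuous_log_cdist {b : E n} (hb : ‖b‖ < 1) :
    Continuous fun x => Real.log (cdist b x) :=
  (contDiff_cdist b).continuous.log fun x => (cdist_pos hb x).ne'

theorem continuousOn_balanceEnergy {w : E n → ℝ} (hw : Continuous w) {r : ℝ} (hr : r < 1) :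
    ContinuousOn (balanceEnergy w) (closedBall (0 : E n) r) := by
  rw [continuousOn_iff_continuous_domRestrict]
  have hlt : ∀ b : closedBall (0 : E n) r, ‖(b : E n)‖ < 1 := fun b =>
    (mem_closedBall_zero_iff.1 b.2).trans_lt hr
  have c0 : Continuous fun p : closedBall (0 : E n) r × sphere (0 : E n) 1 =>
      cdist (p.1 : E n) (p.2 : E n) := by
    unfold cdist
    fun_prop
  have c1 : Continuous fun p : closedBall (0 : E n) r × sphere (0 : E n) 1 =>
      Real.log (cdist (p.1 : E n) (p.2 : E n)) :=
    c0.log fun p => (cdist_pos (hlt p.1) p.2).ne'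
  have c2 : Continuous fun p : closedBall (0 : E n) r × sphere (0 : E n) 1 =>
      Real.log (1 - ‖(p.1 : E n)‖ ^ 2) := by
    refine Continuous.log (by fun_prop) fun p => (one_sub_norm_sq_pos (hlt p.1)).ne'
  have c3 : Continuous fun p : closedBall (0 : E n) r × sphere (0 : E n) 1 =>
      (Real.log (cdist (p.1 : E n) (p.2 : E n)) - Real.log (1 - ‖(p.1 : E n)‖ ^ 2)) * w p.2 :=
    (c1.sub c2).mul (hw.comp (continuous_subtype_val.comp continuous_snd))
  have h := continuous_parametric_integral_of_continuous (X := closedBall (0 : E n) r)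
    (s := (univ : Set (sphere (0 : E n) 1))) (μ := surfaceMeasure n)
    (f := fun b x => (Real.log (cdist (b : E n) (x : E n)) - Real.log (1 - ‖(b : E n)‖ ^ 2)) * w x)
    c3 isCompact_univ
  rw [Measure.restrict_univ] at h
  exact h

theorem balanceEnergy_zero (w : E n → ℝ) : balanceEnergy w 0 = 0 := by
  have : ∀ x : sphere (0 : E n) 1, Real.log (cdist 0 (x : E n)) = 0 := fun x => by
    simp [cdist_sphere _ x.2]
  simp [balanceEnergy, this]

/-- The energy tends to infinity at the boundary of the ball. -/
theorem exists_le_balanceEnergy (hn : n ≠ 0) {w : E n → ℝ} (hw : Continuous w) : ∃ K : ℝ, ∀ b : E n, ‖b‖ < 1 →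
      K - Real.log (1 - ‖b‖ ^ 2) * ∫ x : sphere (0 : E n) 1, w x ∂(surfaceMeasure n) ≤
        balanceEnergy w b := by
  obtain ⟨m, hm⟩ := (isCompact_sphere (0 : E n) 1).exists_bound_of_continuousOn hw.continuousOn
  refine ⟨Real.log 4 * (∫ x : sphere (0 : E n) 1, w x ∂(surfaceMeasure n)) -
    m * (Real.log 4 * omega n), fun b hb => ?_⟩
  have cl : Continuous fun x : sphere (0 : E n) 1 => Real.log (cdist b x) :=
    Continuous.comp (g := fun x => Real.log (cdist b x)) (continuous_log_cdist hb)
      continuous_subtype_val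
  have hm0 : 0 ≤ m := by
    have : (univ : Set (sphere (0 : E n) 1)).Nonempty := by
      by_contra h
      have := omega_pos n
      rw [not_nonempty_iff_eq_empty] at h
      simp [omega, h] at this
    obtain ⟨x, _⟩ := this
    exact (norm_nonneg _).trans (hm x x.2)
  have hle : ∫ x : sphere (0 : E n) 1, (Real.log 4 * w x +
        m * (Real.log (cdist b x) - Real.log 4)) ∂(surfaceMeasure n) ≤
      ∫ x : sphere (0 : E n) 1, Real.log (cdist b x) * w x ∂(surfaceMeasure n) := by
    refine integral_mono (integrable_of_continuous_sphere (by fun_prop))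
      (integrable_of_continuous_sphere (by fun_prop)) fun x => ?_
    have h1 : Real.log (cdist b x) ≤ Real.log 4 := by
      refine Real.log_le_log (cdist_pos hb x) ?_
      rw [cdist_sphere b x.2]
      have := abs_le.1 (abs_real_inner_le_norm b x)
      rw [mem_sphere_zero_iff_norm.1 x.2, mul_one] at this
      nlinarith [norm_nonneg b]
    have h2 : w x ≤ m := (le_abs_self _).trans (hm x x.2)
    -- `cdist b x ≤ 4` on the sphere, so the density `w` may be replaced by its bound `m`.
    have : 0 ≤ (Real.log 4 - Real.log (cdist b x)) * (m - w x) :=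
      mul_nonneg (sub_nonneg.2 h1) (sub_nonneg.2 h2)
    change _ ≤ _
    linarith
  rw [integral_add (integrable_of_continuous_sphere (by fun_prop))
    (integrable_of_continuous_sphere (by fun_prop)), integral_const_mul, integral_const_mul,
    integral_sub (integrable_of_continuous_sphere (by fun_prop))
    (integrable_of_continuous_sphere (by fun_prop)), integral_const, smul_eq_mul] at hle
  have hl := mul_nonneg hm0 (integral_log_cdist_nonneg hn hb)
  have hom : (surfaceMeasure n).real univ = omega n := rfl
  rw [hom] at hle
  have he : balanceEnergy w b =
      (∫ x : sphere (0 : E n) 1, Real.log (cdist b x) * w x ∂(surfaceMeasure n)) -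
        Real.log (1 - ‖b‖ ^ 2) * ∫ x : sphere (0 : E n) 1, w x ∂(surfaceMeasure n) := by
    simp only [balanceEnergy, sub_mul]
    rw [integral_sub (integrable_of_continuous_sphere (by fun_prop))
      (integrable_of_continuous_sphere (by fun_prop)), integral_const_mul]
  rw [he]
  linarith

/-- The Euler–Lagrange equation of the energy, obtained along the path `a + ε sin θ • e`, which stays
in the ball of radius `r`. -/
theorem integral_eq_zero_of_isMinOn {w : E n → ℝ} (hw : Continuous w) {r : ℝ} (hr : r < 1)
    {a : E n} (ha : ‖a‖ < r) (hmin : IsMinOn (balanceEnergy w) (closedBall (0 : E n) r) a)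
    (e : E n) : ∫ x : sphere (0 : E n) 1, ((-2 * inner ℝ e (x : E n) + 2 * inner ℝ a e) *
      invDist a x + 2 * inner ℝ a e * (1 - ‖a‖ ^ 2)⁻¹) * w x ∂(surfaceMeasure n) = 0 := by
  set ε : ℝ := (r - ‖a‖) / (‖e‖ + 1) with hε
  have hεpos : 0 < ε := div_pos (sub_pos.2 ha) (by positivity)
  set β : ℝ → E n := fun θ => a + (ε * Real.sin θ) • e with hβ
  have cβ : Continuous β := by fun_prop
  have hβr : ∀ θ, ‖β θ‖ ≤ r := by
    intro θ
    refine (norm_add_le _ _).trans ?_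
    have h1 : ‖(ε * Real.sin θ) • e‖ ≤ ε * ‖e‖ := by
      rw [norm_smul, Real.norm_eq_abs, abs_mul, abs_of_pos hεpos, mul_assoc]
      exact mul_le_mul_of_nonneg_left
        (mul_le_of_le_one_left (norm_nonneg e) (Real.abs_sin_le_one θ)) hεpos.le
    have h2 : ε * (‖e‖ + 1) = r - ‖a‖ := div_mul_cancel₀ _ (by positivity)
    linarith
  have hb : ∀ θ, ‖β θ‖ < 1 := fun θ => (hβr θ).trans_lt hr
  have cinv := continuous_invDist cβ hb
  have cD : Continuous fun p : ℝ × E n => (1 - ‖β p.1‖ ^ 2)⁻¹ :=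
    (by fun_prop : Continuous fun p : ℝ × E n => 1 - ‖β p.1‖ ^ 2).inv₀
      fun p => (one_sub_norm_sq_pos (hb p.1)).ne'
  have hnorm : ∀ θ, ‖β θ‖ ^ 2 = ‖a‖ ^ 2 + 2 * (ε * Real.sin θ) * inner ℝ a e +
      (ε * Real.sin θ) ^ 2 * ‖e‖ ^ 2 := by
    intro θ
    rw [hβ, norm_add_sq_real, real_inner_smul_right, norm_smul_sq]
    ring
  have hs : ∀ θ, HasDerivAt (fun θ => ε * Real.sin θ) (ε * Real.cos θ) θ := fun θ =>
    (Real.hasDerivAt_sin θ).const_mul ε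
  have hdn : ∀ θ, HasDerivAt (fun θ => ‖β θ‖ ^ 2)
      (ε * Real.cos θ * (2 * inner ℝ a e + 2 * (ε * Real.sin θ) * ‖e‖ ^ 2)) θ := by
    intro θ
    simp only [hnorm]
    refine ((((hs θ).const_mul 2).mul_const (inner ℝ a e)).const_add (‖a‖ ^ 2) |>.add
      (((hs θ).fun_pow 2).mul_const (‖e‖ ^ 2))).congr_deriv ?_
    push_cast
    ring
  have hd : ∀ t, ∀ x ∈ sphere (0 : E n) 1,
      HasDerivAt (fun θ => (Real.log (cdist (β θ) x) - Real.log (1 - ‖β θ‖ ^ 2)) * w x)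
        ((ε * Real.cos t * (-2 * inner ℝ e x + 2 * inner ℝ a e + 2 * (ε * Real.sin t) * ‖e‖ ^ 2) *
          invDist (β t) x + ε * Real.cos t * (2 * inner ℝ a e + 2 * (ε * Real.sin t) * ‖e‖ ^ 2) *
          (1 - ‖β t‖ ^ 2)⁻¹) * w x) t := by
    intro t x hx
    have hin : HasDerivAt (fun θ => inner ℝ (β θ) x) (ε * Real.cos t * inner ℝ e x) t := by
      simp only [hβ, inner_add_left, real_inner_smul_left]
      exact ((hs t).mul_const _).const_add _
    have hc : HasDerivAt (fun θ => cdist (β θ) x) (ε * Real.cos t * (-2 * inner ℝ e x +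
        2 * inner ℝ a e + 2 * (ε * Real.sin t) * ‖e‖ ^ 2)) t := by
      simp only [cdist_sphere _ hx]
      exact (((hin.const_mul 2).const_sub 1).add (hdn t)).congr_deriv (by ring)
    refine (((hc.log (cdist_pos (hb t) x).ne').sub (((hdn t).const_sub 1).log
      (one_sub_norm_sq_pos (hb t)).ne')).mul_const (w x)).congr_deriv ?_
    rw [invDist, div_eq_mul_inv, div_eq_mul_inv]
    ring
  have hder := hasDerivAt_sphereIntegral (n := n) (fun θ => by
    have := continuous_log_cdist (hb θ)
    fun_prop) (by fun_prop) hd 0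
  have hβ0 : β 0 = a := by simp [hβ]
  have hloc : IsLocalMin (fun θ => balanceEnergy w (β θ)) 0 := by
    refine Eventually.of_forall fun θ => ?_
    simp only [hβ0]
    exact hmin (mem_closedBall_zero_iff.2 (hβr θ))
  have h0 := hloc.hasDerivAt_eq_zero hder
  simp only [hβ0, Real.cos_zero, Real.sin_zero, mul_one, mul_zero, zero_mul, add_zero,
    mul_assoc ε, ← mul_add ε, integral_const_mul] at h0
  exact (mul_eq_zero.1 h0).resolve_left hεpos.ne'

/-- Every positive density on the unit sphere is balanced by a conformal diffeomorphism of the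
ball: the image of the density has its centre of mass at the origin. -/
theorem exists_balanced (hn : n ≠ 0) {w : E n → ℝ} (hw : Continuous w)
    (hpos : ∀ x ∈ sphere (0 : E n) 1, 0 < w x) : ∃ a : E n, ‖a‖ < 1 ∧ ∀ i,
      ∫ x : sphere (0 : E n) 1, ((1 - ‖a‖ ^ 2) * ((x : E n) i - a i) * invDist a x - a i) * w x
        ∂(surfaceMeasure n) = 0 := by
  obtain ⟨K, hK⟩ := exists_le_balanceEnergy hn hw
  set M := ∫ x : sphere (0 : E n) 1, w x ∂(surfaceMeasure n) with hM
  have hM0 : 0 < M := by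
    have hne : (surfaceMeasure n) univ ≠ 0 := fun h => by
      have := omega_pos n
      simp [omega, Measure.real, h] at this
    refine (integral_pos_iff_support_of_nonneg (f := fun x : sphere (0 : E n) 1 => w x) (fun x => (hpos x x.2).le)
      (integrable_of_continuous_sphere (by fun_prop))).2 ?_
    rw [show (Function.support fun x : sphere (0 : E n) 1 => w x) = univ from
      eq_univ_of_forall fun x => (hpos x x.2).ne']
    exact pos_iff_ne_zero.2 hne
  -- The radius `r` is such that the lower bound `K - M log (1 - r ^ 2) = K + M L` is positive.
  set L : ℝ := |K| / M + 1 with hL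
  have hLpos : 0 < L := by positivity
  have hexp : Real.exp (-L) < 1 := Real.exp_lt_one_iff.2 (by linarith)
  set r : ℝ := √(1 - Real.exp (-L)) with hr
  have hr2 : r ^ 2 = 1 - Real.exp (-L) := Real.sq_sqrt (by linarith)
  have hr0 : 0 ≤ r := Real.sqrt_nonneg _
  have hr1 : r < 1 := by
    have := Real.exp_pos (-L)
    nlinarith
  obtain ⟨a, har, hmin⟩ := (isCompact_closedBall (0 : E n) r).exists_isMinOn
    (nonempty_closedBall.2 hr0) (continuousOn_balanceEnergy hw hr1)
  rw [mem_closedBall_zero_iff] at har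
  have hlt : ‖a‖ < r := by
    refine lt_of_le_of_ne har fun h => ?_
    have h1 := hK a (har.trans_lt hr1)
    have h2 : balanceEnergy w a ≤ balanceEnergy w 0 := hmin (mem_closedBall_self hr0)
    rw [balanceEnergy_zero] at h2
    rw [h, hr2, sub_sub_cancel, Real.log_exp] at h1
    have h3 : L * M = |K| + M := by rw [hL, add_mul, one_mul, div_mul_cancel₀ _ hM0.ne']
    have := neg_abs_le K
    linarith
  have ha1 := hlt.trans hr1
  refine ⟨a, ha1, fun i => ?_⟩
  have h := integral_eq_zero_of_isMinOn hw hr1 hlt hmin (EuclideanSpace.single i 1)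
  have hD := (one_sub_norm_sq_pos ha1).ne'
  have e : ∀ x : sphere (0 : E n) 1, ((1 - ‖a‖ ^ 2) * ((x : E n) i - a i) * invDist a x - a i) * w x =
      -((1 - ‖a‖ ^ 2) / 2) * (((-2 * inner ℝ (EuclideanSpace.single i 1) (x : E n) +
        2 * inner ℝ a (EuclideanSpace.single i 1)) * invDist a x +
        2 * inner ℝ a (EuclideanSpace.single i 1) * (1 - ‖a‖ ^ 2)⁻¹) * w x) := by
    intro x
    rw [EuclideanSpace.inner_single_left, EuclideanSpace.inner_single_right]
    simp only [map_one, one_mul, conj_trivial]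
    field_simp
    ring
  simp only [e, integral_const_mul, h, mul_zero]

/-! ### Conformal diffeomorphisms of the ball -/

/-- The denominator in the formula for a conformal diffeomorphism of the ball. -/
def mobDen (a x : E n) : ℝ := 1 - 2 * inner ℝ a x + ‖a‖ ^ 2 * ‖x‖ ^ 2

/-- The conformal diffeomorphism of the ball which maps `a` to the origin. -/
def mobius (a x : E n) : E n :=
  (mobDen a x)⁻¹ • ((1 - ‖a‖ ^ 2) • (x - a) - ‖x - a‖ ^ 2 • a)

/-- The logarithm of the conformal factor of `mobius a`. -/
def mobLog (a x : E n) : ℝ := Real.log (1 - ‖a‖ ^ 2) - Real.log (mobDen a x)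

theorem mobDen_eq (a x : E n) :
    mobDen a x = ‖x - a‖ ^ 2 + (1 - ‖x‖ ^ 2) * (1 - ‖a‖ ^ 2) := by
  rw [mobDen, norm_sub_sq_real, real_inner_comm]
  ring

theorem mobDen_pos {a x : E n} (ha : ‖a‖ < 1) (hx : x ∈ B n) : 0 < mobDen a x := by
  have hD := one_sub_norm_sq_pos ha
  have hx1 := mem_closedBall_zero_iff.1 hx
  rw [mobDen_eq]
  rcases hx1.lt_or_eq with h | h
  · have := one_sub_norm_sq_pos h
    positivity
  · have : x - a ≠ 0 := fun h0 => by
      rw [sub_eq_zero] at h0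
      rw [h0] at h
      linarith
    rw [h]
    have := norm_pos_iff.2 this
    norm_num
    positivity

theorem contDiff_mobDen (a : E n) : ContDiff ℝ ∞ (mobDen a) := by
  unfold mobDen
  have : ContDiff ℝ ∞ fun x : E n => ‖x‖ ^ 2 := contDiff_norm_sq ℝ
  have : ContDiff ℝ ∞ fun x : E n => inner ℝ a x := contDiff_const.inner ℝ contDiff_id
  fun_prop

theorem isOpen_mobDen_pos (a : E n) : IsOpen {x | 0 < mobDen a x} :=
  isOpen_lt continuous_const (contDiff_mobDen a).continuous

theorem contDiffOn_mobius (a : E n) : ContDiffOn ℝ ∞ (mobius a) {x | 0 < mobDen a x} := by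
  have h1 : ContDiff ℝ ∞ fun x : E n => ‖x - a‖ ^ 2 := (contDiff_id.sub contDiff_const).norm_sq ℝ
  have h2 : ContDiff ℝ ∞ fun x : E n => (1 - ‖a‖ ^ 2) • (x - a) - ‖x - a‖ ^ 2 • a := by fun_prop
  exact ((contDiff_mobDen a).contDiffOn.inv fun _ hx => ne_of_gt hx).smul h2.contDiffOn

theorem contDiffOn_mobLog (a : E n) : ContDiffOn ℝ ∞ (mobLog a) {x | 0 < mobDen a x} :=
  contDiffOn_const.sub ((contDiff_mobDen a).contDiffOn.log fun _ hx => ne_of_gt hx)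

theorem mobius_apply (a x : E n) (i : Fin (n + 1)) :
    mobius a x i = (mobDen a x)⁻¹ * ((1 - ‖a‖ ^ 2) * (x i - a i) - ‖x - a‖ ^ 2 * a i) := by
  simp [mobius]

/-- `|mobius a x| = |x - a| / √ρ` for the denominator `ρ`. -/
theorem norm_mobius_sq {a x : E n} (h : mobDen a x ≠ 0) :
    ‖mobius a x‖ ^ 2 = (mobDen a x)⁻¹ * ‖x - a‖ ^ 2 := by
  rw [mobius, norm_smul_sq, norm_sub_sq_real, norm_smul_sq, norm_smul_sq, real_inner_smul_left,
    real_inner_smul_right, inner_sub_left, real_inner_self_eq_norm_sq, real_inner_comm]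
  have h1 : (1 - ‖a‖ ^ 2) ^ 2 * ‖x - a‖ ^ 2 - 2 * ((1 - ‖a‖ ^ 2) * (‖x - a‖ ^ 2 *
      (inner ℝ a x - ‖a‖ ^ 2))) + (‖x - a‖ ^ 2) ^ 2 * ‖a‖ ^ 2 = mobDen a x * ‖x - a‖ ^ 2 := by
    have : ‖x - a‖ ^ 2 = ‖x‖ ^ 2 - 2 * inner ℝ a x + ‖a‖ ^ 2 := by
      rw [norm_sub_sq_real, real_inner_comm]
    rw [mobDen, this]
    ring
  rw [h1]
  field_simp

theorem one_sub_norm_mobius_sq {a x : E n} (h : mobDen a x ≠ 0) :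
    1 - ‖mobius a x‖ ^ 2 = (mobDen a x)⁻¹ * ((1 - ‖x‖ ^ 2) * (1 - ‖a‖ ^ 2)) := by
  rw [norm_mobius_sq h]
  have := mobDen_eq a x
  field_simp
  linarith

theorem mapsTo_mobius {a : E n} (ha : ‖a‖ < 1) : MapsTo (mobius a) (B n) (B n) := by
  intro x hx
  have hp := mobDen_pos ha hx
  have hD := one_sub_norm_sq_pos ha
  have h1 := mem_closedBall_zero_iff.1 hx
  have h := one_sub_norm_mobius_sq hp.ne'
  have : 0 ≤ 1 - ‖x‖ ^ 2 := by nlinarith [norm_nonneg x]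
  have : 0 ≤ (mobDen a x)⁻¹ * ((1 - ‖x‖ ^ 2) * (1 - ‖a‖ ^ 2)) := by positivity
  rw [mem_closedBall_zero_iff]
  nlinarith [norm_nonneg (mobius a x)]

theorem norm_mobius_of_sphere {a x : E n} (ha : ‖a‖ < 1) (hx : x ∈ sphere (0 : E n) 1) :
    ‖mobius a x‖ ^ 2 = 1 := by
  have h := one_sub_norm_mobius_sq (mobDen_pos ha (sphere_subset_closedBall hx)).ne'
  rw [mem_sphere_zero_iff_norm.1 hx] at h
  linarith

theorem mobius_neg_mobius {a x : E n} (ha : ‖a‖ < 1) (hx : x ∈ B n) :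
    mobius (-a) (mobius a x) = x := by
  have hp := (mobDen_pos ha hx).ne'
  have hD := (one_sub_norm_sq_pos ha).ne'
  have hR : (mobDen a x)⁻¹ * (1 - 2 * inner ℝ a x + ‖a‖ ^ 2 * ‖x‖ ^ 2) = 1 := inv_mul_cancel₀ hp
  have hP : ‖x - a‖ ^ 2 = ‖x‖ ^ 2 - 2 * inner ℝ a x + ‖a‖ ^ 2 := by
    rw [norm_sub_sq_real, real_inner_comm]
  have hin : inner ℝ a (mobius a x) = (mobDen a x)⁻¹ *
      ((1 - ‖a‖ ^ 2) * (inner ℝ a x - ‖a‖ ^ 2) - ‖x - a‖ ^ 2 * ‖a‖ ^ 2) := by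
    rw [mobius, real_inner_smul_right, inner_sub_right, real_inner_smul_right, inner_sub_right,
      real_inner_smul_right, real_inner_self_eq_norm_sq]
  have hden : mobDen (-a) (mobius a x) = (mobDen a x)⁻¹ * (1 - ‖a‖ ^ 2) ^ 2 := by
    rw [mobDen, inner_neg_left, norm_neg, hin, norm_mobius_sq hp, hP]
    linear_combination -hR
  have hN : ‖mobius a x - -a‖ ^ 2 = (mobDen a x)⁻¹ * ‖x - a‖ ^ 2 + 2 * ((mobDen a x)⁻¹ *
      ((1 - ‖a‖ ^ 2) * (inner ℝ a x - ‖a‖ ^ 2) - ‖x - a‖ ^ 2 * ‖a‖ ^ 2)) + ‖a‖ ^ 2 := by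
    rw [sub_neg_eq_add, norm_add_sq_real, norm_mobius_sq hp, real_inner_comm, hin]
  ext i
  rw [mobius_apply, hden, hN, norm_neg, PiLp.neg_apply, mobius_apply, hP]
  have hne : (mobDen a x)⁻¹ * (1 - ‖a‖ ^ 2) ^ 2 ≠ 0 := by positivity
  rw [inv_mul_eq_iff_eq_mul₀ hne]
  linear_combination (-a i) * hR

theorem pd_mobDen (a : E n) (i : Fin (n + 1)) (x : E n) :
    pd i (mobDen a) x = 2 * (‖a‖ ^ 2 * x i - a i) := by
  have c1 : ContDiff ℝ ∞ fun x : E n => ‖x‖ ^ 2 := contDiff_norm_sq ℝ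
  have c2 : ContDiff ℝ ∞ fun x : E n => inner ℝ a x := contDiff_const.inner ℝ contDiff_id
  have d1 := c1.differentiableAt_top x
  have d2 := c2.differentiableAt_top x
  have : mobDen a = fun x => 1 - 2 * inner ℝ a x + ‖a‖ ^ 2 * ‖x‖ ^ 2 := rfl
  rw [this, pd_add (by fun_prop) (by fun_prop), pd_sub (by fun_prop) (by fun_prop),
    pd_const_mul _ d2, pd_const_mul _ d1, pd_inner, pd_norm_sq, pd_const]
  ring

theorem pd_mobius (a : E n) (i b : Fin (n + 1)) {x : E n} (hx : mobDen a x ≠ 0) :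
    pd b (fun y => mobius a y i) x = (mobDen a x)⁻¹ * (1 - ‖a‖ ^ 2) * (if b = i then 1 else 0) -
      2 * (mobDen a x)⁻¹ * (x b - a b) * a i -
      2 * (mobDen a x)⁻¹ ^ 2 * (‖a‖ ^ 2 * x b - a b) *
        ((1 - ‖a‖ ^ 2) * (x i - a i) - ‖x - a‖ ^ 2 * a i) := by
  have c1 : ContDiff ℝ ∞ fun x : E n => ‖x‖ ^ 2 := contDiff_norm_sq ℝ
  have c2 : ContDiff ℝ ∞ fun x : E n => inner ℝ a x := contDiff_const.inner ℝ contDiff_id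
  have d1 := c1.differentiableAt_top x
  have d2 := c2.differentiableAt_top x
  have d3 := (contDiff_mobDen a).differentiableAt_top x
  have hP : ∀ y : E n, ‖y - a‖ ^ 2 = ‖y‖ ^ 2 - 2 * inner ℝ a y + ‖a‖ ^ 2 := fun y => by
    rw [norm_sub_sq_real, real_inner_comm]
  simp only [mobius_apply, hP]
  have dinv : DifferentiableAt ℝ (fun y => (mobDen a y)⁻¹) x := d3.inv hx
  rw [pd_mul dinv (by fun_prop), pd_inv d3 hx, pd_mobDen,
    pd_sub (by fun_prop) (by fun_prop), pd_const_mul _ (by fun_prop),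
    pd_sub (by fun_prop) (by fun_prop), pd_mul (by fun_prop) (by fun_prop),
    pd_add (by fun_prop) (by fun_prop), pd_sub (by fun_prop) (by fun_prop), pd_norm_sq,
    pd_const_mul _ d2, pd_inner, pd_const, pd_const, pd_coord]
  ring

theorem sum_mul_three_term (α : ℝ) (β γ a N : Fin (n + 1) → ℝ) (j k : Fin (n + 1)) :
    ∑ i, (α * (if j = i then 1 else 0) - β j * a i - γ j * N i) *
      (α * (if k = i then 1 else 0) - β k * a i - γ k * N i) =
    α ^ 2 * (if j = k then 1 else 0) - α * (β k * a j + β j * a k) - α * (γ k * N j + γ j * N k) +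
      β j * β k * (∑ i, a i * a i) + (β j * γ k + γ j * β k) * (∑ i, a i * N i) +
      γ j * γ k * ∑ i, N i * N i := by
  have e : ∀ i, (α * (if j = i then 1 else 0) - β j * a i - γ j * N i) *
      (α * (if k = i then 1 else 0) - β k * a i - γ k * N i) =
      (if j = i then α * (α * (if k = i then 1 else 0) - β k * a i - γ k * N i) else 0) -
      (if k = i then α * (β j * a i + γ j * N i) else 0) + β j * β k * (a i * a i) +
      (β j * γ k + γ j * β k) * (a i * N i) + γ j * γ k * (N i * N i) := by
    intro i
    split_ifs <;> ring
  simp only [e, Finset.sum_add_distrib, Finset.sum_sub_distrib, ← Finset.mul_sum,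
    Finset.sum_ite_eq, Finset.mem_univ, if_true, eq_comm (a := k) (b := j)]
  split_ifs <;> ring

/-- `mobius a` is conformal with factor `(1 - |a|²) / ρ`. -/
theorem sum_pd_mobius (a : E n) (j k : Fin (n + 1)) {x : E n} (hx : mobDen a x ≠ 0) :
    ∑ i, pd j (fun y => mobius a y i) x * pd k (fun y => mobius a y i) x =
      if j = k then ((1 - ‖a‖ ^ 2) * (mobDen a x)⁻¹) ^ 2 else 0 := by
  have hR : (mobDen a x)⁻¹ * (1 - 2 * inner ℝ a x + ‖a‖ ^ 2 * ‖x‖ ^ 2) = 1 := inv_mul_cancel₀ hx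
  have hP : ‖x - a‖ ^ 2 = ‖x‖ ^ 2 - 2 * inner ℝ a x + ‖a‖ ^ 2 := by
    rw [norm_sub_sq_real, real_inner_comm]
  have h1 : ∑ i, a i * ((1 - ‖a‖ ^ 2) * (x i - a i) - ‖x - a‖ ^ 2 * a i) =
      (1 - ‖a‖ ^ 2) * (inner ℝ a x - ‖a‖ ^ 2) - ‖x - a‖ ^ 2 * ‖a‖ ^ 2 := by
    rw [← sum_mul_self_eq_norm_sq a, ← sum_mul_eq_inner a x]
    simp only [mul_sub, Finset.sum_sub_distrib, Finset.mul_sum]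
    congr 1
    · congr 1 <;> exact Finset.sum_congr rfl fun i _ => by ring
    · exact Finset.sum_congr rfl fun i _ => by ring
  have h2 : ∑ i, ((1 - ‖a‖ ^ 2) * (x i - a i) - ‖x - a‖ ^ 2 * a i) *
      ((1 - ‖a‖ ^ 2) * (x i - a i) - ‖x - a‖ ^ 2 * a i) = mobDen a x * ‖x - a‖ ^ 2 := by
    have := norm_mobius_sq hx
    rw [← sum_mul_self_eq_norm_sq (mobius a x)] at this
    simp only [mobius_apply] at this
    have e : ∀ N : ℝ, (mobDen a x)⁻¹ * N * ((mobDen a x)⁻¹ * N) = (mobDen a x)⁻¹ ^ 2 * (N * N) :=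
      fun N => by ring
    simp only [e, ← Finset.mul_sum] at this
    refine mul_left_cancel₀ (pow_ne_zero 2 (inv_ne_zero hx)) (this.trans ?_)
    field_simp
  have h3 := sum_mul_three_term ((mobDen a x)⁻¹ * (1 - ‖a‖ ^ 2))
    (fun b => 2 * (mobDen a x)⁻¹ * (x b - a b))
    (fun b => 2 * (mobDen a x)⁻¹ ^ 2 * (‖a‖ ^ 2 * x b - a b)) a
    (fun i => (1 - ‖a‖ ^ 2) * (x i - a i) - ‖x - a‖ ^ 2 * a i) j k
  simp only [pd_mobius a _ _ hx]
  rw [h3, h1, h2, sum_mul_self_eq_norm_sq, mobDen, hP]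
  have hif : ∀ c : ℝ, (if j = k then c else 0) = c * if j = k then 1 else 0 := fun c => by simp
  rw [hif (_ ^ 2)]
  rw [mobDen] at hR
  generalize (1 - 2 * inner ℝ a x + ‖a‖ ^ 2 * ‖x‖ ^ 2)⁻¹ = R at *
  -- The left side is `R² E₀ + R³ E₁ + R⁴ ρ E₂` with `ρ E₀ + E₁ + E₂ = 0` and `R ρ = 1`.
  linear_combination (R ^ 3 * (4 * (‖x‖ ^ 2 - 2 * inner ℝ a x + ‖a‖ ^ 2) *
      (‖a‖ ^ 2 * x j - a j) * (‖a‖ ^ 2 * x k - a k)) -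
    R ^ 2 * (-2 * (1 - ‖a‖ ^ 2) * ((x k - a k) * a j + (x j - a j) * a k) +
      4 * ‖a‖ ^ 2 * (x j - a j) * (x k - a k))) * hR

theorem pd_mobLog (a : E n) (i : Fin (n + 1)) {x : E n} (hx : mobDen a x ≠ 0) :
    pd i (mobLog a) x = -(mobDen a x)⁻¹ * (2 * (‖a‖ ^ 2 * x i - a i)) := by
  have d3 := (contDiff_mobDen a).differentiableAt_top x
  have e : mobLog a = fun y => Real.log (1 - ‖a‖ ^ 2) - Real.log (mobDen a y) := rfl
  have hl := (d3.hasFDerivAt.log hx).fderiv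
  have : pd i (fun y => Real.log (mobDen a y)) x = (mobDen a x)⁻¹ * pd i (mobDen a) x := by
    simp only [pd, hl]
    simp
  rw [e, pd_sub (by fun_prop) (d3.log hx), pd_const, this, pd_mobDen]
  ring

theorem pd_pd_mobLog (a : E n) (i j : Fin (n + 1)) {x : E n} (hx : mobDen a x ≠ 0) :
    pd i (pd j (mobLog a)) x = (mobDen a x)⁻¹ ^ 2 * (2 * (‖a‖ ^ 2 * x i - a i)) *
      (2 * (‖a‖ ^ 2 * x j - a j)) -
      if i = j then 2 * (mobDen a x)⁻¹ * ‖a‖ ^ 2 else 0 := by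
  have d3 := (contDiff_mobDen a).differentiableAt_top x
  have dinv : DifferentiableAt ℝ (fun y => (mobDen a y)⁻¹) x := d3.inv hx
  have hev : pd j (mobLog a) =ᶠ[𝓝 x]
      fun y => -((mobDen a y)⁻¹ * (2 * (‖a‖ ^ 2 * y j - a j))) := by
    filter_upwards [(contDiff_mobDen a).continuous.continuousAt.eventually_ne hx] with y hy
    rw [pd_mobLog a j hy]
    ring
  rw [(pd_congr hev i).eq_of_nhds, pd_neg, pd_mul dinv (by fun_prop), pd_inv d3 hx, pd_mobDen,
    pd_const_mul _ (by fun_prop), pd_sub (by fun_prop) (by fun_prop),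
    pd_const_mul _ (by fun_prop), pd_coord, pd_const]
  split_ifs <;> ring

/-- The metric `(mobius a)^* dx²` is flat. -/
theorem sch_mobLog (a : E n) {x : E n} (hx : mobDen a x ≠ 0) (i j : Fin (n + 1)) :
    sch (mobLog a) x i j = 0 := by
  have hR : (mobDen a x)⁻¹ * (1 - 2 * inner ℝ a x + ‖a‖ ^ 2 * ‖x‖ ^ 2) = 1 := inv_mul_cancel₀ hx
  have hg : gradDot (mobLog a) (mobLog a) x = 4 * (mobDen a x)⁻¹ * ‖a‖ ^ 2 := by
    have e : ∀ i, pd i (mobLog a) x * pd i (mobLog a) x = 4 * (mobDen a x)⁻¹ ^ 2 *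
        (‖a‖ ^ 2 * ‖a‖ ^ 2 * (x i * x i) - 2 * ‖a‖ ^ 2 * (a i * x i) + a i * a i) := fun i => by
      rw [pd_mobLog a i hx]
      ring
    simp only [gradDot, e, ← Finset.mul_sum, Finset.sum_add_distrib, Finset.sum_sub_distrib,
      sum_mul_eq_inner, real_inner_self_eq_norm_sq]
    linear_combination (4 * (mobDen a x)⁻¹ * ‖a‖ ^ 2) * hR
  rw [sch, pd_pd_mobLog a i j hx, hg, pd_mobLog a i hx, pd_mobLog a j hx]
  split_ifs <;> ring

theorem exp_mobLog {a x : E n} (ha : ‖a‖ < 1) (hx : 0 < mobDen a x) :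
    Real.exp (mobLog a x) = (1 - ‖a‖ ^ 2) * (mobDen a x)⁻¹ := by
  rw [mobLog, Real.exp_sub, Real.exp_log (one_sub_norm_sq_pos ha), Real.exp_log hx, div_eq_mul_inv]

/-- The unit sphere has mean curvature one for `(mobius a)^* dx²`. -/
theorem rad_mobLog {a x : E n} (hx : mobDen a x ≠ 0) (h1 : x ∈ sphere (0 : E n) 1) :
    1 + rad (mobLog a) x = (1 - ‖a‖ ^ 2) * (mobDen a x)⁻¹ := by
  have hR : (mobDen a x)⁻¹ * (1 - 2 * inner ℝ a x + ‖a‖ ^ 2 * ‖x‖ ^ 2) = 1 := inv_mul_cancel₀ hx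
  have e : ∀ i, x i * pd i (mobLog a) x = -2 * (mobDen a x)⁻¹ *
      (‖a‖ ^ 2 * (x i * x i) - a i * x i) := fun i => by
    rw [pd_mobLog a i hx]
    ring
  simp only [rad, e, ← Finset.mul_sum, Finset.sum_sub_distrib, sum_mul_eq_inner,
    real_inner_self_eq_norm_sq]
  rw [mem_sphere_zero_iff_norm.1 h1] at hR ⊢
  linear_combination -hR

theorem mobDen_sphere (a : E n) {x : E n} (hx : x ∈ sphere (0 : E n) 1) :
    mobDen a x = cdist a x := by
  rw [mobDen, cdist_sphere a hx, mem_sphere_zero_iff_norm.1 hx]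
  ring

section Extension

variable {a : E n} {Φ : E n → E n} {v₀ : E n → ℝ}

theorem contDiff_apply {Φ : E n → E n} (hΦ : ContDiff ℝ ∞ Φ) (i : Fin (n + 1)) :
    ContDiff ℝ ∞ fun x => Φ x i :=
  (contDiff_coord i).comp hΦ

theorem exists_mobius_extension (ha : ‖a‖ < 1) :
    ∃ Φ : E n → E n, ContDiff ℝ ∞ Φ ∧ Φ =ᶠ[𝓝ˢ (B n)] mobius a :=
  exists_contDiff_eventuallyEq (isOpen_mobDen_pos a) (fun _ hx => mobDen_pos ha hx)
    (contDiffOn_mobius a)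

theorem exists_mobLog_extension (ha : ‖a‖ < 1) :
    ∃ v₀ : E n → ℝ, ContDiff ℝ ∞ v₀ ∧ v₀ =ᶠ[𝓝ˢ (B n)] mobLog a :=
  exists_contDiff_eventuallyEq (isOpen_mobDen_pos a) (fun _ hx => mobDen_pos ha hx)
    (contDiffOn_mobLog a)

theorem exp_extension (ha : ‖a‖ < 1) (h : v₀ =ᶠ[𝓝ˢ (B n)] mobLog a) {x : E n} (hx : x ∈ B n) :
    Real.exp (v₀ x) = (1 - ‖a‖ ^ 2) * (mobDen a x)⁻¹ := by
  rw [(eventuallyEq_nhds_of_mem h hx).eq_of_nhds, exp_mobLog ha (mobDen_pos ha hx)]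

theorem confCoords_mobius (ha : ‖a‖ < 1) (hΦs : ContDiff ℝ ∞ Φ) (hΦ : Φ =ᶠ[𝓝ˢ (B n)] mobius a)
    (hv₀s : ContDiff ℝ ∞ v₀) (hv₀ : v₀ =ᶠ[𝓝ˢ (B n)] mobLog a) :
    ConfCoords v₀ fun i x => Φ x i where
  smooth_factor := hv₀s
  smooth := contDiff_apply hΦs
  sum_sq x hx := by
    rw [(eventuallyEq_nhds_of_mem hΦ (sphere_subset_closedBall hx)).eq_of_nhds,
      ← norm_mobius_of_sphere ha hx, ← sum_mul_self_eq_norm_sq]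
    exact Finset.sum_congr rfl fun i _ => pow_two _
  conformal x hx j k := by
    have h : ∀ i, (fun y => Φ y i) =ᶠ[𝓝 x] fun y => mobius a y i := fun i =>
      (eventuallyEq_nhds_of_mem hΦ hx).mono fun y hy => by simp only [hy]
    simp only [fun i b => (pd_congr (h i) b).eq_of_nhds]
    have he : Real.exp (2 * v₀ x) = Real.exp (v₀ x) ^ 2 := by
      rw [← Real.exp_nat_mul]; norm_num
    rw [sum_pd_mobius a j k (mobDen_pos ha hx).ne', he, exp_extension ha hv₀ hx]

theorem flatPair_mobius (ha : ‖a‖ < 1) {v : E n → ℝ} (hv : ContDiff ℝ ∞ v)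
    (hv₀s : ContDiff ℝ ∞ v₀) (hv₀ : v₀ =ᶠ[𝓝ˢ (B n)] mobLog a) :
    FlatPair v fun x => v₀ x - v x where
  smooth_left := hv
  smooth_right := hv₀s.sub hv
  sch_eq x hx i j := by
    have h := eventuallyEq_nhds_of_mem hv₀ hx
    have h1 := fun k => (pd_congr h k).eq_of_nhds
    have h2 := fun k l => (pd_congr (pd_congr h k) l).eq_of_nhds
    simp only [add_sub_cancel]
    rw [← sch_mobLog a (mobDen_pos ha hx).ne' i j]
    simp only [sch, gradDot, h1, h2]
  exp_eq x hx := by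
    have hB : x ∈ B n := sphere_subset_closedBall hx
    have h := eventuallyEq_nhds_of_mem hv₀ hB
    have h1 := fun k => (pd_congr h k).eq_of_nhds
    have e : rad v₀ x = rad (mobLog a) x := by simp only [rad, h1]
    have e' : rad (fun x => v₀ x - v x) x = rad v₀ x - rad v x := by
      simp only [rad, ← Finset.sum_sub_distrib]
      refine Finset.sum_congr rfl fun i _ => ?_
      rw [pd_sub (hv₀s.differentiableAt_top x) (hv.differentiableAt_top x)]
      ring
    have := rad_mobLog (mobDen_pos ha hB).ne' hx
    rw [add_sub_cancel, exp_extension ha hv₀ hB, e', e]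
    linarith

theorem fderiv_apply_eq {Φ : E n → E n} (hΦ : ContDiff ℝ ∞ Φ) (x w : E n) (i : Fin (n + 1)) :
    fderiv ℝ Φ x w i = ∑ b, w b * pd b (fun y => Φ y i) x := by
  have hd : DifferentiableAt ℝ Φ x := (hΦ.differentiable (by simp)).differentiableAt
  have h := ((EuclideanSpace.proj i : E n →L[ℝ] ℝ).hasFDerivAt.comp x hd.hasFDerivAt).fderiv
  have e : ((EuclideanSpace.proj i : E n →L[ℝ] ℝ) ∘ Φ) = fun y => Φ y i := rfl
  rw [e] at h
  rw [← fderiv_eq_sum_pd, h]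
  simp

theorem ConfCoords.conformalAt (hΦs : ContDiff ℝ ∞ Φ) (h : ConfCoords v₀ fun i x => Φ x i)
    {x : E n} (hx : x ∈ B n) : ConformalAt Φ x := by
  have hd : DifferentiableAt ℝ Φ x := (hΦs.differentiable (by simp)).differentiableAt
  refine ⟨fderiv ℝ Φ x, hd.hasFDerivAt, (isConformalMap_iff _).2
    ⟨Real.exp (2 * v₀ x), Real.exp_pos _, fun y z => ?_⟩⟩
  have hb := h.sum_bilin hx fun a b => y a * z b
  rw [← sum_mul_eq_inner, ← sum_mul_eq_inner y z, ← hb]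
  refine Finset.sum_congr rfl fun i _ => ?_
  rw [fderiv_apply_eq hΦs, fderiv_apply_eq hΦs, Finset.sum_mul_sum]
  exact Finset.sum_congr rfl fun a _ => Finset.sum_congr rfl fun b _ => by ring

theorem isConfDiffeo_mobius (ha : ‖a‖ < 1) (hΦs : ContDiff ℝ ∞ Φ)
    (hΦ : Φ =ᶠ[𝓝ˢ (B n)] mobius a) (h : ConfCoords v₀ fun i x => Φ x i) : IsConfDiffeo Φ := by
  have ha' : ‖-a‖ < 1 := by rwa [norm_neg]
  obtain ⟨Ψ, hΨs, hΨ⟩ := exists_mobius_extension ha'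
  have eΦ : ∀ x ∈ B n, Φ x = mobius a x := fun x hx => (eventuallyEq_nhds_of_mem hΦ hx).eq_of_nhds
  have eΨ : ∀ x ∈ B n, Ψ x = mobius (-a) x := fun x hx =>
    (eventuallyEq_nhds_of_mem hΨ hx).eq_of_nhds
  refine ⟨hΦs, (mapsTo_mobius ha).congr fun x hx => (eΦ x hx).symm, fun x hx => ?_,
    fun x hx => h.conformalAt hΦs hx, Ψ, hΨs,
    (mapsTo_mobius ha').congr fun x hx => (eΨ x hx).symm, fun x hx => ?_, fun x hx => ?_⟩
  · rw [eΦ x (sphere_subset_closedBall hx), mem_sphere_zero_iff_norm]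
    exact (pow_eq_one_iff_of_nonneg (norm_nonneg _) two_ne_zero).1 (norm_mobius_of_sphere ha hx)
  · rw [eΦ x hx, eΨ _ (mapsTo_mobius ha hx), mobius_neg_mobius ha hx]
  · rw [eΨ x hx, eΦ _ (mapsTo_mobius ha' hx)]
    simpa using mobius_neg_mobius ha' hx

end Extension

/-! ### Conclusion -/

theorem StableAlongCurves.exists_isConfDiffeo (hn : n = 4 ∨ n = 5) {v : E n → ℝ}
    (hv : ContDiff ℝ ∞ v) (hC : InC1 fun x => Real.exp (v x)) (hV : InV fun x => Real.exp (v x))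
    (hs : StableAlongCurves v) :
    ∃ Φ : E n → E n, IsConfDiffeo Φ ∧
      ∀ x ∈ B n, confMetric (fun y => Real.exp (v y)) x = pullback Φ (flatMetric n) x := by
  have hn0 : n ≠ 0 := by omega
  have htr : ∀ x ∈ B n, 0 ≤ trSch v x := fun x hx => by
    have := hC.2.1 x hx
    rw [sigma1_confMetric (by omega) hv] at this
    exact nonneg_of_mul_nonneg_right this (Real.exp_pos _)
  have hH : ∀ x ∈ sphere (0 : E n) 1, 0 < 1 + rad v x := fun x hx => by
    have := hC.2.2 x hx
    rw [meanCurv_confMetric hn0 hv hx] at this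
    exact (mul_pos_iff_of_pos_left (Real.exp_pos _)).1 this
  have cv := hv.continuous
  obtain ⟨a, ha, hbal⟩ := exists_balanced hn0 (w := fun x : E n => Real.exp (n * v x))
    (by fun_prop) fun x _ => Real.exp_pos _
  obtain ⟨Φ, hΦs, hΦ⟩ := exists_mobius_extension ha
  obtain ⟨v₀, hv₀s, hv₀⟩ := exists_mobLog_extension ha
  have hY := confCoords_mobius ha hΦs hΦ hv₀s hv₀
  have hF := flatPair_mobius ha hv hv₀s hv₀
  have hbal' : ∀ i, ∫ x : sphere (0 : E n) 1, Φ x i * Real.exp (n * v x) ∂(surfaceMeasure n) =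
      0 := by
    intro i
    rw [← hbal i]
    refine integral_congr_ae (Eventually.of_forall fun x => ?_)
    have hx := x.2
    have hp := cdist_pos ha (x : E n)
    have e : ‖(x : E n) - a‖ ^ 2 = cdist a x := by
      have := mobDen_eq a (x : E n)
      rw [mobDen_sphere a hx, mem_sphere_zero_iff_norm.1 hx] at this
      linarith
    simp only [(eventuallyEq_nhds_of_mem hΦ (sphere_subset_closedBall hx)).eq_of_nhds,
      mobius_apply, e, mobDen_sphere a hx, invDist]
    field_simp
  have hineq := hs.balanced_inequality (by omega) hv hV hY hbal'
  have hconst : ∀ x ∈ B n, v₀ x - v x = v₀ 0 - v 0 := fun x hx =>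
    hF.eq_of_integral_nonpos hn (fun x hx => hs.bulkDensity_eq_zero (by omega) hv hV hx) htr hH
      (by simpa only [add_sub_cancel] using hineq) hx (mem_closedBall_self zero_le_one)
  set c := v₀ 0 - v 0 with hc
  have hvol : Real.exp (n * c) * omega n = omega n := by
    have h1 := hV.2
    rw [boundaryVol_confMetric] at h1
    conv_lhs => rw [← h1]
    rw [← integral_const_mul, ← integral_poisson hn0 ha]
    refine integral_congr_ae (Eventually.of_forall fun x => ?_)
    have hB : (x : E n) ∈ B n := sphere_subset_closedBall x.2
    have h2 := exp_extension ha hv₀ hB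
    rw [mobDen_sphere a x.2] at h2
    simp only [invDist]
    rw [← h2, ← Real.exp_nat_mul, ← Real.exp_add, ← hconst x hB]
    congr 1
    ring
  have hc0 : c = 0 := by
    have h1 : Real.exp (n * c) = 1 := mul_right_cancel₀ (omega_pos n).ne' (by rw [hvol, one_mul])
    have h2 : (n : ℝ) * c = 0 := Real.exp_eq_one_iff _ |>.1 h1
    exact (mul_eq_zero.1 h2).resolve_left (by exact_mod_cast hn0)
  refine ⟨Φ, isConfDiffeo_mobius ha hΦs hΦ hY, fun x hx => ?_⟩
  ext i j
  have hvx : v x = v₀ x := by linarith [hconst x hx]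
  rw [confMetric_exp_apply, hvx, ← hY.conformal x hx i j]
  simp [pullback, flatMetric, Matrix.one_apply]

theorem isFlatUpToConf_of_stableAlongCurves (hn : n = 4 ∨ n = 5) {u : E n → ℝ} (hC : InC1 u)
    (hV : InV u) (hs : ∀ v : E n → ℝ, ContDiff ℝ ∞ v → u =ᶠ[𝓝ˢ (B n)] (fun x => Real.exp (v x)) →
      StableAlongCurves v) : IsFlatUpToConf (confMetric u) := by
  obtain ⟨v, hv, huv⟩ := hC.1.exists_exp
  obtain ⟨Φ, hΦ, h⟩ := (hs v hv huv).exists_isConfDiffeo hn hv (hC.congr huv hv.exp)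
    (hV.congr huv hv.exp)
  exact ⟨Φ, hΦ, fun x hx =>
    (eventuallyEq_nhds_of_mem (confMetric_congr huv) hx).eq_of_nhds.trans (h x hx)⟩

end BallSigmaTwo

end

open BallSigmaTwo in
theorem theorem1 (n : ℕ) (hn : n = 4 ∨ n = 5) (u : E n → ℝ) (hC : InC1 u) :
    (IsLocalMinimizer u → IsFlatUpToConf (confMetric u)) ∧
      (IsStableCritical u → IsFlatUpToConf (confMetric u)) :=
  ⟨fun h => isFlatUpToConf_of_stableAlongCurves hn hC h.1 fun _ hv huv =>
      (h.congr huv hv.exp).stableAlongCurves,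
    fun h => isFlatUpToConf_of_stableAlongCurves hn hC h.1 fun _ hv huv =>
      (h.congr huv hv.exp).stableAlongCurves⟩
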